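/- **Setting.** Let $\Bbbk$ be a field; $\otimes=\otimes_\Bbbk$ and $\iota$ denotes identity maps. For a nondegenerate algebra $B$ let $M(B)$ be its multiplier algebra. A *multiplier bialgebra* is a nondegenerate algebra $B$ with a nondegenerate homomorphism $\Delta:B\to M(B\otimes B)$ (i.e. $\Delta(B)(B\otimes B)=B\otimes B=(B\otimes B)\Delta(B)$) which is coassociative and for which $\Delta(B)(1\otimes B)$, $\Delta(B)(B\otimes1)$, $(B\otimes1)\Delta(B)$, $(1\otimes B)\Delta(B)$ are contained in $B\otimes B$. It is a *multiplier Hopf algebra* if $a\otimes b\mapsto\Delta(a)(1\otimes b)$ and $a\otimes b\mapsto(a\otimes1)\Delta(b)$ are bijections of $B\otimes B$, and *regular* if moreover $(B,\sigma\Delta)$, $\sigma$ the flip, is a multiplier Hopf algebra. A *left* (resp. *right*) *counit* of $(B,\Delta)$ is a homomorphism $\varepsilon:B\to\Bbbk$ with $(\varepsilon\otimes\iota)\Delta=\iota$ (resp. $(\iota\otimes\varepsilon)\Delta=\iota$); a multiplier bialgebra is *counitary* if it has a left and a right counit. Let $(A,\Delta_A)$ and $(Y,\Delta_Y)$ be regular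 multiplier Hopf algebras with counits $\varepsilon_A,\varepsilon_Y$, with $A$ commutative. Let $Y$ be a symmetric partial $A$-comodule bialgebra via a linear map $\rho:Y\to M(A\otimes Y)$; that is, with $T(y\otimes a)=\rho(y)(a\otimes1)$ and $\overline T(a\otimes y)=(a\otimes 1)\rho(y)$, both assumed to lie in $A\otimes Y$: * (*symmetric partial comodule algebra*) $\rho$ is an injective homomorphism and there is an idempotent $E\in M(A\otimes Y)$ with $(A\otimes1)E,\ E(A\otimes1)\subseteq A\otimes M(Y)$, $\rho(Y)(A\otimes1)\subseteq E(A\otimes Y)$, $(A\otimes1)\rho(Y)\subseteq(A\otimes Y)E$ and, for all $y$, $(\iota\otimes\rho)\rho(y)=(1\otimes E)\,(\Delta_A\otimes\iota)\rho(y)=(\Delta_A\otimes\iota)\rho(y)\,(1\otimes E)$; * (*symmetric partial comodule coalgebra*) $(\varepsilon_A\otimes\iota)\rho(y)=y$; the elements $\big((\iota\otimes T)(\Delta_Y(y)\otimes a)\big)(1\otimes1\otimes y')$ and $(1\otimes1\otimes y')\big((\iota\otimes T)(\Delta_Y(y)\otimes a)\big)$ lie in $Y\otimes A\otimes Y$,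 and $\big((\overline T\otimes\iota)(a\otimes\Delta_Y(y))\big)(1\otimes y'\otimes1)$ lies in $A\otimes Y\otimes Y$; and, with $\tau$ denoting flips of tensor factors, $$(\iota_A\otimes\Delta_Y)T=(T\otimes\iota_Y)(\iota_Y\otimes T)(\Delta_Y\otimes\iota_A),$$ $$(\iota_A\otimes T)(T\otimes\iota_A)(\iota_Y\otimes\Delta_A)=\big((\iota_A\otimes\varepsilon_Y)T\otimes\iota_A\otimes\iota_Y\big)\big(\iota_Y\otimes(\Delta_A\otimes\iota_Y)T\big)(\Delta_Y\otimes\iota_A),$$ $$(\iota_A\otimes\overline T)(\iota_A\otimes\tau_{Y\otimes A})(\overline T\otimes\iota_A)(\iota_A\otimes\tau_{A\otimes Y})(\Delta_A\otimes\iota_Y)=\big((\iota_A\otimes\varepsilon_Y)\overline T\otimes\iota_A\otimes\iota_Y\big)(\iota_A\otimes\tau_{A\otimes Y,Y})\big((\Delta_A\otimes\iota_Y)\overline T\otimes\iota_Y\big)(\iota_A\otimes\Delta_Y).$$ Let $Y\rtimes A$ be the smash coproduct: the algebra $Y\otimes A$ with the map $\overline\Delta:Y\otimes A\to M\big((Y\otimes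 A)\otimes(Y\otimes A)\big)$ given, for $y,y',y''\in Y$ and $a,a',a''\in A$, by $$\overline\Delta(y\otimes a)\big((y'\otimes a')\otimes(y''\otimes a'')\big)=\Big(\big((\iota\otimes T)(\Delta_Y(y)\otimes a_{(1)})\big)(1\otimes1\otimes y'')\otimes a_{(2)}a''\Big)\big((y'\otimes a')\otimes(1\otimes 1)\big),$$ $$\big((y'\otimes a')\otimes(y''\otimes a'')\big)\overline\Delta(y\otimes a)=\big((1\otimes 1)\otimes(y''\otimes a'')\big)\Big(y'y_{(1)}\otimes(a'\otimes1\otimes1)\big((T\otimes\iota)(y_{(2)}\otimes\Delta_A(a))\big)\Big).$$ **Statement.** The map $\overline\Delta$ is well defined, and $(Y\otimes A,\overline\Delta)$ satisfies all axioms of a multiplier bialgebra except possibly the nondegeneracy of the homomorphism $\overline\Delta$. The map $\overline\varepsilon(y\otimes a)=\varepsilon_Y(y)\varepsilon_A(a)$ is a left counit of it. The subspace $$\overline{Y\rtimes A}=(\iota_Y\otimes\iota_A\otimes\overline\varepsilon)\overline\Delta(Y\rtimes A)=\operatorname{span}_{\Bbbk}\{(\iota\otimes\overline\varepsilon)(\overline\Delta(c)(1\otimes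 d)) : c,d\in Y\otimes A,\ \overline\varepsilon(d)=1\}$$ (the *partial smash coproduct*) is a subalgebra of $Y\otimes A$, the map $\overline\Delta$ restricts to a comultiplication on it, and with this restriction $\overline{Y\rtimes A}$ is a multiplier bialgebra (with nondegenerate comultiplication) for which the restriction of $\overline\varepsilon$ is both a left and a right counit; that is, $\overline{Y\rtimes A}$ is a counitary multiplier bialgebra. -/

import Mathlib

open scoped TensorProduct

namespace MultHopf

noncomputable section

/-! ### Nondegenerate algebras and multiplier algebras -/

/-- A (not necessarily unital) algebra is nondegenerate if its product is a nondegenerate pairing. -/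
def Nondegenerate (B : Type*) [NonUnitalRing B] : Prop :=
  (∀ a : B, (∀ b : B, a * b = 0) → a = 0) ∧ (∀ b : B, (∀ a : B, a * b = 0) → b = 0)

section Multiplier

variable (k : Type*) [Field k]
variable (B : Type*) [NonUnitalRing B] [Module k B] [SMulCommClass k B B] [IsScalarTower k B B]

/-- The multiplier algebra: pairs `(L, R)` of linear maps with `a * L b = R a * b`, and product
`(L, R) (L', R') = (L ∘ L', R' ∘ R)`. -/
def multiplierAlgebra : Subalgebra k (Module.End k B × (Module.End k B)ᵐᵒᵖ) where
  carrier := {m | ∀ a b : B, a * m.1 b = m.2.unop a * b}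
  mul_mem' := by
    intro m n hm hn a b
    change a * m.1 (n.1 b) = n.2.unop (m.2.unop a) * b
    rw [hm, hn]
  add_mem' := by
    intro m n hm hn a b
    change a * (m.1 b + n.1 b) = (m.2.unop a + n.2.unop a) * b
    rw [mul_add, add_mul, hm, hn]
  algebraMap_mem' := by
    intro r a b
    change a * (r • b) = (r • a) * b
    rw [mul_smul_comm, smul_mul_assoc]

/-- `M k B` is the multiplier algebra of `B`, a unital `k`-algebra. -/
abbrev M : Type _ := ↥(multiplierAlgebra k B)

end Multiplier

section MultiplierMaps

variable {k : Type*} [Field k]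
variable {B : Type*} [NonUnitalRing B] [Module k B] [SMulCommClass k B B] [IsScalarTower k B B]
variable {D : Type*} [NonUnitalRing D] [Module k D] [SMulCommClass k D D] [IsScalarTower k D D]

/-- `b ↦ m b`. -/
def M.left (m : M k B) : B →ₗ[k] B := m.1.1

/-- `b ↦ b m`. -/
def M.right (m : M k B) : B →ₗ[k] B := m.1.2.unop

theorem M.compat (m : M k B) (a b : B) : a * m.left b = m.right a * b := m.2 a b

/-- The multiplier with prescribed left and right actions. -/
def M.mk (L R : B →ₗ[k] B) (h : ∀ a b : B, a * L b = R a * b) : M k B :=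
  ⟨(L, MulOpposite.op R), h⟩

/-- The canonical map `B → M(B)`. -/
def emb : B →ₗ[k] M k B where
  toFun b := M.mk (LinearMap.mulLeft k b) (LinearMap.mulRight k b) (by
    intro x y; simp [mul_assoc])
  map_add' x y := by
    apply Subtype.ext
    refine Prod.ext ?_ (MulOpposite.unop_injective ?_) <;> ext z
    · exact add_mul x y z
    · exact mul_add z x y
  map_smul' r x := by
    apply Subtype.ext
    refine Prod.ext ?_ (MulOpposite.unop_injective ?_) <;> ext z
    · exact smul_mul_assoc r x z
    · exact mul_smul_comm r z x

/-- A linear left inverse of `emb`. It is used only on multipliers that lie in the range of `emb`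
(every use is accompanied by that condition), where, for nondegenerate `B`, it is the inverse
of the embedding `B ⊆ M(B)`. -/
def pull : M k B →ₗ[k] B := LinearMap.leftInverse (emb : B →ₗ[k] M k B)

/-- The multiplier `m ⊗ n` of `B ⊗ D`. -/
def tens (m : M k B) (n : M k D) : M k (B ⊗[k] D) :=
  M.mk (TensorProduct.map m.left n.left) (TensorProduct.map m.right n.right) (by
    intro x y
    induction x using TensorProduct.induction_on with
    | zero => simp
    | add x₁ x₂ h₁ h₂ => rw [add_mul, map_add, add_mul, h₁, h₂]
    | tmul b d =>
      induction y using TensorProduct.induction_on with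
      | zero => simp
      | add y₁ y₂ h₁ h₂ => rw [map_add, mul_add, mul_add, h₁, h₂]
      | tmul b' d' =>
        simp only [TensorProduct.map_tmul, Algebra.TensorProduct.tmul_mul_tmul, M.compat])

/-- The map `(m, n) ↦ m ⊗ n` from `M(B) × M(D)` to `M(B ⊗ D)` is bilinear. -/
def tensLin : M k B →ₗ[k] M k D →ₗ[k] M k (B ⊗[k] D) :=
  LinearMap.mk₂ k tens
    (by
      intro m m' n
      apply Subtype.ext
      exact Prod.ext (TensorProduct.map_add_left m.left m'.left n.left)
        (MulOpposite.unop_injective (TensorProduct.map_add_left m.right m'.right n.right)))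
    (by
      intro r m n
      apply Subtype.ext
      exact Prod.ext (TensorProduct.map_smul_left r m.left n.left)
        (MulOpposite.unop_injective (TensorProduct.map_smul_left r m.right n.right)))
    (by
      intro m n n'
      apply Subtype.ext
      exact Prod.ext (TensorProduct.map_add_right m.left n.left n'.left)
        (MulOpposite.unop_injective (TensorProduct.map_add_right m.right n.right n'.right)))
    (by
      intro r m n
      apply Subtype.ext
      exact Prod.ext (TensorProduct.map_smul_right r m.left n.left)
        (MulOpposite.unop_injective (TensorProduct.map_smul_right r m.right n.right)))

/-- For linear maps `φ : B → M(B')` and `ψ : D → M(D')`, the map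
`φ ⊗ ψ : B ⊗ D → M(B' ⊗ D')`, `b ⊗ d ↦ φ(b) ⊗ ψ(d)`. -/
def tensMap {B' : Type*} [NonUnitalRing B'] [Module k B'] [SMulCommClass k B' B']
    [IsScalarTower k B' B'] {D' : Type*} [NonUnitalRing D'] [Module k D'] [SMulCommClass k D' D']
    [IsScalarTower k D' D'] (φ : B →ₗ[k] M k B') (ψ : D →ₗ[k] M k D') :
    B ⊗[k] D →ₗ[k] M k (B' ⊗[k] D') :=
  TensorProduct.lift (tensLin.compl₁₂ φ ψ)

/-- Transport of multipliers along an isomorphism of algebras. -/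
def M.congr (e : B ≃ₗ[k] D) (he : ∀ x y : B, e (x * y) = e x * e y) : M k B →ₗ[k] M k D where
  toFun m := M.mk (e.toLinearMap ∘ₗ m.left ∘ₗ e.symm.toLinearMap)
    (e.toLinearMap ∘ₗ m.right ∘ₗ e.symm.toLinearMap) (by
      intro x y
      obtain ⟨x, rfl⟩ := e.surjective x
      obtain ⟨y, rfl⟩ := e.surjective y
      simp only [LinearMap.comp_apply, LinearEquiv.coe_coe, LinearEquiv.symm_apply_apply]
      rw [← he, ← he, M.compat])
  map_add' m n := by
    apply Subtype.ext
    refine Prod.ext ?_ (MulOpposite.unop_injective ?_) <;> ext z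
    · exact map_add e (m.left (e.symm z)) (n.left (e.symm z))
    · exact map_add e (m.right (e.symm z)) (n.right (e.symm z))
  map_smul' r m := by
    apply Subtype.ext
    refine Prod.ext ?_ (MulOpposite.unop_injective ?_) <;> ext z
    · exact map_smul e r (m.left (e.symm z))
    · exact map_smul e r (m.right (e.symm z))

theorem comm_map_mul (x y : B ⊗[k] D) :
    TensorProduct.comm k B D (x * y) = TensorProduct.comm k B D x * TensorProduct.comm k B D y := by
  induction x using TensorProduct.induction_on with
  | zero => simp
  | add x₁ x₂ h₁ h₂ => rw [add_mul, map_add, map_add, add_mul, h₁, h₂]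
  | tmul b d =>
    induction y using TensorProduct.induction_on with
    | zero => simp
    | add y₁ y₂ h₁ h₂ => rw [mul_add, map_add, map_add, mul_add, h₁, h₂]
    | tmul b' d' => simp

theorem assoc_map_mul {F : Type*} [NonUnitalRing F] [Module k F] [SMulCommClass k F F]
    [IsScalarTower k F F] (x y : (B ⊗[k] D) ⊗[k] F) :
    TensorProduct.assoc k B D F (x * y) =
      TensorProduct.assoc k B D F x * TensorProduct.assoc k B D F y := by
  induction x using TensorProduct.induction_on with
  | zero => simp
  | add x₁ x₂ h₁ h₂ => rw [add_mul, map_add, map_add, add_mul, h₁, h₂]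
  | tmul p f =>
    induction y using TensorProduct.induction_on with
    | zero => simp
    | add y₁ y₂ h₁ h₂ => rw [mul_add, map_add, map_add, mul_add, h₁, h₂]
    | tmul q f' =>
      induction p using TensorProduct.induction_on with
      | zero => simp
      | add p₁ p₂ h₁ h₂ =>
        rw [TensorProduct.add_tmul, add_mul, map_add, map_add, add_mul, h₁, h₂]
      | tmul b d =>
        induction q using TensorProduct.induction_on with
        | zero => simp
        | add q₁ q₂ h₁ h₂ =>
          rw [TensorProduct.add_tmul, mul_add, map_add, map_add, mul_add, h₁, h₂]
        | tmul b' d' => simp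

/-- The flip `M(B ⊗ D) → M(D ⊗ B)`. -/
def M.flip : M k (B ⊗[k] D) →ₗ[k] M k (D ⊗[k] B) :=
  M.congr (TensorProduct.comm k B D) comm_map_mul

/-- The identification `M((B ⊗ D) ⊗ F) → M(B ⊗ (D ⊗ F))`. -/
def M.assoc {F : Type*} [NonUnitalRing F] [Module k F] [SMulCommClass k F F]
    [IsScalarTower k F F] : M k ((B ⊗[k] D) ⊗[k] F) →ₗ[k] M k (B ⊗[k] (D ⊗[k] F)) :=
  M.congr (TensorProduct.assoc k B D F) assoc_map_mul

/-- `φ : B → M(D)` is nondegenerate: `φ(B) D = D = D φ(B)` (linear spans of the products). -/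
def IsNondegenerateHom (φ : B →ₗ[k] M k D) : Prop :=
  Submodule.span k {x : D | ∃ b d, x = (φ b).left d} = ⊤ ∧
    Submodule.span k {x : D | ∃ b d, x = (φ b).right d} = ⊤

/-- `n = φ(m)`, where `φ : B → M(D)` is a nondegenerate homomorphism, extended to `M(B)`; the
extension is determined by `φ(m) φ(b) = φ(m b)` and `φ(b) φ(m) = φ(b m)`. -/
def ExtendsTo (φ : B →ₗ[k] M k D) (m : M k B) (n : M k D) : Prop :=
  ∀ b : B, n * φ b = φ (m.left b) ∧ φ b * n = φ (m.right b)

end MultiplierMaps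

/-! ### Multiplier bialgebras and multiplier Hopf algebras -/

section Bialgebra

variable {k : Type*} [Field k]
variable {A : Type*} [NonUnitalRing A] [Module k A] [SMulCommClass k A A] [IsScalarTower k A A]

/-- `T₁(a ⊗ b) = Δ(a)(1 ⊗ b)`. -/
def canonOne (Δ : A →ₗ[k] M k (A ⊗[k] A)) : A →ₗ[k] A →ₗ[k] A ⊗[k] A :=
  LinearMap.mk₂ k (fun a b => pull (Δ a * tensLin 1 (emb b)))
    (by intros; simp [add_mul]) (by intros; simp)
    (by intros; simp [mul_add]) (by intros; simp)

/-- `T₂(a ⊗ b) = (a ⊗ 1)Δ(b)`. -/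
def canonTwo (Δ : A →ₗ[k] M k (A ⊗[k] A)) : A →ₗ[k] A →ₗ[k] A ⊗[k] A :=
  LinearMap.mk₂ k (fun a b => pull (tensLin (emb a) 1 * Δ b))
    (by intros; simp [add_mul]) (by intros; simp)
    (by intros; simp [mul_add]) (by intros; simp)

/-- `T₃(a ⊗ b) = Δ(a)(b ⊗ 1)`. -/
def canonThree (Δ : A →ₗ[k] M k (A ⊗[k] A)) : A →ₗ[k] A →ₗ[k] A ⊗[k] A :=
  LinearMap.mk₂ k (fun a b => pull (Δ a * tensLin (emb b) 1))
    (by intros; simp [add_mul]) (by intros; simp)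
    (by intros; simp [mul_add]) (by intros; simp)

/-- `T₄(a ⊗ b) = (1 ⊗ a)Δ(b)`. -/
def canonFour (Δ : A →ₗ[k] M k (A ⊗[k] A)) : A →ₗ[k] A →ₗ[k] A ⊗[k] A :=
  LinearMap.mk₂ k (fun a b => pull (tensLin 1 (emb a) * Δ b))
    (by intros; simp [add_mul]) (by intros; simp)
    (by intros; simp [mul_add]) (by intros; simp)

/-- All the axioms of a multiplier bialgebra except the nondegeneracy of the homomorphism `Δ`.
Coassociativity is the identity
`(a ⊗ 1 ⊗ 1)(Δ ⊗ ι)(Δ(b)(1 ⊗ c)) = (ι ⊗ Δ)((a ⊗ 1)Δ(b))(1 ⊗ 1 ⊗ c)`. -/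
structure IsPreMultiplierBialgebra (Δ : A →ₗ[k] M k (A ⊗[k] A)) : Prop where
  nondegenerate : Nondegenerate A
  map_mul : ∀ a b : A, Δ (a * b) = Δ a * Δ b
  mem_one : ∀ a b : A, Δ a * tensLin 1 (emb b) ∈ LinearMap.range (emb (k := k) (B := A ⊗[k] A))
  mem_two : ∀ a b : A, tensLin (emb a) 1 * Δ b ∈ LinearMap.range (emb (k := k) (B := A ⊗[k] A))
  mem_three : ∀ a b : A, Δ a * tensLin (emb b) 1 ∈ LinearMap.range (emb (k := k) (B := A ⊗[k] A))
  mem_four : ∀ a b : A, tensLin 1 (emb a) * Δ b ∈ LinearMap.range (emb (k := k) (B := A ⊗[k] A))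
  coassoc : ∀ a b c : A,
    TensorProduct.assoc k A A A ((canonTwo Δ a).rTensor A (canonOne Δ b c)) =
      ((canonOne Δ).flip c).lTensor A (canonTwo Δ a b)

/-- `(A, Δ)` is a multiplier bialgebra. -/
structure IsMultiplierBialgebra (Δ : A →ₗ[k] M k (A ⊗[k] A)) : Prop
    extends IsPreMultiplierBialgebra Δ where
  nondegenerateHom : IsNondegenerateHom Δ

/-- `(A, Δ)` is a multiplier Hopf algebra. -/
structure IsMultiplierHopf (Δ : A →ₗ[k] M k (A ⊗[k] A)) : Prop
    extends IsMultiplierBialgebra Δ where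
  bijective_one : Function.Bijective (TensorProduct.lift (canonOne Δ))
  bijective_two : Function.Bijective (TensorProduct.lift (canonTwo Δ))

/-- `(A, Δ)` is a regular multiplier Hopf algebra: `(A, Δ)` and `(A, σΔ)` are multiplier Hopf
algebras, where `σ` is the flip. -/
structure IsRegularMultiplierHopf (Δ : A →ₗ[k] M k (A ⊗[k] A)) : Prop
    extends IsMultiplierHopf Δ where
  flip : IsMultiplierHopf (M.flip ∘ₗ Δ)

/-- The defining property of the counit of a multiplier Hopf algebra:
`(ε ⊗ ι)(Δ(a)(1 ⊗ b)) = ab` and `(ι ⊗ ε)((a ⊗ 1)Δ(b)) = ab`. -/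
def IsHopfCounit (Δ : A →ₗ[k] M k (A ⊗[k] A)) (ε : A →ₗ[k] k) : Prop :=
  ∀ a b : A, TensorProduct.lid k A (ε.rTensor A (canonOne Δ a b)) = a * b ∧
    TensorProduct.rid k A (ε.lTensor A (canonTwo Δ a b)) = a * b

/-- The counit of a multiplier Hopf algebra: the unique linear map with the property
`IsHopfCounit`. -/
def hopfCounit (Δ : A →ₗ[k] M k (A ⊗[k] A)) : A →ₗ[k] k := Classical.epsilon (IsHopfCounit Δ)

/-- `ε` is a left counit of `(A, Δ)`: a homomorphism to `k` with `(ε ⊗ ι)Δ = ι`, that is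
`(ε ⊗ ι)(Δ(a)(1 ⊗ b)) = ab` and `(ε ⊗ ι)((1 ⊗ b)Δ(a)) = ba`. -/
structure IsLeftCounit (Δ : A →ₗ[k] M k (A ⊗[k] A)) (ε : A →ₗ[k] k) : Prop where
  map_mul : ∀ a b : A, ε (a * b) = ε a * ε b
  counit_left : ∀ a b : A, TensorProduct.lid k A (ε.rTensor A (canonOne Δ a b)) = a * b
  counit_right : ∀ a b : A, TensorProduct.lid k A (ε.rTensor A (canonFour Δ b a)) = b * a

/-- `ε` is a right counit of `(A, Δ)`: a homomorphism to `k` with `(ι ⊗ ε)Δ = ι`, that is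
`(ι ⊗ ε)(Δ(a)(b ⊗ 1)) = ab` and `(ι ⊗ ε)((b ⊗ 1)Δ(a)) = ba`. -/
structure IsRightCounit (Δ : A →ₗ[k] M k (A ⊗[k] A)) (ε : A →ₗ[k] k) : Prop where
  map_mul : ∀ a b : A, ε (a * b) = ε a * ε b
  counit_left : ∀ a b : A, TensorProduct.rid k A (ε.lTensor A (canonThree Δ a b)) = a * b
  counit_right : ∀ a b : A, TensorProduct.rid k A (ε.lTensor A (canonTwo Δ b a)) = b * a

/-- For a subalgebra `C ⊆ A`, the map `Δ_C : C → M(C ⊗ C)` is the restriction of `Δ` to `C`: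
`Δ(c)x = Δ_C(c)x` and `xΔ(c) = xΔ_C(c)` in `A ⊗ A`, for all `x ∈ C ⊗ C ⊆ A ⊗ A`. -/
def IsRestriction (C : NonUnitalSubalgebra k A) (Δ : A →ₗ[k] M k (A ⊗[k] A))
    (ΔC : C →ₗ[k] M k (C ⊗[k] C)) : Prop :=
  ∀ (c : C) (x : C ⊗[k] C),
    TensorProduct.map C.toSubmodule.subtype C.toSubmodule.subtype ((ΔC c).left x) =
        (Δ c).left (TensorProduct.map C.toSubmodule.subtype C.toSubmodule.subtype x) ∧
      TensorProduct.map C.toSubmodule.subtype C.toSubmodule.subtype ((ΔC c).right x) =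
        (Δ c).right (TensorProduct.map C.toSubmodule.subtype C.toSubmodule.subtype x)

/-- The subspace `(ι ⊗ ε)Δ(A)`, spanned by the elements
`(ι ⊗ ε)Δ(a) = (ι ⊗ ε)(Δ(a)(1 ⊗ b))`, where `ε(b) = 1`. -/
def sliceSubspace (Δ : A →ₗ[k] M k (A ⊗[k] A)) (ε : A →ₗ[k] k) : Submodule k A :=
  Submodule.span k {x : A | ∃ a b : A, ε b = 1 ∧
    x = TensorProduct.rid k A (ε.lTensor A (canonOne Δ a b))}

end Bialgebra

/-! ### Partial comodule coalgebras, algebras and bialgebras -/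

section PartialComodule

variable {k : Type*} [Field k]
variable {A : Type*} [NonUnitalRing A] [Module k A] [SMulCommClass k A A] [IsScalarTower k A A]
variable {Y : Type*} [NonUnitalRing Y] [Module k Y] [SMulCommClass k Y Y] [IsScalarTower k Y Y]

/-- `T(y ⊗ a) = ρ(y)(a ⊗ 1)`. -/
def coactT (ρ : Y →ₗ[k] M k (A ⊗[k] Y)) : Y →ₗ[k] A →ₗ[k] A ⊗[k] Y :=
  LinearMap.mk₂ k (fun y a => pull (ρ y * tensLin (emb a) 1))
    (by intros; simp [add_mul]) (by intros; simp)
    (by intros; simp [mul_add]) (by intros; simp)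

/-- `T̄(a ⊗ y) = (a ⊗ 1)ρ(y)`. -/
def coactTbar (ρ : Y →ₗ[k] M k (A ⊗[k] Y)) : A →ₗ[k] Y →ₗ[k] A ⊗[k] Y :=
  LinearMap.mk₂ k (fun a y => pull (tensLin (emb a) 1 * ρ y))
    (by intros; simp [add_mul]) (by intros; simp)
    (by intros; simp [mul_add]) (by intros; simp)

/-- `z = ((ι ⊗ T)(Δ_Y(y) ⊗ a))(1 ⊗ 1 ⊗ y')`, where `z ∈ Y ⊗ A ⊗ Y`. Here `(ι ⊗ T)(Δ_Y(y) ⊗ a)` is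
the multiplier with respect to the first factor that is given by
`u ↦ (ι ⊗ T)(Δ_Y(y)(u ⊗ 1) ⊗ a)` and `u ↦ (ι ⊗ T)((u ⊗ 1)Δ_Y(y) ⊗ a)`. -/
def IsComulCoactRight (ΔY : Y →ₗ[k] M k (Y ⊗[k] Y)) (ρ : Y →ₗ[k] M k (A ⊗[k] Y))
    (y : Y) (a : A) (y' : Y) (z : Y ⊗[k] (A ⊗[k] Y)) : Prop :=
  ∀ u : Y,
    (LinearMap.mulRight k u).rTensor (A ⊗[k] Y) z =
        ((LinearMap.mulRight k y').lTensor A).lTensor Y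
          (((coactT ρ).flip a).lTensor Y (canonThree ΔY y u)) ∧
      (LinearMap.mulLeft k u).rTensor (A ⊗[k] Y) z =
        ((LinearMap.mulRight k y').lTensor A).lTensor Y
          (((coactT ρ).flip a).lTensor Y (canonTwo ΔY u y))

/-- `z = (1 ⊗ 1 ⊗ y')((ι ⊗ T)(Δ_Y(y) ⊗ a))`, where `z ∈ Y ⊗ A ⊗ Y`. -/
def IsComulCoactLeft (ΔY : Y →ₗ[k] M k (Y ⊗[k] Y)) (ρ : Y →ₗ[k] M k (A ⊗[k] Y))
    (y' : Y) (y : Y) (a : A) (z : Y ⊗[k] (A ⊗[k] Y)) : Prop :=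
  ∀ u : Y,
    (LinearMap.mulRight k u).rTensor (A ⊗[k] Y) z =
        ((LinearMap.mulLeft k y').lTensor A).lTensor Y
          (((coactT ρ).flip a).lTensor Y (canonThree ΔY y u)) ∧
      (LinearMap.mulLeft k u).rTensor (A ⊗[k] Y) z =
        ((LinearMap.mulLeft k y').lTensor A).lTensor Y
          (((coactT ρ).flip a).lTensor Y (canonTwo ΔY u y))

/-- `v = ((T̄ ⊗ ι)(a ⊗ Δ_Y(y)))(1 ⊗ y' ⊗ 1)`, where `v ∈ A ⊗ Y ⊗ Y`. Here `(T̄ ⊗ ι)(a ⊗ Δ_Y(y))` is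
the multiplier with respect to the third factor that is given by
`u ↦ (T̄ ⊗ ι)(a ⊗ Δ_Y(y)(1 ⊗ u))` and `u ↦ (T̄ ⊗ ι)(a ⊗ (1 ⊗ u)Δ_Y(y))`. -/
def IsCoactComulRight (ΔY : Y →ₗ[k] M k (Y ⊗[k] Y)) (ρ : Y →ₗ[k] M k (A ⊗[k] Y))
    (a : A) (y y' : Y) (v : (A ⊗[k] Y) ⊗[k] Y) : Prop :=
  ∀ u : Y,
    (LinearMap.mulRight k u).lTensor (A ⊗[k] Y) v =
        ((LinearMap.mulRight k y').lTensor A).rTensor Y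
          ((coactTbar ρ a).rTensor Y (canonOne ΔY y u)) ∧
      (LinearMap.mulLeft k u).lTensor (A ⊗[k] Y) v =
        ((LinearMap.mulRight k y').lTensor A).rTensor Y
          ((coactTbar ρ a).rTensor Y (canonFour ΔY u y))

/-- `(ι_A ⊗ ε_Y)T : Y ⊗ A → A`. -/
def counitT (ΔY : Y →ₗ[k] M k (Y ⊗[k] Y)) (ρ : Y →ₗ[k] M k (A ⊗[k] Y)) : Y ⊗[k] A →ₗ[k] A :=
  (TensorProduct.rid k A).toLinearMap ∘ₗ (hopfCounit ΔY).lTensor A ∘ₗ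
    TensorProduct.lift (coactT ρ)

/-- `(ι_A ⊗ ε_Y)T̄ : A ⊗ Y → A`. -/
def counitTbar (ΔY : Y →ₗ[k] M k (Y ⊗[k] Y)) (ρ : Y →ₗ[k] M k (A ⊗[k] Y)) : A ⊗[k] Y →ₗ[k] A :=
  (TensorProduct.rid k A).toLinearMap ∘ₗ (hopfCounit ΔY).lTensor A ∘ₗ
    TensorProduct.lift (coactTbar ρ)

/-- `Y` is a partial `A`-comodule coalgebra via `ρ`. -/
structure IsPartialComoduleCoalgebra (ΔA : A →ₗ[k] M k (A ⊗[k] A))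
    (ΔY : Y →ₗ[k] M k (Y ⊗[k] Y)) (ρ : Y →ₗ[k] M k (A ⊗[k] Y)) : Prop where
  /-- `ρ(y)(a ⊗ 1) ∈ A ⊗ Y`. -/
  mem_T : ∀ y a, ρ y * tensLin (emb a) 1 ∈ LinearMap.range (emb (k := k) (B := A ⊗[k] Y))
  /-- `(a ⊗ 1)ρ(y) ∈ A ⊗ Y`. -/
  mem_Tbar : ∀ a y, tensLin (emb a) 1 * ρ y ∈ LinearMap.range (emb (k := k) (B := A ⊗[k] Y))
  /-- `(ε_A ⊗ ι)ρ(y) = y`, where `ε_A ⊗ ι` is extended to multipliers. -/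
  counit_right : ∀ y a,
    TensorProduct.lid k Y ((hopfCounit ΔA).rTensor Y (coactT ρ y a)) = hopfCounit ΔA a • y
  counit_left : ∀ a y,
    TensorProduct.lid k Y ((hopfCounit ΔA).rTensor Y (coactTbar ρ a y)) = hopfCounit ΔA a • y
  /-- `((ι ⊗ T)(Δ_Y(y) ⊗ a))(1 ⊗ 1 ⊗ y') ∈ Y ⊗ A ⊗ Y`. -/
  mem_right : ∀ y a y', ∃ z, IsComulCoactRight ΔY ρ y a y' z
  /-- `(1 ⊗ 1 ⊗ y')((ι ⊗ T)(Δ_Y(y) ⊗ a)) ∈ Y ⊗ A ⊗ Y`. -/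
  mem_left : ∀ y' y a, ∃ z, IsComulCoactLeft ΔY ρ y' y a z
  /-- `(ι ⊗ Δ_Y)T = (T ⊗ ι)(ι ⊗ T)(Δ_Y ⊗ ι)`, multiplied by `1 ⊗ 1 ⊗ y'` from the right. -/
  comul_right : ∀ y a y' z, IsComulCoactRight ΔY ρ y a y' z →
    ((canonOne ΔY).flip y').lTensor A (coactT ρ y a) =
      TensorProduct.assoc k A Y Y ((TensorProduct.lift (coactT ρ)).rTensor Y
        ((TensorProduct.assoc k Y A Y).symm z))
  /-- The same identity, multiplied by `1 ⊗ 1 ⊗ y'` from the left. -/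
  comul_left : ∀ y' y a z, IsComulCoactLeft ΔY ρ y' y a z →
    (canonFour ΔY y').lTensor A (coactT ρ y a) =
      TensorProduct.assoc k A Y Y ((TensorProduct.lift (coactT ρ)).rTensor Y
        ((TensorProduct.assoc k Y A Y).symm z))
  /-- `(ι ⊗ T)(T ⊗ ι)(ι ⊗ Δ_A) = ((ι ⊗ ε_Y)T ⊗ ι ⊗ ι)(ι ⊗ (Δ_A ⊗ ι)T)(Δ_Y ⊗ ι)` on `y ⊗ a`,
  multiplied by `1 ⊗ a' ⊗ y'` from the right. -/
  coassoc : ∀ y a a' y' z, IsComulCoactRight ΔY ρ y a y' z →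
    ((LinearMap.mulRight k y').lTensor A).lTensor A
        ((TensorProduct.lift (coactT ρ)).lTensor A
          (TensorProduct.assoc k A Y A ((coactT ρ y).rTensor A (canonOne ΔA a a')))) =
      (counitT ΔY ρ).rTensor (A ⊗[k] Y)
        ((TensorProduct.assoc k Y A (A ⊗[k] Y)).symm
          ((TensorProduct.assoc k A A Y).toLinearMap.lTensor Y
            ((((canonOne ΔA).flip a').rTensor Y).lTensor Y z)))

/-- The partial `A`-comodule coalgebra `Y` is symmetric. -/
structure IsSymmetricPartialComoduleCoalgebra (ΔA : A →ₗ[k] M k (A ⊗[k] A))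
    (ΔY : Y →ₗ[k] M k (Y ⊗[k] Y)) (ρ : Y →ₗ[k] M k (A ⊗[k] Y)) : Prop
    extends IsPartialComoduleCoalgebra ΔA ΔY ρ where
  /-- `((T̄ ⊗ ι)(a ⊗ Δ_Y(y)))(1 ⊗ y' ⊗ 1) ∈ A ⊗ Y ⊗ Y`. -/
  mem_symm : ∀ a y y', ∃ v, IsCoactComulRight ΔY ρ a y y' v
  /-- `(ι ⊗ T̄)(ι ⊗ τ)(T̄ ⊗ ι)(ι ⊗ τ)(Δ_A ⊗ ι)
    = ((ι ⊗ ε_Y)T̄ ⊗ ι ⊗ ι)(ι ⊗ τ)((Δ_A ⊗ ι)T̄ ⊗ ι)(ι ⊗ Δ_Y)` on `a ⊗ y`,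
  multiplied by `1 ⊗ a' ⊗ 1` from the left and by `1 ⊗ 1 ⊗ y'` from the right. -/
  coassoc_symm : ∀ a' a y y' v, IsCoactComulRight ΔY ρ a y y' v →
    ((LinearMap.mulRight k y').lTensor A).lTensor A
        ((TensorProduct.lift (coactTbar ρ) ∘ₗ (TensorProduct.comm k Y A).toLinearMap).lTensor A
          (TensorProduct.assoc k A Y A (((coactTbar ρ).flip y).rTensor A (canonFour ΔA a' a)))) =
      (counitTbar ΔY ρ).rTensor (A ⊗[k] Y)
        ((TensorProduct.assoc k A Y (A ⊗[k] Y)).symm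
          ((TensorProduct.comm k (A ⊗[k] Y) Y).toLinearMap.lTensor A
            (TensorProduct.assoc k A (A ⊗[k] Y) Y
              ((TensorProduct.assoc k A A Y).toLinearMap.rTensor Y
                (((canonFour ΔA a').rTensor Y).rTensor Y v)))))

/-- `m = (ι_A ⊗ ρ)(ρ(y))`: the multiplier `m` of `A ⊗ A ⊗ Y` with
`m(a ⊗ 1 ⊗ 1) = (ι ⊗ ρ)(ρ(y)(a ⊗ 1))` and `(a ⊗ 1 ⊗ 1)m = (ι ⊗ ρ)((a ⊗ 1)ρ(y))`. -/
def IsIteratedCoaction (ρ : Y →ₗ[k] M k (A ⊗[k] Y)) (y : Y) (m : M k (A ⊗[k] (A ⊗[k] Y))) : Prop :=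
  ∀ a : A, m * tensLin (emb a) 1 = tensMap emb ρ (coactT ρ y a) ∧
    tensLin (emb a) 1 * m = tensMap emb ρ (coactTbar ρ a y)

/-- `Y` is a symmetric partial `A`-comodule algebra via `ρ` and the idempotent `E`. -/
structure IsSymmetricPartialComoduleAlgebra (ΔA : A →ₗ[k] M k (A ⊗[k] A))
    (ρ : Y →ₗ[k] M k (A ⊗[k] Y)) (E : M k (A ⊗[k] Y)) : Prop where
  injective : Function.Injective ρ
  map_mul : ∀ x y : Y, ρ (x * y) = ρ x * ρ y
  idempotent : E * E = E
  /-- `(A ⊗ 1)E ⊆ A ⊗ M(Y)`. -/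
  left_mem : ∀ a : A, tensLin (emb a) 1 * E ∈
    LinearMap.range (tensMap (emb : A →ₗ[k] M k A) (LinearMap.id : M k Y →ₗ[k] M k Y)
      : A ⊗[k] M k Y →ₗ[k] M k (A ⊗[k] Y))
  /-- `E(A ⊗ 1) ⊆ A ⊗ M(Y)`. -/
  right_mem : ∀ a : A, E * tensLin (emb a) 1 ∈
    LinearMap.range (tensMap (emb : A →ₗ[k] M k A) (LinearMap.id : M k Y →ₗ[k] M k Y)
      : A ⊗[k] M k Y →ₗ[k] M k (A ⊗[k] Y))
  /-- `ρ(Y)(A ⊗ 1) ⊆ E(A ⊗ Y)`. -/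
  coact_right : ∀ (y : Y) (a : A), ∃ x : A ⊗[k] Y, ρ y * tensLin (emb a) 1 = E * emb x
  /-- `(A ⊗ 1)ρ(Y) ⊆ (A ⊗ Y)E`. -/
  coact_left : ∀ (a : A) (y : Y), ∃ x : A ⊗[k] Y, tensLin (emb a) 1 * ρ y = emb x * E
  /-- `(ι ⊗ ρ)(ρ(y)) = (1 ⊗ E)(Δ_A ⊗ ι)(ρ(y))` and `(ι ⊗ ρ)(ρ(y)) = (Δ_A ⊗ ι)(ρ(y))(1 ⊗ E)`. -/
  coassoc : ∀ y : Y, ∃ n : M k ((A ⊗[k] A) ⊗[k] Y), ExtendsTo (tensMap ΔA emb) (ρ y) n ∧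
    IsIteratedCoaction ρ y (tensLin 1 E * M.assoc n) ∧
    IsIteratedCoaction ρ y (M.assoc n * tensLin 1 E)

/-- `Y` is a symmetric partial `A`-comodule bialgebra via `ρ` (and the idempotent `E`). -/
structure IsSymmetricPartialComoduleBialgebra (ΔA : A →ₗ[k] M k (A ⊗[k] A))
    (ΔY : Y →ₗ[k] M k (Y ⊗[k] Y)) (ρ : Y →ₗ[k] M k (A ⊗[k] Y)) (E : M k (A ⊗[k] Y)) : Prop where
  algebra : IsSymmetricPartialComoduleAlgebra ΔA ρ E
  coalgebra : IsSymmetricPartialComoduleCoalgebra ΔA ΔY ρ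

/-! ### The smash coproduct -/

/-- `ι_Y ⊗ T ⊗ ι_A : Y ⊗ Y ⊗ A ⊗ A → Y ⊗ A ⊗ Y ⊗ A`. -/
def middleT (ρ : Y →ₗ[k] M k (A ⊗[k] Y)) :
    (Y ⊗[k] Y) ⊗[k] (A ⊗[k] A) →ₗ[k] (Y ⊗[k] A) ⊗[k] (Y ⊗[k] A) :=
  (TensorProduct.assoc k Y A (Y ⊗[k] A)).symm.toLinearMap ∘ₗ
    ((TensorProduct.assoc k A Y A).toLinearMap ∘ₗ
      (TensorProduct.lift (coactT ρ)).rTensor A ∘ₗ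
        (TensorProduct.assoc k Y A A).symm.toLinearMap).lTensor Y ∘ₗ
          (TensorProduct.assoc k Y Y (A ⊗[k] A)).toLinearMap

/-- `T̄₂((y' ⊗ a') ⊗ (y ⊗ a)) = y' y₍₁₎ ⊗ (a' ⊗ 1 ⊗ 1)((T ⊗ ι)(y₍₂₎ ⊗ Δ_A(a)))`, where
`(a' ⊗ 1 ⊗ 1)((T ⊗ ι)(w ⊗ Δ_A(a)))` is the image of `(a' ⊗ 1)ρ(w) = ∑ b ⊗ w'` under
`b ⊗ w' ↦ b a₍₁₎ ⊗ w' ⊗ a₍₂₎`, with `b a₍₁₎ ⊗ a₍₂₎ = (b ⊗ 1)Δ_A(a)`. -/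
def smashTwo (ΔA : A →ₗ[k] M k (A ⊗[k] A)) (ΔY : Y →ₗ[k] M k (Y ⊗[k] Y))
    (ρ : Y →ₗ[k] M k (A ⊗[k] Y)) (y' : Y) (a' : A) (y : Y) (a : A) :
    (Y ⊗[k] A) ⊗[k] (Y ⊗[k] A) :=
  (TensorProduct.assoc k Y A (Y ⊗[k] A)).symm
    (((TensorProduct.comm k A Y).toLinearMap.lTensor A ∘ₗ
      (TensorProduct.assoc k A A Y).toLinearMap ∘ₗ
        ((canonTwo ΔA).flip a).rTensor Y ∘ₗ coactTbar ρ a').lTensor Y (canonTwo ΔY y' y))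

/-- `Δ` is the comultiplication of the smash coproduct `Y ⋊ A`. It is given by
`Δ(y ⊗ a)((y' ⊗ a') ⊗ (y'' ⊗ a'')) = T̄₁((y ⊗ a) ⊗ (y'' ⊗ a''))((y' ⊗ a') ⊗ 1)`, where
`T̄₁((y ⊗ a) ⊗ (y'' ⊗ a'')) = ((ι ⊗ T)(Δ_Y(y) ⊗ a₍₁₎))(1 ⊗ 1 ⊗ y'') ⊗ a₍₂₎ a''`, so that the right
hand side is `(ι ⊗ T ⊗ ι)(Δ_Y(y)(y' ⊗ 1) ⊗ Δ_A(a)(1 ⊗ a''))(1 ⊗ a' ⊗ y'' ⊗ 1)`, and by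
`((y' ⊗ a') ⊗ (y'' ⊗ a''))Δ(y ⊗ a) = (1 ⊗ (y'' ⊗ a''))T̄₂((y' ⊗ a') ⊗ (y ⊗ a))`. -/
def IsSmashComul (ΔA : A →ₗ[k] M k (A ⊗[k] A)) (ΔY : Y →ₗ[k] M k (Y ⊗[k] Y))
    (ρ : Y →ₗ[k] M k (A ⊗[k] Y))
    (Δ : Y ⊗[k] A →ₗ[k] M k ((Y ⊗[k] A) ⊗[k] (Y ⊗[k] A))) : Prop :=
  ∀ (y y' y'' : Y) (a a' a'' : A),
    (Δ (y ⊗ₜ[k] a)).left ((y' ⊗ₜ[k] a') ⊗ₜ[k] (y'' ⊗ₜ[k] a'')) =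
        TensorProduct.map ((LinearMap.mulRight k a').lTensor Y)
          ((LinearMap.mulRight k y'').rTensor A)
          (middleT ρ (canonThree ΔY y y' ⊗ₜ[k] canonOne ΔA a a'')) ∧
      (Δ (y ⊗ₜ[k] a)).right ((y' ⊗ₜ[k] a') ⊗ₜ[k] (y'' ⊗ₜ[k] a'')) =
        (LinearMap.mulLeft k (y'' ⊗ₜ[k] a'')).lTensor (Y ⊗[k] A) (smashTwo ΔA ΔY ρ y' a' y a)

/-- `y ⊗ a ↦ ε_Y(y) ε_A(a)`. -/
def smashCounit (ΔA : A →ₗ[k] M k (A ⊗[k] A)) (ΔY : Y →ₗ[k] M k (Y ⊗[k] Y)) :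
    Y ⊗[k] A →ₗ[k] k :=
  LinearMap.mul' k k ∘ₗ TensorProduct.map (hopfCounit ΔY) (hopfCounit ΔA)

end PartialComodule

end

end MultHopf

namespace MultHopf

set_option linter.unusedSectionVars false

noncomputable section

/-! ### Linear algebra of tensor products -/

section LinearAlgebra

variable {k : Type*} [Field k]
variable {U V W X : Type*} [AddCommGroup U] [Module k U] [AddCommGroup V] [Module k V]
variable [AddCommGroup W] [Module k W] [AddCommGroup X] [Module k X]

/-! Write ρ(y) = y₋₁ ⊗ y₀, let χ(y) = (ι ⊗ ε_Y)ρ(y), a multiplier of A (`coactChar` gives χ(y)a),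
and put B = Y ⊗ A. The comultiplication is Δ(y ⊗ a) = ((ι ⊗ ρ)Δ_Y(y) ⊗ 1) · Δ_A(a)₂₄, a product of
two homomorphisms into M(Y ⊗ A ⊗ Y ⊗ A). Since A is commutative, the second factor is central, and
so Δ is multiplicative (`smashComul_map_mul`).

Coverings. Containment of Δ(b)(1 ⊗ c) in B ⊗ B needs y₍₁₎ ⊗ ρ(y₍₂₎)x to lie in Y ⊗ A ⊗ Y. This is
clear for x = ρ(v)x', where the element is Δ_Y(y)(1 ⊗ v) with ρ(·)x' applied to its second leg. A
general x may be replaced by Ex, because ρ(t) = ρ(t)E. Contracting the identity (ι ⊗ ρ)ρ(y) = (1 ⊗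
E)(Δ_A ⊗ ι)ρ(y) with the antipode of A gives (S(y₋₁) ⊗ 1)ρ(y₀) = E(1 ⊗ y), so Ex lies in the span of
ρ(Y)(A ⊗ Y). This is `mem_span_of_iterated`, leading to `isCovered`.

Coassociativity. The compatibility of ρ with Δ_Y and the partial coassociativity (ι ⊗ ρ)ρ(y) =
(χ(y₍₁₎) ⊗ 1 ⊗ 1)(Δ_A ⊗ ι)ρ(y₍₂₎) transform one iterate of Δ into the other up to a factor χ, which
is absorbed by ρ(y₍₁₎)(χ(y₍₂₎) ⊗ 1) = ρ(y) (`coact_partialSlice`, `coactLegs_comul_covR`).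

The slice. For every coassociative Δ with a left counit ε, the map π = (ι ⊗ ε)Δ is an idempotent
algebra endomorphism. Slicing coassociativity in the middle and in the last leg gives (π ⊗ ι)Δ = Δ
and (ι ⊗ π)Δ = Δπ. Hence Δ restricts to the image of π, where the right counit law is just π = ι.
All this is formal (`exists_restriction_slice`). What is not formal is the nondegeneracy of the
image as an algebra and of the restricted comultiplication.

Both rest on π(y ⊗ a) = y₍₁₎ ⊗ χ(y₍₂₎)a. The elements s ⊗ χ(t)a span π(B)B, so if π(c) annihilates
π(B), then (ι ⊗ χ(t))π(c) = 0 for all t, and this forces π(c) = π(π(c)) = 0. Modulo ker π the same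
elements span B. Finally ρ(y₍₁₎)(y₍₂₎₋₁ ⊗ S(y₍₂₎₀)) = χ(y) ⊗ 1 puts χ(u)a ⊗ y in the span of ρ(Y)(A
⊗ Y), whence (s ⊗ χ(u)a) ⊗ (y ⊗ d) is in the span of Δ(B)(B ⊗ B) (`coactChar_tmul_mem_left`). The
other side uses the antipode of the co-opposite of Y. -/

theorem equivFinsuppOfBasisLeft_lTensor {J : Type*} [DecidableEq J] (b : Module.Basis J k U)
    (φ : V →ₗ[k] W) (i : J) (x : U ⊗[k] V) :
    TensorProduct.equivFinsuppOfBasisLeft b (φ.lTensor U x) i =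
      φ (TensorProduct.equivFinsuppOfBasisLeft b x i) := by
  induction x using TensorProduct.induction_on with
  | zero => simp
  | add x y hx hy => simp only [map_add, Finsupp.add_apply, hx, hy]
  | tmul u v =>
    rw [LinearMap.lTensor_tmul, TensorProduct.equivFinsuppOfBasisLeft_apply_tmul_apply,
      TensorProduct.equivFinsuppOfBasisLeft_apply_tmul_apply, map_smul]

theorem comm_rTensor (f : U →ₗ[k] V) (x : U ⊗[k] W) :
    TensorProduct.comm k V W (f.rTensor W x) = f.lTensor W (TensorProduct.comm k U W x) := by
  induction x using TensorProduct.induction_on with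
  | zero => simp
  | add x y hx hy => simp only [map_add, hx, hy]
  | tmul u v => rfl

/-- If `g` vanishes on the common kernel of the `f j`, then `ι ⊗ g` vanishes on the common kernel
of the `ι ⊗ f j`. -/
theorem lTensor_eq_zero_of_joint {J : Type*} (f : J → V →ₗ[k] W) (g : V →ₗ[k] X)
    (h : ∀ v, (∀ j, f j v = 0) → g v = 0) (x : U ⊗[k] V)
    (hx : ∀ j, (f j).lTensor U x = 0) : g.lTensor U x = 0 := by
  classical
  -- A basis of `U` turns an element of `U ⊗ V` into a finitely supported family in `V` on which all
  -- the maps act coordinatewise.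
  apply (TensorProduct.equivFinsuppOfBasisLeft (Module.Basis.ofVectorSpace k U)).injective
  rw [map_zero]
  ext i
  rw [equivFinsuppOfBasisLeft_lTensor, Finsupp.zero_apply]
  apply h
  intro j
  rw [← equivFinsuppOfBasisLeft_lTensor, hx, map_zero, Finsupp.zero_apply]

theorem rTensor_eq_zero_of_joint {J : Type*} (f : J → V →ₗ[k] W) (g : V →ₗ[k] X)
    (h : ∀ v, (∀ j, f j v = 0) → g v = 0) (x : V ⊗[k] U)
    (hx : ∀ j, (f j).rTensor U x = 0) : g.rTensor U x = 0 := by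
  apply (TensorProduct.comm k X U).injective
  rw [comm_rTensor, map_zero]
  refine lTensor_eq_zero_of_joint f g h _ fun j => ?_
  rw [← comm_rTensor, hx, map_zero]

theorem rTensor_lTensor_comm (f : U →ₗ[k] V) (g : W →ₗ[k] X) (x : U ⊗[k] W) :
    f.rTensor X (g.lTensor U x) = g.lTensor V (f.rTensor W x) := by
  rw [← LinearMap.comp_apply, ← LinearMap.comp_apply, LinearMap.rTensor_comp_lTensor,
    LinearMap.lTensor_comp_rTensor]

end LinearAlgebra

/-! ### Nondegenerate products on one leg of a tensor product -/

section Nondegenerate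

variable {k : Type*} [Field k]
variable {B : Type*} [NonUnitalRing B] [Module k B] [SMulCommClass k B B] [IsScalarTower k B B]
variable {D : Type*} [NonUnitalRing D] [Module k D] [SMulCommClass k D D] [IsScalarTower k D D]
variable {V : Type*} [AddCommGroup V] [Module k V]

/-- The joint-kernel lemma with `g` the identity: nondegeneracy of a product survives tensoring with
any vector space. Elements known only through their products on one leg are identified with these
four lemmas. -/
theorem ext_mulLeft_rTensor (hB : Nondegenerate B) {x y : B ⊗[k] V}
    (h : ∀ e : B, (LinearMap.mulLeft k e).rTensor V x = (LinearMap.mulLeft k e).rTensor V y) :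
    x = y := by
  rw [← sub_eq_zero]
  simpa using rTensor_eq_zero_of_joint (fun e : B => LinearMap.mulLeft k e) LinearMap.id
    (fun v hv => hB.2 v hv) (x - y) (fun e => by rw [map_sub, h, sub_self])

theorem ext_mulRight_rTensor (hB : Nondegenerate B) {x y : B ⊗[k] V}
    (h : ∀ e : B, (LinearMap.mulRight k e).rTensor V x = (LinearMap.mulRight k e).rTensor V y) :
    x = y := by
  rw [← sub_eq_zero]
  simpa using rTensor_eq_zero_of_joint (fun e : B => LinearMap.mulRight k e) LinearMap.id
    (fun v hv => hB.1 v hv) (x - y) (fun e => by rw [map_sub, h, sub_self])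

theorem ext_mulLeft_lTensor (hB : Nondegenerate B) {x y : V ⊗[k] B}
    (h : ∀ e : B, (LinearMap.mulLeft k e).lTensor V x = (LinearMap.mulLeft k e).lTensor V y) :
    x = y := by
  rw [← sub_eq_zero]
  simpa using lTensor_eq_zero_of_joint (fun e : B => LinearMap.mulLeft k e) LinearMap.id
    (fun v hv => hB.2 v hv) (x - y) (fun e => by rw [map_sub, h, sub_self])

theorem ext_mulRight_lTensor (hB : Nondegenerate B) {x y : V ⊗[k] B}
    (h : ∀ e : B, (LinearMap.mulRight k e).lTensor V x = (LinearMap.mulRight k e).lTensor V y) :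
    x = y := by
  rw [← sub_eq_zero]
  simpa using lTensor_eq_zero_of_joint (fun e : B => LinearMap.mulRight k e) LinearMap.id
    (fun v hv => hB.1 v hv) (x - y) (fun e => by rw [map_sub, h, sub_self])

theorem mul_tmul (x : B ⊗[k] D) (b : B) (d : D) :
    x * (b ⊗ₜ[k] d) = (LinearMap.mulRight k d).lTensor B ((LinearMap.mulRight k b).rTensor D x) := by
  induction x using TensorProduct.induction_on with
  | zero => rw [zero_mul, map_zero, map_zero]
  | add x y hx hy => rw [add_mul, hx, hy, map_add, map_add]
  | tmul u v => rw [Algebra.TensorProduct.tmul_mul_tmul]; rfl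

theorem tmul_mul (x : B ⊗[k] D) (b : B) (d : D) :
    (b ⊗ₜ[k] d) * x = (LinearMap.mulLeft k d).lTensor B ((LinearMap.mulLeft k b).rTensor D x) := by
  induction x using TensorProduct.induction_on with
  | zero => rw [mul_zero, map_zero, map_zero]
  | add x y hx hy => rw [mul_add, hx, hy, map_add, map_add]
  | tmul u v => rw [Algebra.TensorProduct.tmul_mul_tmul]; rfl

theorem Nondegenerate.tensor (hB : Nondegenerate B) (hD : Nondegenerate D) :
    Nondegenerate (B ⊗[k] D) := by
  constructor
  · intro x hx
    refine ext_mulRight_rTensor hB fun e => ext_mulRight_lTensor hD fun f => ?_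
    rw [← mul_tmul, ← mul_tmul, hx, zero_mul]
  · intro x hx
    refine ext_mulLeft_rTensor hB fun e => ext_mulLeft_lTensor hD fun f => ?_
    rw [← tmul_mul, ← tmul_mul, hx, mul_zero]

theorem Nondegenerate.ext_right (hB : Nondegenerate B) {x y : B} (h : ∀ z, x * z = y * z) :
    x = y := by
  rw [← sub_eq_zero]
  exact hB.1 _ fun z => by rw [sub_mul, h, sub_self]

theorem Nondegenerate.ext_left (hB : Nondegenerate B) {x y : B} (h : ∀ z, z * x = z * y) :
    x = y := by
  rw [← sub_eq_zero]
  exact hB.2 _ fun z => by rw [mul_sub, h, sub_self]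

end Nondegenerate

/-! ### Multipliers -/

section Multipliers

variable {k : Type*} [Field k]
variable {B : Type*} [NonUnitalRing B] [Module k B] [SMulCommClass k B B] [IsScalarTower k B B]
variable {D : Type*} [NonUnitalRing D] [Module k D] [SMulCommClass k D D] [IsScalarTower k D D]

@[simp] theorem M.left_mul (m n : M k B) (x : B) : (m * n).left x = m.left (n.left x) := rfl

@[simp] theorem M.right_mul (m n : M k B) (x : B) : (m * n).right x = n.right (m.right x) := rfl

@[simp] theorem M.left_one (x : B) : (1 : M k B).left x = x := rfl

@[simp] theorem M.right_one (x : B) : (1 : M k B).right x = x := rfl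

@[simp] theorem M.left_mk (L R : B →ₗ[k] B) (h) : (M.mk L R h).left = L := rfl

@[simp] theorem M.right_mk (L R : B →ₗ[k] B) (h) : (M.mk L R h).right = R := rfl

@[simp] theorem emb_left (b x : B) : (emb (k := k) b).left x = b * x := rfl

@[simp] theorem emb_right (b x : B) : (emb (k := k) b).right x = x * b := rfl

@[simp] theorem tensLin_left (m : M k B) (n : M k D) :
    (tensLin m n).left = TensorProduct.map m.left n.left := rfl

@[simp] theorem tensLin_right (m : M k B) (n : M k D) :
    (tensLin m n).right = TensorProduct.map m.right n.right := rfl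

@[simp] theorem congr_left (e : B ≃ₗ[k] D) (he) (m : M k B) (x : D) :
    (M.congr e he m).left x = e (m.left (e.symm x)) := rfl

@[simp] theorem congr_right (e : B ≃ₗ[k] D) (he) (m : M k B) (x : D) :
    (M.congr e he m).right x = e (m.right (e.symm x)) := rfl

/-- `m ↦ (b ↦ m b)` as a linear map. -/
def M.leftLin : M k B →ₗ[k] B →ₗ[k] B where
  toFun m := m.left
  map_add' _ _ := rfl
  map_smul' _ _ := rfl

/-- `m ↦ (b ↦ b m)` as a linear map. -/
def M.rightLin : M k B →ₗ[k] B →ₗ[k] B where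
  toFun m := m.right
  map_add' _ _ := rfl
  map_smul' _ _ := rfl

@[simp] theorem M.leftLin_apply (m : M k B) (x : B) : M.leftLin m x = m.left x := rfl

@[simp] theorem M.rightLin_apply (m : M k B) (x : B) : M.rightLin m x = m.right x := rfl

theorem M.ext_both {m n : M k B} (h : m.left = n.left) (h' : m.right = n.right) : m = n :=
  Subtype.ext (Prod.ext h (MulOpposite.unop_injective h'))

/-- Over a nondegenerate algebra the relation `a * L b = R a * b` makes the right action a function
of the left one. -/
theorem M.ext_left (hB : Nondegenerate B) {m n : M k B} (h : ∀ x, m.left x = n.left x) :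
    m = n := by
  refine M.ext_both (LinearMap.ext h) (LinearMap.ext fun x => hB.ext_right fun z => ?_)
  rw [← M.compat, ← M.compat, h]

theorem M.left_mul_apply (hB : Nondegenerate B) (m : M k B) (x y : B) :
    m.left (x * y) = m.left x * y :=
  hB.ext_left fun z => by rw [M.compat, ← mul_assoc, ← mul_assoc, M.compat]

theorem M.right_mul_apply (hB : Nondegenerate B) (m : M k B) (x y : B) :
    m.right (x * y) = x * m.right y :=
  hB.ext_right fun z => by rw [← M.compat, mul_assoc, mul_assoc, M.compat]

theorem emb_injective (hB : Nondegenerate B) :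
    Function.Injective (emb : B →ₗ[k] M k B) := by
  intro x y h
  exact hB.ext_right fun z => by rw [← emb_left (k := k), h, emb_left]

theorem pull_emb (hB : Nondegenerate B) (b : B) : pull (emb (k := k) b) = b :=
  LinearMap.leftInverse_apply_of_inj (LinearMap.ker_eq_bot.mpr (emb_injective hB)) b

theorem emb_pull (hB : Nondegenerate B) {m : M k B}
    (hm : m ∈ LinearMap.range (emb (k := k) (B := B))) : emb (pull m) = m := by
  obtain ⟨b, rfl⟩ := hm
  rw [pull_emb hB]

theorem eq_emb (hB : Nondegenerate B) {m : M k B} {w : B} (h : ∀ x, m.left x = w * x) :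
    m = emb w :=
  M.ext_left hB h

theorem mul_emb (hB : Nondegenerate B) (m : M k B) (b : B) : m * emb b = emb (m.left b) :=
  eq_emb hB fun x => M.left_mul_apply hB m b x

theorem emb_mul_multiplier (m : M k B) (hB : Nondegenerate B) (b : B) :
    emb b * m = emb (m.right b) :=
  eq_emb hB fun x => M.compat m b x

theorem emb_mul_emb (a b : B) : emb (k := k) a * emb b = emb (a * b) :=
  M.ext_both (LinearMap.ext fun x => (mul_assoc a b x).symm)
    (LinearMap.ext fun x => mul_assoc x a b)

theorem tensLin_mul (m m' : M k B) (n n' : M k D) :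
    tensLin m n * tensLin m' n' = tensLin (m * m') (n * n') :=
  M.ext_both (TensorProduct.map_comp m.left n.left m'.left n'.left).symm
    (TensorProduct.map_comp m'.right n'.right m.right n.right).symm

theorem tensLin_emb_emb (b : B) (d : D) : tensLin (emb b) (emb d) = emb (k := k) (b ⊗ₜ[k] d) := by
  refine M.ext_both ?_ ?_ <;>
    exact TensorProduct.ext' fun x y => (Algebra.TensorProduct.tmul_mul_tmul _ _ _ _).symm

/-- A multiplier whose left and right actions agree is central. -/
theorem M.central (hB : Nondegenerate B) {n : M k B} (hn : ∀ x, n.left x = n.right x)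
    (m : M k B) : n * m = m * n := by
  refine M.ext_left hB fun z => ?_
  refine hB.ext_left fun x => ?_
  rw [M.left_mul, M.left_mul, M.compat, M.compat, M.compat, M.compat]
  congr 1
  refine hB.ext_right fun w => ?_
  rw [← M.compat, ← hn x, ← M.left_mul_apply hB, M.compat, ← hn, M.left_mul_apply hB]

theorem M.left_eq_right_of_comm (hB : Nondegenerate B) (hc : ∀ a b : B, a * b = b * a)
    (m : M k B) (x : B) : m.left x = m.right x := by
  refine hB.ext_right fun y => ?_
  rw [← M.compat, hc x, ← M.left_mul_apply hB, ← M.left_mul_apply hB, hc]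

end Multipliers

/-! ### Multipliers of tensor products covered on one leg -/

section Covered

variable {k : Type*} [Field k]
variable {B : Type*} [NonUnitalRing B] [Module k B] [SMulCommClass k B B] [IsScalarTower k B B]
variable {D : Type*} [NonUnitalRing D] [Module k D] [SMulCommClass k D D] [IsScalarTower k D D]

theorem mulRight_mul' (a b : B) :
    LinearMap.mulRight k (a * b) = LinearMap.mulRight k b ∘ₗ LinearMap.mulRight k a :=
  LinearMap.ext fun x => (mul_assoc x a b).symm

theorem mulLeft_mul' (a b : B) :
    LinearMap.mulLeft k (a * b) = LinearMap.mulLeft k a ∘ₗ LinearMap.mulLeft k b :=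
  LinearMap.ext fun x => mul_assoc a b x

theorem mulLeft_mulRight_comm (a b : B) :
    LinearMap.mulLeft k a ∘ₗ LinearMap.mulRight k b =
      LinearMap.mulRight k b ∘ₗ LinearMap.mulLeft k a :=
  LinearMap.ext fun x => (mul_assoc a x b).symm

theorem ext_mul_tmul (hB : Nondegenerate B) (hD : Nondegenerate D) {x y : B ⊗[k] D}
    (h : ∀ (b : B) (d : D), x * (b ⊗ₜ[k] d) = y * (b ⊗ₜ[k] d)) : x = y := by
  refine ext_mulRight_rTensor hB fun e => ext_mulRight_lTensor hD fun f => ?_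
  rw [← mul_tmul, ← mul_tmul, h]

theorem ext_tmul_mul (hB : Nondegenerate B) (hD : Nondegenerate D) {x y : B ⊗[k] D}
    (h : ∀ (b : B) (d : D), (b ⊗ₜ[k] d) * x = (b ⊗ₜ[k] d) * y) : x = y := by
  refine ext_mulLeft_rTensor hB fun e => ext_mulLeft_lTensor hD fun f => ?_
  rw [← tmul_mul, ← tmul_mul, h]

theorem emb_tmul_eq (b : B) (d : D) :
    emb (k := k) (b ⊗ₜ[k] d) = tensLin (emb b) 1 * tensLin 1 (emb d) := by
  rw [tensLin_mul, mul_one, one_mul, tensLin_emb_emb]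

theorem emb_tmul_eq' (b : B) (d : D) :
    emb (k := k) (b ⊗ₜ[k] d) = tensLin 1 (emb d) * tensLin (emb b) 1 := by
  rw [tensLin_mul, mul_one, one_mul, tensLin_emb_emb]

section

variable (hB : Nondegenerate B) (hD : Nondegenerate D)
include hB hD

theorem tens_emb_one_mul_emb (b : B) (w : B ⊗[k] D) :
    tensLin (emb b) 1 * emb w = emb ((LinearMap.mulLeft k b).rTensor D w) :=
  mul_emb (hB.tensor hD) _ _

theorem tens_one_emb_mul_emb (d : D) (w : B ⊗[k] D) :
    tensLin 1 (emb d) * emb w = emb ((LinearMap.mulLeft k d).lTensor B w) :=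
  mul_emb (hB.tensor hD) _ _

theorem emb_mul_tens_emb_one (b : B) (w : B ⊗[k] D) :
    emb w * tensLin (emb b) 1 = emb ((LinearMap.mulRight k b).rTensor D w) :=
  emb_mul_multiplier _ (hB.tensor hD) _

theorem emb_mul_tens_one_emb (d : D) (w : B ⊗[k] D) :
    emb w * tensLin 1 (emb d) = emb ((LinearMap.mulRight k d).lTensor B w) :=
  emb_mul_multiplier _ (hB.tensor hD) _

/-- In the multiplier algebra `b ⊗ d` factors through its legs in either order. Putting the covered
leg next to `m` turns `m` into the element `w`, and the remaining factor multiplies one leg of `w`.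
The next three lemmas vary the side and the leg. -/
theorem left_tmul_of_right_leg {m : M k (B ⊗[k] D)} {d : D} {w : B ⊗[k] D}
    (h : m * tensLin 1 (emb d) = emb w) (b : B) :
    m.left (b ⊗ₜ[k] d) = (LinearMap.mulRight k b).rTensor D w := by
  apply emb_injective (k := k) (hB.tensor hD)
  rw [← mul_emb (hB.tensor hD), emb_tmul_eq', ← mul_assoc, h, emb_mul_tens_emb_one hB hD]

theorem left_tmul_of_left_leg {m : M k (B ⊗[k] D)} {b : B} {w : B ⊗[k] D}
    (h : m * tensLin (emb b) 1 = emb w) (d : D) :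
    m.left (b ⊗ₜ[k] d) = (LinearMap.mulRight k d).lTensor B w := by
  apply emb_injective (k := k) (hB.tensor hD)
  rw [← mul_emb (hB.tensor hD), emb_tmul_eq, ← mul_assoc, h, emb_mul_tens_one_emb hB hD]

theorem right_tmul_of_left_leg {m : M k (B ⊗[k] D)} {b : B} {w : B ⊗[k] D}
    (h : tensLin (emb b) 1 * m = emb w) (d : D) :
    m.right (b ⊗ₜ[k] d) = (LinearMap.mulLeft k d).lTensor B w := by
  apply emb_injective (k := k) (hB.tensor hD)
  rw [← emb_mul_multiplier _ (hB.tensor hD), emb_tmul_eq', mul_assoc, h,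
    tens_one_emb_mul_emb hB hD]

theorem right_tmul_of_right_leg {m : M k (B ⊗[k] D)} {d : D} {w : B ⊗[k] D}
    (h : tensLin 1 (emb d) * m = emb w) (b : B) :
    m.right (b ⊗ₜ[k] d) = (LinearMap.mulLeft k b).rTensor D w := by
  apply emb_injective (k := k) (hB.tensor hD)
  rw [← emb_mul_multiplier _ (hB.tensor hD), emb_tmul_eq, mul_assoc, h,
    tens_emb_one_mul_emb hB hD]

/-- A converse of the preceding lemmas: the action on tensors with a fixed leg `d` already decides
that `m` is covered there. -/
theorem mul_tens_one_emb_eq {m : M k (B ⊗[k] D)} {d : D} {w : B ⊗[k] D}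
    (h : ∀ b, m.left (b ⊗ₜ[k] d) = (LinearMap.mulRight k b).rTensor D w) :
    m * tensLin 1 (emb d) = emb w := by
  refine eq_emb (hB.tensor hD) fun x => ?_
  induction x using TensorProduct.induction_on with
  | zero => simp only [map_zero, mul_zero]
  | add x y hx hy => rw [map_add, hx, hy, mul_add]
  | tmul b d' =>
    refine ext_mul_tmul hB hD fun u v => ?_
    change m.left (b ⊗ₜ[k] (d * d')) * (u ⊗ₜ[k] v) = _
    -- The hypothesis speaks of the second leg `d` only, so the surplus factor `d'` is moved into
    -- the test element: `(b ⊗ dd')(u ⊗ v) = (b ⊗ d)(u ⊗ d'v)`.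
    rw [← M.left_mul_apply (hB.tensor hD), Algebra.TensorProduct.tmul_mul_tmul, mul_assoc,
      ← Algebra.TensorProduct.tmul_mul_tmul, M.left_mul_apply (hB.tensor hD), h, mul_assoc,
      Algebra.TensorProduct.tmul_mul_tmul, mul_tmul, mul_tmul, mulRight_mul' b u,
      LinearMap.rTensor_comp, LinearMap.comp_apply]

theorem mul_tens_emb_one_eq {m : M k (B ⊗[k] D)} {b : B} {w : B ⊗[k] D}
    (h : ∀ d, m.left (b ⊗ₜ[k] d) = (LinearMap.mulRight k d).lTensor B w) :
    m * tensLin (emb b) 1 = emb w := by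
  refine eq_emb (hB.tensor hD) fun x => ?_
  induction x using TensorProduct.induction_on with
  | zero => simp only [map_zero, mul_zero]
  | add x y hx hy => rw [map_add, hx, hy, mul_add]
  | tmul b' d =>
    refine ext_mul_tmul hB hD fun u v => ?_
    change m.left ((b * b') ⊗ₜ[k] d) * (u ⊗ₜ[k] v) = _
    rw [← M.left_mul_apply (hB.tensor hD), Algebra.TensorProduct.tmul_mul_tmul, mul_assoc,
      ← Algebra.TensorProduct.tmul_mul_tmul, M.left_mul_apply (hB.tensor hD), h, mul_assoc,
      Algebra.TensorProduct.tmul_mul_tmul, mul_tmul, mul_tmul, mulRight_mul' d v,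
      LinearMap.lTensor_comp, LinearMap.comp_apply, rTensor_lTensor_comm]

theorem M.ext_right {m n : M k B} (h : ∀ x, m.right x = n.right x) : m = n := by
  refine M.ext_both (LinearMap.ext fun x => hB.ext_left fun z => ?_) (LinearMap.ext h)
  rw [M.compat, M.compat, h]

theorem tens_one_emb_mul_eq {m : M k (B ⊗[k] D)} {d : D} {w : B ⊗[k] D}
    (h : ∀ b, m.right (b ⊗ₜ[k] d) = (LinearMap.mulLeft k b).rTensor D w) :
    tensLin 1 (emb d) * m = emb w := by
  refine M.ext_right (hB.tensor hD) hB fun x => ?_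
  induction x using TensorProduct.induction_on with
  | zero => simp only [map_zero]
  | add x y hx hy => rw [map_add, map_add, hx, hy]
  | tmul b d' =>
    refine ext_tmul_mul hB hD fun u v => ?_
    change _ * m.right (b ⊗ₜ[k] (d' * d)) = _ * (b ⊗ₜ[k] d' * w)
    rw [← M.right_mul_apply (hB.tensor hD), Algebra.TensorProduct.tmul_mul_tmul, ← mul_assoc,
      ← Algebra.TensorProduct.tmul_mul_tmul, M.right_mul_apply (hB.tensor hD), h, ← mul_assoc,
      Algebra.TensorProduct.tmul_mul_tmul, tmul_mul, tmul_mul, mulLeft_mul' u b,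
      LinearMap.rTensor_comp, LinearMap.comp_apply]

theorem tens_emb_one_mul_eq {m : M k (B ⊗[k] D)} {b : B} {w : B ⊗[k] D}
    (h : ∀ d, m.right (b ⊗ₜ[k] d) = (LinearMap.mulLeft k d).lTensor B w) :
    tensLin (emb b) 1 * m = emb w := by
  refine M.ext_right (hB.tensor hD) hB fun x => ?_
  induction x using TensorProduct.induction_on with
  | zero => simp only [map_zero]
  | add x y hx hy => rw [map_add, map_add, hx, hy]
  | tmul b' d =>
    refine ext_tmul_mul hB hD fun u v => ?_
    change _ * m.right ((b' * b) ⊗ₜ[k] d) = _ * (b' ⊗ₜ[k] d * w)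
    rw [← M.right_mul_apply (hB.tensor hD), Algebra.TensorProduct.tmul_mul_tmul, ← mul_assoc,
      ← Algebra.TensorProduct.tmul_mul_tmul, M.right_mul_apply (hB.tensor hD), h, ← mul_assoc,
      Algebra.TensorProduct.tmul_mul_tmul, tmul_mul, tmul_mul, mulLeft_mul' v d,
      LinearMap.lTensor_comp, LinearMap.comp_apply, rTensor_lTensor_comm]

end

end Covered

/-! ### The canonical maps of a multiplier bialgebra -/

namespace IsPreMultiplierBialgebra

variable {k : Type*} [Field k]
variable {B : Type*} [NonUnitalRing B] [Module k B] [SMulCommClass k B B] [IsScalarTower k B B]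
variable {Δ : B →ₗ[k] M k (B ⊗[k] B)} (h : IsPreMultiplierBialgebra Δ)
include h

theorem nondegenerate_tensor : Nondegenerate (B ⊗[k] B) := h.nondegenerate.tensor h.nondegenerate

theorem emb_canonOne (a b : B) : emb (canonOne Δ a b) = Δ a * tensLin 1 (emb b) :=
  emb_pull h.nondegenerate_tensor (h.mem_one a b)

theorem emb_canonTwo (a b : B) : emb (canonTwo Δ a b) = tensLin (emb a) 1 * Δ b :=
  emb_pull h.nondegenerate_tensor (h.mem_two a b)

theorem emb_canonThree (a b : B) : emb (canonThree Δ a b) = Δ a * tensLin (emb b) 1 :=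
  emb_pull h.nondegenerate_tensor (h.mem_three a b)

theorem emb_canonFour (a b : B) : emb (canonFour Δ a b) = tensLin 1 (emb a) * Δ b :=
  emb_pull h.nondegenerate_tensor (h.mem_four a b)

theorem left_one (a x y : B) :
    (Δ a).left (x ⊗ₜ[k] y) = (LinearMap.mulRight k x).rTensor B (canonOne Δ a y) :=
  left_tmul_of_right_leg h.nondegenerate h.nondegenerate (h.emb_canonOne a y).symm x

theorem left_three (a x y : B) :
    (Δ a).left (x ⊗ₜ[k] y) = (LinearMap.mulRight k y).lTensor B (canonThree Δ a x) :=
  left_tmul_of_left_leg h.nondegenerate h.nondegenerate (h.emb_canonThree a x).symm y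

theorem right_two (a x y : B) :
    (Δ a).right (x ⊗ₜ[k] y) = (LinearMap.mulLeft k y).lTensor B (canonTwo Δ x a) :=
  right_tmul_of_left_leg h.nondegenerate h.nondegenerate (h.emb_canonTwo x a).symm y

theorem right_four (a x y : B) :
    (Δ a).right (x ⊗ₜ[k] y) = (LinearMap.mulLeft k x).rTensor B (canonFour Δ y a) :=
  right_tmul_of_right_leg h.nondegenerate h.nondegenerate (h.emb_canonFour y a).symm x

/-- Both sides are `(x ⊗ 1)Δ(a)(1 ⊗ y)`, bracketed in two ways. These exchange lemmas replace one
canonical map by another, so that a fact proved for one of them passes to the rest. -/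
theorem mulLeft_one_eq_mulRight_two (x a y : B) :
    (LinearMap.mulLeft k x).rTensor B (canonOne Δ a y) =
      (LinearMap.mulRight k y).lTensor B (canonTwo Δ x a) := by
  apply emb_injective (k := k) h.nondegenerate_tensor
  rw [← tens_emb_one_mul_emb h.nondegenerate h.nondegenerate,
    ← emb_mul_tens_one_emb h.nondegenerate h.nondegenerate, h.emb_canonOne, h.emb_canonTwo,
    mul_assoc]

theorem mulLeft_three_eq_mulRight_two (x a y : B) :
    (LinearMap.mulLeft k x).rTensor B (canonThree Δ a y) =
      (LinearMap.mulRight k y).rTensor B (canonTwo Δ x a) := by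
  apply emb_injective (k := k) h.nondegenerate_tensor
  rw [← tens_emb_one_mul_emb h.nondegenerate h.nondegenerate,
    ← emb_mul_tens_emb_one h.nondegenerate h.nondegenerate, h.emb_canonThree, h.emb_canonTwo,
    mul_assoc]

theorem mulLeft_one_eq_mulRight_four (x a y : B) :
    (LinearMap.mulLeft k x).lTensor B (canonOne Δ a y) =
      (LinearMap.mulRight k y).lTensor B (canonFour Δ x a) := by
  apply emb_injective (k := k) h.nondegenerate_tensor
  rw [← tens_one_emb_mul_emb h.nondegenerate h.nondegenerate,
    ← emb_mul_tens_one_emb h.nondegenerate h.nondegenerate, h.emb_canonOne, h.emb_canonFour,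
    mul_assoc]

theorem mulLeft_three_eq_mulRight_four (x a y : B) :
    (LinearMap.mulLeft k x).lTensor B (canonThree Δ a y) =
      (LinearMap.mulRight k y).rTensor B (canonFour Δ x a) := by
  apply emb_injective (k := k) h.nondegenerate_tensor
  rw [← tens_one_emb_mul_emb h.nondegenerate h.nondegenerate,
    ← emb_mul_tens_emb_one h.nondegenerate h.nondegenerate, h.emb_canonThree, h.emb_canonFour,
    mul_assoc]

theorem mulRight_one_eq_mulRight_three (a x y : B) :
    (LinearMap.mulRight k x).rTensor B (canonOne Δ a y) =
      (LinearMap.mulRight k y).lTensor B (canonThree Δ a x) := by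
  rw [← h.left_one, h.left_three]

theorem mulLeft_two_eq_mulLeft_four (a x y : B) :
    (LinearMap.mulLeft k y).lTensor B (canonTwo Δ x a) =
      (LinearMap.mulLeft k x).rTensor B (canonFour Δ y a) := by
  rw [← h.right_two, h.right_four]

theorem one_mul_right (a b c : B) :
    canonOne Δ a (b * c) = (LinearMap.mulRight k c).lTensor B (canonOne Δ a b) := by
  apply emb_injective (k := k) h.nondegenerate_tensor
  rw [← emb_mul_tens_one_emb h.nondegenerate h.nondegenerate, h.emb_canonOne, h.emb_canonOne,
    mul_assoc, tensLin_mul, one_mul, emb_mul_emb]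

theorem one_mul_left (a b c : B) :
    canonOne Δ (a * b) c = (Δ a).left (canonOne Δ b c) := by
  apply emb_injective (k := k) h.nondegenerate_tensor
  rw [← mul_emb h.nondegenerate_tensor, h.emb_canonOne, h.emb_canonOne, h.map_mul, mul_assoc]

theorem three_mul_left (a b c : B) :
    canonThree Δ (a * b) c = (Δ a).left (canonThree Δ b c) := by
  apply emb_injective (k := k) h.nondegenerate_tensor
  rw [← mul_emb h.nondegenerate_tensor, h.emb_canonThree, h.emb_canonThree, h.map_mul, mul_assoc]

theorem two_mul_right (a b c : B) :
    canonTwo Δ a (b * c) = (Δ c).right (canonTwo Δ a b) := by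
  apply emb_injective (k := k) h.nondegenerate_tensor
  rw [← emb_mul_multiplier _ h.nondegenerate_tensor, h.emb_canonTwo, h.emb_canonTwo, h.map_mul,
    mul_assoc]

end IsPreMultiplierBialgebra

/-! ### Slicing by functionals -/

section Slices

variable {k : Type*} [Field k]
variable {U V W X : Type*} [AddCommGroup U] [Module k U] [AddCommGroup V] [Module k V]
variable [AddCommGroup W] [Module k W] [AddCommGroup X] [Module k X]

/-- `ι ⊗ φ : U ⊗ V → U`. -/
def sliceR (φ : V →ₗ[k] k) : U ⊗[k] V →ₗ[k] U :=
  (TensorProduct.rid k U).toLinearMap ∘ₗ φ.lTensor U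

/-- `φ ⊗ ι : U ⊗ V → V`. -/
def sliceL (φ : U →ₗ[k] k) : U ⊗[k] V →ₗ[k] V :=
  (TensorProduct.lid k V).toLinearMap ∘ₗ φ.rTensor V

@[simp] theorem sliceR_tmul (φ : V →ₗ[k] k) (u : U) (v : V) : sliceR φ (u ⊗ₜ[k] v) = φ v • u := rfl

@[simp] theorem sliceL_tmul (φ : U →ₗ[k] k) (u : U) (v : V) : sliceL φ (u ⊗ₜ[k] v) = φ u • v := rfl

theorem sliceR_rTensor (φ : V →ₗ[k] k) (f : U →ₗ[k] W) (x : U ⊗[k] V) :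
    sliceR φ (f.rTensor V x) = f (sliceR φ x) := by
  induction x using TensorProduct.induction_on with
  | zero => simp
  | add x y hx hy => simp only [map_add, hx, hy]
  | tmul u v => simp

theorem sliceL_lTensor (φ : U →ₗ[k] k) (f : V →ₗ[k] W) (x : U ⊗[k] V) :
    sliceL φ (f.lTensor U x) = f (sliceL φ x) := by
  induction x using TensorProduct.induction_on with
  | zero => simp
  | add x y hx hy => simp only [map_add, hx, hy]
  | tmul u v => simp

theorem sliceR_lTensor_smul (φ : V →ₗ[k] k) (ψ : W →ₗ[k] k) (f : V →ₗ[k] W) (c : k)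
    (hf : ∀ v, ψ (f v) = c * φ v) (x : U ⊗[k] V) : sliceR ψ (f.lTensor U x) = c • sliceR φ x := by
  induction x using TensorProduct.induction_on with
  | zero => simp
  | add x y hx hy => simp only [map_add, hx, hy, smul_add]
  | tmul u v => simp [hf, mul_smul]

theorem lTensor_sliceL_assoc (φ : V →ₗ[k] k) (x : (U ⊗[k] V) ⊗[k] W) :
    (sliceL φ).lTensor U (TensorProduct.assoc k U V W x) = (sliceR φ).rTensor W x := by
  induction x using TensorProduct.induction_on with
  | zero => simp
  | add x y hx hy => simp only [map_add, hx, hy]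
  | tmul p w =>
    induction p using TensorProduct.induction_on with
    | zero => simp
    | add x y hx hy => simp only [TensorProduct.add_tmul, map_add, hx, hy]
    | tmul u v => simp [TensorProduct.smul_tmul]

theorem lTensor_sliceR_assoc (φ : W →ₗ[k] k) (x : (U ⊗[k] V) ⊗[k] W) :
    (sliceR φ).lTensor U (TensorProduct.assoc k U V W x) = sliceR φ x := by
  induction x using TensorProduct.induction_on with
  | zero => simp
  | add x y hx hy => simp only [map_add, hx, hy]
  | tmul p w =>
    induction p using TensorProduct.induction_on with
    | zero => simp
    | add x y hx hy => simp only [TensorProduct.add_tmul, map_add, hx, hy]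
    | tmul u v => simp

theorem rTensor_rTensor (f : U →ₗ[k] V) (g : V →ₗ[k] W) (x : U ⊗[k] X) :
    g.rTensor X (f.rTensor X x) = (g ∘ₗ f).rTensor X x := by
  rw [LinearMap.rTensor_comp, LinearMap.comp_apply]

theorem lTensor_lTensor (f : U →ₗ[k] V) (g : V →ₗ[k] W) (x : X ⊗[k] U) :
    g.lTensor X (f.lTensor X x) = (g ∘ₗ f).lTensor X x := by
  rw [LinearMap.lTensor_comp, LinearMap.comp_apply]

end Slices

/-! ### The slice of a multiplier bialgebra along a left counit -/

section SliceMap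

variable {k : Type*} [Field k]
variable {B : Type*} [NonUnitalRing B] [Module k B] [SMulCommClass k B B] [IsScalarTower k B B]

/-- `c ↦ (ι ⊗ ε)(Δ(c)(1 ⊗ d))`. -/
def sliceMap (Δ : B →ₗ[k] M k (B ⊗[k] B)) (ε : B →ₗ[k] k) (d : B) : B →ₗ[k] B :=
  sliceR ε ∘ₗ (canonOne Δ).flip d

theorem sliceMap_apply (Δ : B →ₗ[k] M k (B ⊗[k] B)) (ε : B →ₗ[k] k) (d c : B) :
    sliceMap Δ ε d c = sliceR ε (canonOne Δ c d) := rfl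

variable {Δ : B →ₗ[k] M k (B ⊗[k] B)} {ε : B →ₗ[k] k} {d₀ : B}
variable (h : IsPreMultiplierBialgebra Δ) (hε : IsLeftCounit Δ ε) (hd : ε d₀ = 1)

local notation "π" => sliceMap Δ ε d₀

include hε in
theorem sliceR_mulRight {U : Type*} [AddCommGroup U] [Module k U] (d : B) (x : U ⊗[k] B) :
    sliceR ε ((LinearMap.mulRight k d).lTensor U x) = ε d • sliceR ε x :=
  sliceR_lTensor_smul ε ε _ _ (fun v => by
    rw [LinearMap.mulRight_apply, hε.map_mul, mul_comm]) x

section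

include h hε hd

/-- The element `Δ(c)(e ⊗ d₀)` can be covered first on either leg; as `ε` is multiplicative, `d₀`
contributes only the factor `ε d₀ = 1`. -/
theorem sliceR_three (c e : B) : sliceR ε (canonThree Δ c e) = π c * e := by
  rw [sliceMap_apply, ← LinearMap.mulRight_apply (R := k), ← sliceR_rTensor,
    h.mulRight_one_eq_mulRight_three, sliceR_mulRight hε, hd, one_smul]

/-- Only `ε d` enters, so the slice does not depend on the chosen element `d₀`. -/
theorem sliceR_one (c d : B) : sliceR ε (canonOne Δ c d) = ε d • π c := by
  refine h.nondegenerate.ext_right fun e => ?_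
  rw [← LinearMap.mulRight_apply (R := k), ← sliceR_rTensor,
    h.mulRight_one_eq_mulRight_three, sliceR_mulRight hε, sliceR_three h hε hd, smul_mul_assoc]

theorem sliceR_two (e c : B) : sliceR ε (canonTwo Δ e c) = e * π c := by
  refine h.nondegenerate.ext_right fun b => ?_
  rw [← LinearMap.mulRight_apply (R := k), ← sliceR_rTensor, ← h.mulLeft_three_eq_mulRight_two,
    sliceR_rTensor, sliceR_three h hε hd, LinearMap.mulLeft_apply, mul_assoc]

theorem sliceR_left (c : B) (x : B ⊗[k] B) : sliceR ε ((Δ c).left x) = π c * sliceR ε x := by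
  induction x using TensorProduct.induction_on with
  | zero => simp only [map_zero, mul_zero]
  | add x y hx hy => simp only [map_add, hx, hy, mul_add]
  | tmul p q =>
    rw [h.left_three, sliceR_mulRight hε, sliceR_three h hε hd, sliceR_tmul, mul_smul_comm]

/-- Since `ε` is multiplicative, `ι ⊗ ε` turns the action of `Δ c` into multiplication by `π c`;
multiplicativity of `Δ` does the rest. -/
theorem sliceMap_mul (c c' : B) : π (c * c') = π c * π c' := by
  refine h.nondegenerate.ext_right fun e => ?_
  rw [← sliceR_three h hε hd, h.three_mul_left, sliceR_left h hε hd, sliceR_three h hε hd,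
    mul_assoc]

/-- Apply `ι ⊗ ε ⊗ ι` to coassociativity: one side becomes `(π ⊗ ι)Δ`, and on the other the left
counit law collapses `(ε ⊗ ι)Δ`. This is the identity `(π ⊗ ι)Δ = Δ`. -/
theorem sliceMap_one (c d : B) : (π).rTensor B (canonOne Δ c d) = canonOne Δ c d := by
  refine ext_mulLeft_rTensor h.nondegenerate fun a => ?_
  have := congrArg ((sliceL ε).lTensor B) (h.coassoc a c d)
  rw [lTensor_sliceL_assoc, rTensor_rTensor, lTensor_lTensor] at this
  have e₁ : sliceR ε ∘ₗ canonTwo Δ a = LinearMap.mulLeft k a ∘ₗ π :=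
    LinearMap.ext fun x => sliceR_two h hε hd a x
  have e₂ : sliceL ε ∘ₗ (canonOne Δ).flip d = LinearMap.mulRight k d :=
    LinearMap.ext fun x => hε.counit_left x d
  rw [e₁, e₂] at this
  rw [rTensor_rTensor, this, h.mulLeft_one_eq_mulRight_two]

/-- Apply `ι ⊗ ι ⊗ ε` to coassociativity; no counit law is needed. This is the identity `(ι ⊗ π)Δ =
Δπ`. -/
theorem lTensor_sliceMap_two (a b : B) : (π).lTensor B (canonTwo Δ a b) = canonTwo Δ a (π b) := by
  have := congrArg ((sliceR ε).lTensor B) (h.coassoc a b d₀)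
  rw [lTensor_sliceR_assoc, lTensor_lTensor, sliceR_rTensor] at this
  exact this.symm

/-- The outer `π` can be moved inside the slice onto the first leg of `Δ`, where it acts as the
identity by `sliceMap_one`. -/
theorem sliceMap_sliceMap (c : B) : π (π c) = π c := by
  conv_lhs => rw [sliceMap_apply Δ ε d₀ c, ← sliceR_rTensor, sliceMap_one h hε hd]
  rfl

theorem sliceMap_comp_mulLeft (a : B) :
    π ∘ₗ LinearMap.mulLeft k a = LinearMap.mulLeft k (π a) ∘ₗ π :=
  LinearMap.ext fun b => sliceMap_mul h hε hd a b

theorem sliceMap_comp_mulRight (a : B) :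
    π ∘ₗ LinearMap.mulRight k a = LinearMap.mulRight k (π a) ∘ₗ π :=
  LinearMap.ext fun b => sliceMap_mul h hε hd b a

theorem sliceMap_four (d c : B) : (π).rTensor B (canonFour Δ d c) = canonFour Δ d c := by
  refine ext_mulRight_lTensor h.nondegenerate fun e => ?_
  rw [← rTensor_lTensor_comm, ← h.mulLeft_one_eq_mulRight_four, rTensor_lTensor_comm,
    sliceMap_one h hε hd]

theorem sliceMap_two (a b : B) : (π).rTensor B (canonTwo Δ a b) = canonTwo Δ (π a) b := by
  refine ext_mulRight_lTensor h.nondegenerate fun c => ?_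
  rw [← rTensor_lTensor_comm, ← h.mulLeft_one_eq_mulRight_two, ← h.mulLeft_one_eq_mulRight_two,
    rTensor_rTensor, sliceMap_comp_mulLeft h hε hd, ← rTensor_rTensor, sliceMap_one h hε hd]

theorem sliceMap_three (c e : B) : (π).rTensor B (canonThree Δ c e) = canonThree Δ c (π e) := by
  refine ext_mulLeft_lTensor h.nondegenerate fun d => ?_
  rw [← rTensor_lTensor_comm, h.mulLeft_three_eq_mulRight_four, h.mulLeft_three_eq_mulRight_four,
    rTensor_rTensor, sliceMap_comp_mulRight h hε hd, ← rTensor_rTensor, sliceMap_four h hε hd]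

theorem lTensor_sliceMap_three (c e : B) :
    (π).lTensor B (canonThree Δ c e) = canonThree Δ (π c) e := by
  refine ext_mulLeft_rTensor h.nondegenerate fun a => ?_
  rw [rTensor_lTensor_comm, h.mulLeft_three_eq_mulRight_two, h.mulLeft_three_eq_mulRight_two,
    ← rTensor_lTensor_comm, lTensor_sliceMap_two h hε hd]

theorem lTensor_sliceMap_one (c d : B) :
    (π).lTensor B (canonOne Δ c d) = canonOne Δ (π c) (π d) := by
  refine ext_mulLeft_rTensor h.nondegenerate fun a => ?_
  rw [rTensor_lTensor_comm, h.mulLeft_one_eq_mulRight_two, h.mulLeft_one_eq_mulRight_two,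
    lTensor_lTensor, sliceMap_comp_mulRight h hε hd, ← lTensor_lTensor,
    lTensor_sliceMap_two h hε hd]

theorem lTensor_sliceMap_four (d c : B) :
    (π).lTensor B (canonFour Δ d c) = canonFour Δ (π d) (π c) := by
  refine ext_mulLeft_rTensor h.nondegenerate fun a => ?_
  rw [rTensor_lTensor_comm, ← h.mulLeft_two_eq_mulLeft_four, ← h.mulLeft_two_eq_mulLeft_four,
    lTensor_lTensor, sliceMap_comp_mulLeft h hε hd, ← lTensor_lTensor,
    lTensor_sliceMap_two h hε hd]

/-- Combines `(π ⊗ ι)Δ = Δ`, `(ι ⊗ π)Δ = Δπ` and the multiplicativity of `π`: the slice is a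
morphism for the action of `Δ`, and this is why `Δ` restricts to its image. -/
theorem map_sliceMap_left (c : B) (x : B ⊗[k] B) :
    TensorProduct.map π π ((Δ c).left x) = (Δ (π c)).left (TensorProduct.map π π x) := by
  induction x using TensorProduct.induction_on with
  | zero => simp only [map_zero]
  | add x y hx hy => simp only [map_add, hx, hy]
  | tmul e d =>
    rw [TensorProduct.map_tmul, h.left_one, h.left_one, ← LinearMap.lTensor_comp_rTensor,
      LinearMap.comp_apply, rTensor_rTensor, sliceMap_comp_mulRight h hε hd, ← rTensor_rTensor,
      sliceMap_one h hε hd, ← rTensor_lTensor_comm, lTensor_sliceMap_one h hε hd]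

theorem map_sliceMap_right (c : B) (x : B ⊗[k] B) :
    TensorProduct.map π π ((Δ c).right x) = (Δ (π c)).right (TensorProduct.map π π x) := by
  induction x using TensorProduct.induction_on with
  | zero => simp only [map_zero]
  | add x y hx hy => simp only [map_add, hx, hy]
  | tmul e d =>
    rw [TensorProduct.map_tmul, h.right_four, h.right_four, ← LinearMap.lTensor_comp_rTensor,
      LinearMap.comp_apply, rTensor_rTensor, sliceMap_comp_mulLeft h hε hd, ← rTensor_rTensor,
      sliceMap_four h hε hd, ← rTensor_lTensor_comm, lTensor_sliceMap_four h hε hd]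

end

end SliceMap

/-! ### Restriction of the comultiplication to the slice -/

section Retract

variable {k : Type*} [Field k]
variable {B : Type*} [NonUnitalRing B] [Module k B] [SMulCommClass k B B] [IsScalarTower k B B]
variable {D : Type*} [NonUnitalRing D] [Module k D] [SMulCommClass k D D] [IsScalarTower k D D]

/-- A linear family of multipliers from its left and right actions. -/
def M.mkLin {V : Type*} [AddCommGroup V] [Module k V] (L R : V →ₗ[k] B →ₗ[k] B)
    (h : ∀ (v : V) (a b : B), a * L v b = R v a * b) : V →ₗ[k] M k B where
  toFun v := M.mk (L v) (R v) (h v)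
  map_add' x y := M.ext_both (map_add L x y) (map_add R x y)
  map_smul' c x := M.ext_both (map_smul L c x) (map_smul R c x)

theorem tensorMap_mul (j : D →ₗ[k] B) (hj : ∀ x y, j (x * y) = j x * j y) (x y : D ⊗[k] D) :
    TensorProduct.map j j (x * y) = TensorProduct.map j j x * TensorProduct.map j j y := by
  induction x using TensorProduct.induction_on with
  | zero => simp only [zero_mul, map_zero]
  | add x₁ x₂ h₁ h₂ => rw [add_mul, map_add, map_add, add_mul, h₁, h₂]
  | tmul b d =>
    induction y using TensorProduct.induction_on with
    | zero => simp only [mul_zero, map_zero]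
    | add y₁ y₂ h₁ h₂ => rw [mul_add, map_add, map_add, mul_add, h₁, h₂]
    | tmul b' d' =>
      simp only [TensorProduct.map_tmul, Algebra.TensorProduct.tmul_mul_tmul, hj]

/-- `j : D → B` and `p : B → D` exhibit the algebra `D` as the image of the idempotent
`c ↦ (ι ⊗ ε)Δ(c)` of `B`. -/
structure IsSliceRetract (Δ : B →ₗ[k] M k (B ⊗[k] B)) (ε : B →ₗ[k] k) (d₀ : B)
    (j : D →ₗ[k] B) (p : B →ₗ[k] D) : Prop where
  pre : IsPreMultiplierBialgebra Δ
  counit : IsLeftCounit Δ ε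
  counit_eq_one : ε d₀ = 1
  map_mul : ∀ x y, j (x * y) = j x * j y
  left_inv : ∀ x, p (j x) = x
  comp_eq : ∀ b, j (p b) = sliceMap Δ ε d₀ b

namespace IsSliceRetract

variable {Δ : B →ₗ[k] M k (B ⊗[k] B)} {ε : B →ₗ[k] k} {d₀ : B} {j : D →ₗ[k] B} {p : B →ₗ[k] D}
variable (r : IsSliceRetract Δ ε d₀ j p)

include r

theorem sliceMap_map (x : D) : sliceMap Δ ε d₀ (j x) = j x := by
  rw [← r.comp_eq, r.left_inv]

theorem map_injective : Function.Injective j :=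
  Function.LeftInverse.injective r.left_inv

theorem tensor_left_inv (x : D ⊗[k] D) :
    TensorProduct.map p p (TensorProduct.map j j x) = x := by
  have : p ∘ₗ j = LinearMap.id := LinearMap.ext r.left_inv
  rw [← LinearMap.comp_apply, ← TensorProduct.map_comp, this, TensorProduct.map_id,
    LinearMap.id_apply]

theorem tensor_injective : Function.Injective (TensorProduct.map j j) :=
  Function.LeftInverse.injective r.tensor_left_inv

theorem tensor_comp_eq (x : B ⊗[k] B) :
    TensorProduct.map j j (TensorProduct.map p p x) =
      TensorProduct.map (sliceMap Δ ε d₀) (sliceMap Δ ε d₀) x := by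
  have : j ∘ₗ p = sliceMap Δ ε d₀ := LinearMap.ext r.comp_eq
  rw [← LinearMap.comp_apply, ← TensorProduct.map_comp, this]

theorem tensor_sliceMap_map (x : D ⊗[k] D) :
    TensorProduct.map (sliceMap Δ ε d₀) (sliceMap Δ ε d₀) (TensorProduct.map j j x) =
      TensorProduct.map j j x := by
  rw [← r.tensor_comp_eq, r.tensor_left_inv]

/-- The composite `j ∘ p` is `π`, which fixes everything in the image, so equivariance of `π ⊗ π`
shows that `Δ(D)` preserves `D ⊗ D` inside `B ⊗ B`. -/
theorem tensor_left (c : D) (x : D ⊗[k] D) :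
    TensorProduct.map j j (TensorProduct.map p p ((Δ (j c)).left (TensorProduct.map j j x))) =
      (Δ (j c)).left (TensorProduct.map j j x) := by
  rw [r.tensor_comp_eq, map_sliceMap_left r.pre r.counit r.counit_eq_one, r.sliceMap_map,
    r.tensor_sliceMap_map]

theorem tensor_right (c : D) (x : D ⊗[k] D) :
    TensorProduct.map j j (TensorProduct.map p p ((Δ (j c)).right (TensorProduct.map j j x))) =
      (Δ (j c)).right (TensorProduct.map j j x) := by
  rw [r.tensor_comp_eq, map_sliceMap_right r.pre r.counit r.counit_eq_one, r.sliceMap_map,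
    r.tensor_sliceMap_map]

/-- The restriction of `Δ` to the slice. -/
def comul : D →ₗ[k] M k (D ⊗[k] D) :=
  M.mkLin (((M.leftLin ∘ₗ Δ).compl₁₂ j (TensorProduct.map j j)).compr₂ (TensorProduct.map p p))
    (((M.rightLin ∘ₗ Δ).compl₁₂ j (TensorProduct.map j j)).compr₂ (TensorProduct.map p p))
    (fun c x y => by
      apply r.tensor_injective
      rw [tensorMap_mul j r.map_mul, tensorMap_mul j r.map_mul]
      simp only [LinearMap.compr₂_apply, LinearMap.compl₁₂_apply, LinearMap.comp_apply,
        M.leftLin_apply, M.rightLin_apply]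
      rw [r.tensor_left, r.tensor_right, M.compat])

theorem map_comul_left (c : D) (x : D ⊗[k] D) :
    TensorProduct.map j j ((r.comul c).left x) = (Δ (j c)).left (TensorProduct.map j j x) :=
  r.tensor_left c x

theorem map_comul_right (c : D) (x : D ⊗[k] D) :
    TensorProduct.map j j ((r.comul c).right x) = (Δ (j c)).right (TensorProduct.map j j x) :=
  r.tensor_right c x

theorem map_mulRight_rTensor (b : D) (x : D ⊗[k] D) :
    TensorProduct.map j j ((LinearMap.mulRight k b).rTensor D x) =
      (LinearMap.mulRight k (j b)).rTensor B (TensorProduct.map j j x) := by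
  induction x using TensorProduct.induction_on with
  | zero => simp only [map_zero]
  | add x y hx hy => simp only [map_add, hx, hy]
  | tmul u v => simp [r.map_mul]

theorem map_mulRight_lTensor (b : D) (x : D ⊗[k] D) :
    TensorProduct.map j j ((LinearMap.mulRight k b).lTensor D x) =
      (LinearMap.mulRight k (j b)).lTensor B (TensorProduct.map j j x) := by
  induction x using TensorProduct.induction_on with
  | zero => simp only [map_zero]
  | add x y hx hy => simp only [map_add, hx, hy]
  | tmul u v => simp [r.map_mul]

theorem map_mulLeft_rTensor (b : D) (x : D ⊗[k] D) :
    TensorProduct.map j j ((LinearMap.mulLeft k b).rTensor D x) =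
      (LinearMap.mulLeft k (j b)).rTensor B (TensorProduct.map j j x) := by
  induction x using TensorProduct.induction_on with
  | zero => simp only [map_zero]
  | add x y hx hy => simp only [map_add, hx, hy]
  | tmul u v => simp [r.map_mul]

theorem map_mulLeft_lTensor (b : D) (x : D ⊗[k] D) :
    TensorProduct.map j j ((LinearMap.mulLeft k b).lTensor D x) =
      (LinearMap.mulLeft k (j b)).lTensor B (TensorProduct.map j j x) := by
  induction x using TensorProduct.induction_on with
  | zero => simp only [map_zero]
  | add x y hx hy => simp only [map_add, hx, hy]
  | tmul u v => simp [r.map_mul]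

/-- The covered element is fixed by `π ⊗ π`, hence comes from `D ⊗ D`. Nothing about the
nondegeneracy of `D` enters here. -/
theorem map_map_one (c d : D) :
    TensorProduct.map j j (TensorProduct.map p p (canonOne Δ (j c) (j d))) =
      canonOne Δ (j c) (j d) := by
  rw [r.tensor_comp_eq, ← LinearMap.lTensor_comp_rTensor, LinearMap.comp_apply,
    sliceMap_one r.pre r.counit r.counit_eq_one,
    lTensor_sliceMap_one r.pre r.counit r.counit_eq_one, r.sliceMap_map, r.sliceMap_map]

theorem map_map_two (c d : D) :
    TensorProduct.map j j (TensorProduct.map p p (canonTwo Δ (j c) (j d))) =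
      canonTwo Δ (j c) (j d) := by
  rw [r.tensor_comp_eq, ← LinearMap.lTensor_comp_rTensor, LinearMap.comp_apply,
    sliceMap_two r.pre r.counit r.counit_eq_one,
    lTensor_sliceMap_two r.pre r.counit r.counit_eq_one, r.sliceMap_map, r.sliceMap_map]

theorem map_map_three (c d : D) :
    TensorProduct.map j j (TensorProduct.map p p (canonThree Δ (j c) (j d))) =
      canonThree Δ (j c) (j d) := by
  rw [r.tensor_comp_eq, ← LinearMap.lTensor_comp_rTensor, LinearMap.comp_apply,
    sliceMap_three r.pre r.counit r.counit_eq_one,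
    lTensor_sliceMap_three r.pre r.counit r.counit_eq_one, r.sliceMap_map, r.sliceMap_map]

theorem map_map_four (c d : D) :
    TensorProduct.map j j (TensorProduct.map p p (canonFour Δ (j c) (j d))) =
      canonFour Δ (j c) (j d) := by
  rw [r.tensor_comp_eq, ← LinearMap.lTensor_comp_rTensor, LinearMap.comp_apply,
    sliceMap_four r.pre r.counit r.counit_eq_one,
    lTensor_sliceMap_four r.pre r.counit r.counit_eq_one, r.sliceMap_map, r.sliceMap_map]

variable (hD : Nondegenerate D)
include hD

theorem comul_one (c d : D) : r.comul c * tensLin 1 (emb d) =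
    emb (TensorProduct.map p p (canonOne Δ (j c) (j d))) :=
  mul_tens_one_emb_eq hD hD fun b => r.tensor_injective (by
    rw [r.map_comul_left, TensorProduct.map_tmul, r.pre.left_one, r.map_mulRight_rTensor,
      r.map_map_one])

theorem comul_two (c d : D) : tensLin (emb c) 1 * r.comul d =
    emb (TensorProduct.map p p (canonTwo Δ (j c) (j d))) :=
  tens_emb_one_mul_eq hD hD fun b => r.tensor_injective (by
    rw [r.map_comul_right, TensorProduct.map_tmul, r.pre.right_two, r.map_mulLeft_lTensor,
      r.map_map_two])

theorem comul_three (c d : D) : r.comul c * tensLin (emb d) 1 =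
    emb (TensorProduct.map p p (canonThree Δ (j c) (j d))) :=
  mul_tens_emb_one_eq hD hD fun b => r.tensor_injective (by
    rw [r.map_comul_left, TensorProduct.map_tmul, r.pre.left_three, r.map_mulRight_lTensor,
      r.map_map_three])

theorem comul_four (c d : D) : tensLin 1 (emb c) * r.comul d =
    emb (TensorProduct.map p p (canonFour Δ (j c) (j d))) :=
  tens_one_emb_mul_eq hD hD fun b => r.tensor_injective (by
    rw [r.map_comul_right, TensorProduct.map_tmul, r.pre.right_four, r.map_mulLeft_rTensor,
      r.map_map_four])

theorem map_canonOne (c d : D) :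
    TensorProduct.map j j (canonOne r.comul c d) = canonOne Δ (j c) (j d) := by
  rw [← r.map_map_one]
  congr 1
  exact (congrArg pull (r.comul_one hD c d)).trans (pull_emb (hD.tensor hD) _)

theorem map_canonTwo (c d : D) :
    TensorProduct.map j j (canonTwo r.comul c d) = canonTwo Δ (j c) (j d) := by
  rw [← r.map_map_two]
  congr 1
  exact (congrArg pull (r.comul_two hD c d)).trans (pull_emb (hD.tensor hD) _)

theorem map_canonThree (c d : D) :
    TensorProduct.map j j (canonThree r.comul c d) = canonThree Δ (j c) (j d) := by
  rw [← r.map_map_three]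
  congr 1
  exact (congrArg pull (r.comul_three hD c d)).trans (pull_emb (hD.tensor hD) _)

theorem map_canonFour (c d : D) :
    TensorProduct.map j j (canonFour r.comul c d) = canonFour Δ (j c) (j d) := by
  rw [← r.map_map_four]
  congr 1
  exact (congrArg pull (r.comul_four hD c d)).trans (pull_emb (hD.tensor hD) _)

omit hD in
theorem triple_injective :
    Function.Injective (TensorProduct.map j (TensorProduct.map j j)) := by
  have h₁ : p ∘ₗ j = LinearMap.id := LinearMap.ext r.left_inv
  have h₂ : TensorProduct.map p p ∘ₗ TensorProduct.map j j = LinearMap.id :=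
    LinearMap.ext r.tensor_left_inv
  refine Function.LeftInverse.injective (g := TensorProduct.map p (TensorProduct.map p p))
    fun x => ?_
  rw [← LinearMap.comp_apply, ← TensorProduct.map_comp, h₁, h₂, TensorProduct.map_id,
    LinearMap.id_apply]

theorem map_two_rTensor (a : D) (x : D ⊗[k] D) :
    TensorProduct.map j (TensorProduct.map j j)
      (TensorProduct.assoc k D D D ((canonTwo r.comul a).rTensor D x)) =
    TensorProduct.assoc k B B B ((canonTwo Δ (j a)).rTensor B (TensorProduct.map j j x)) := by
  induction x using TensorProduct.induction_on with
  | zero => simp only [map_zero]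
  | add x y hx hy => simp only [map_add, hx, hy]
  | tmul u v =>
    rw [TensorProduct.map_tmul, LinearMap.rTensor_tmul, LinearMap.rTensor_tmul,
      ← r.map_canonTwo hD]
    induction canonTwo r.comul a u using TensorProduct.induction_on with
    | zero => simp only [map_zero, TensorProduct.zero_tmul]
    | add x y hx hy => simp only [map_add, TensorProduct.add_tmul, hx, hy]
    | tmul s t => rfl

theorem map_one_lTensor (c : D) (x : D ⊗[k] D) :
    TensorProduct.map j (TensorProduct.map j j) (((canonOne r.comul).flip c).lTensor D x) =
    ((canonOne Δ).flip (j c)).lTensor B (TensorProduct.map j j x) := by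
  induction x using TensorProduct.induction_on with
  | zero => simp only [map_zero]
  | add x y hx hy => simp only [map_add, hx, hy]
  | tmul u v =>
    rw [TensorProduct.map_tmul, LinearMap.lTensor_tmul, LinearMap.lTensor_tmul,
      LinearMap.flip_apply, LinearMap.flip_apply, ← r.map_canonOne hD, TensorProduct.map_tmul]

theorem isPreMultiplierBialgebra_comul : IsPreMultiplierBialgebra r.comul where
  nondegenerate := hD
  map_mul a b := by
    refine M.ext_left (hD.tensor hD) fun x => r.tensor_injective ?_
    rw [r.map_comul_left, M.left_mul, r.map_comul_left, r.map_comul_left, r.map_mul,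
      r.pre.map_mul, M.left_mul]
  mem_one a b := ⟨_, (r.comul_one hD a b).symm⟩
  mem_two a b := ⟨_, (r.comul_two hD a b).symm⟩
  mem_three a b := ⟨_, (r.comul_three hD a b).symm⟩
  mem_four a b := ⟨_, (r.comul_four hD a b).symm⟩
  coassoc a b c := by
    apply r.triple_injective
    rw [r.map_two_rTensor hD, r.map_one_lTensor hD, r.map_canonOne hD, r.map_canonTwo hD,
      r.pre.coassoc]

omit hD in
theorem map_sliceL (x : D ⊗[k] D) :
    j (sliceL (ε ∘ₗ j) x) = sliceL ε (TensorProduct.map j j x) := by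
  induction x using TensorProduct.induction_on with
  | zero => simp only [map_zero]
  | add x y hx hy => simp only [map_add, hx, hy]
  | tmul u v => simp

omit hD in
theorem map_sliceR (x : D ⊗[k] D) :
    j (sliceR (ε ∘ₗ j) x) = sliceR ε (TensorProduct.map j j x) := by
  induction x using TensorProduct.induction_on with
  | zero => simp only [map_zero]
  | add x y hx hy => simp only [map_add, hx, hy]
  | tmul u v => simp

theorem isLeftCounit_comul : IsLeftCounit r.comul (ε ∘ₗ j) where
  map_mul a b := by
    rw [LinearMap.comp_apply, r.map_mul, r.counit.map_mul, LinearMap.comp_apply,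
      LinearMap.comp_apply]
  counit_left a b := by
    apply r.map_injective
    change j (sliceL _ _) = _
    rw [r.map_sliceL, r.map_canonOne hD, r.map_mul]
    exact r.counit.counit_left _ _
  counit_right a b := by
    apply r.map_injective
    change j (sliceL _ _) = _
    rw [r.map_sliceL, r.map_canonFour hD, r.map_mul]
    exact r.counit.counit_right _ _

/-- By construction `(ι ⊗ ε)Δ` is `π`, and `π` is the identity on the image. On all of `B` the right
counit law may fail. -/
theorem isRightCounit_comul : IsRightCounit r.comul (ε ∘ₗ j) where
  map_mul a b := by
    rw [LinearMap.comp_apply, r.map_mul, r.counit.map_mul, LinearMap.comp_apply,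
      LinearMap.comp_apply]
  counit_left a b := by
    apply r.map_injective
    change j (sliceR _ _) = _
    rw [r.map_sliceR, r.map_canonThree hD, r.map_mul,
      sliceR_three r.pre r.counit r.counit_eq_one, r.sliceMap_map]
  counit_right a b := by
    apply r.map_injective
    change j (sliceR _ _) = _
    rw [r.map_sliceR, r.map_canonTwo hD, r.map_mul,
      sliceR_two r.pre r.counit r.counit_eq_one, r.sliceMap_map]

omit hD in
theorem map_left (b : B) (x : B ⊗[k] B) :
    TensorProduct.map p p ((Δ b).left x) = (r.comul (p b)).left (TensorProduct.map p p x) := by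
  apply r.tensor_injective
  rw [r.map_comul_left, r.tensor_comp_eq, r.tensor_comp_eq, r.comp_eq,
    map_sliceMap_left r.pre r.counit r.counit_eq_one]

omit hD in
theorem map_right (b : B) (x : B ⊗[k] B) :
    TensorProduct.map p p ((Δ b).right x) = (r.comul (p b)).right (TensorProduct.map p p x) := by
  apply r.tensor_injective
  rw [r.map_comul_right, r.tensor_comp_eq, r.tensor_comp_eq, r.comp_eq,
    map_sliceMap_right r.pre r.counit r.counit_eq_one]

omit hD in
-- Since `p ⊗ p` is onto and `j ⊗ j` is injective, it suffices that `S` fills `B ⊗ B` modulo the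
-- kernel of `π ⊗ π`.
theorem span_top {S : Submodule k (B ⊗[k] B)} {T : Submodule k (D ⊗[k] D)}
    (hST : S.map (TensorProduct.map p p) ≤ T)
    (hS : ∀ x, ∃ s ∈ S, TensorProduct.map (sliceMap Δ ε d₀) (sliceMap Δ ε d₀) s =
      TensorProduct.map (sliceMap Δ ε d₀) (sliceMap Δ ε d₀) x) : T = ⊤ := by
  rw [eq_top_iff]
  rintro y -
  obtain ⟨s, hs, e⟩ := hS (TensorProduct.map j j y)
  refine hST ⟨s, hs, r.tensor_injective ?_⟩
  rw [r.tensor_comp_eq, e, r.tensor_sliceMap_map]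

omit hD in
-- The map `p` intertwines the two comultiplications, so `p ⊗ p` carries products `Δ(b)d` to
-- products for the restriction. Nondegeneracy of `Δ` itself is not required, only its image under
-- `π ⊗ π`.
theorem isNondegenerateHom_comul
    (hl : ∀ x, ∃ s ∈ Submodule.span k {x | ∃ b d, x = (Δ b).left d},
      TensorProduct.map (sliceMap Δ ε d₀) (sliceMap Δ ε d₀) s =
        TensorProduct.map (sliceMap Δ ε d₀) (sliceMap Δ ε d₀) x)
    (hr : ∀ x, ∃ s ∈ Submodule.span k {x | ∃ b d, x = (Δ b).right d},
      TensorProduct.map (sliceMap Δ ε d₀) (sliceMap Δ ε d₀) s =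
        TensorProduct.map (sliceMap Δ ε d₀) (sliceMap Δ ε d₀) x) :
    IsNondegenerateHom r.comul := by
  constructor
  · refine r.span_top ?_ hl
    rw [Submodule.map_span_le]
    rintro _ ⟨b, d, rfl⟩
    exact Submodule.subset_span ⟨p b, _, r.map_left b d⟩
  · refine r.span_top ?_ hr
    rw [Submodule.map_span_le]
    rintro _ ⟨b, d, rfl⟩
    exact Submodule.subset_span ⟨p b, _, r.map_right b d⟩

omit hD in
-- An element of `D` multiplies `p b` to zero exactly when `π` kills the corresponding product in
-- `B`, since `π` is multiplicative and fixes `D`.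
theorem nondegenerate
    (hl : ∀ c, (∀ b, sliceMap Δ ε d₀ (c * b) = 0) → sliceMap Δ ε d₀ c = 0)
    (hr : ∀ c, (∀ b, sliceMap Δ ε d₀ (b * c) = 0) → sliceMap Δ ε d₀ c = 0) :
    Nondegenerate D := by
  constructor
  · intro a ha
    apply r.map_injective
    rw [map_zero, ← r.sliceMap_map]
    refine hl _ fun b => ?_
    rw [sliceMap_mul r.pre r.counit r.counit_eq_one, r.sliceMap_map, ← r.comp_eq, ← r.map_mul, ha,
      map_zero]
  · intro a ha
    apply r.map_injective
    rw [map_zero, ← r.sliceMap_map]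
    refine hr _ fun b => ?_
    rw [sliceMap_mul r.pre r.counit r.counit_eq_one, r.sliceMap_map, ← r.comp_eq, ← r.map_mul, ha,
      map_zero]

end IsSliceRetract

end Retract

/-! ### The slice as a subalgebra -/

section SliceSubalgebra

variable {k : Type*} [Field k]
variable {B : Type*} [NonUnitalRing B] [Module k B] [SMulCommClass k B B] [IsScalarTower k B B]
variable {Δ : B →ₗ[k] M k (B ⊗[k] B)} {ε : B →ₗ[k] k} {d₀ : B}

/-- The image of `c ↦ (ι ⊗ ε)Δ(c)` as a subalgebra. -/
def sliceSubalgebra (h : IsPreMultiplierBialgebra Δ) (hε : IsLeftCounit Δ ε) (hd : ε d₀ = 1) :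
    NonUnitalSubalgebra k B :=
  { LinearMap.range (sliceMap Δ ε d₀) with
    mul_mem' := by
      rintro _ _ ⟨a, rfl⟩ ⟨b, rfl⟩
      exact ⟨a * b, sliceMap_mul h hε hd a b⟩ }

/-- The four last hypotheses are all that the formal argument leaves open: nondegeneracy of the
image as an algebra, and of the restricted comultiplication, on each side. -/
theorem exists_restriction_slice (h : IsPreMultiplierBialgebra Δ) (hε : IsLeftCounit Δ ε)
    (hd : ε d₀ = 1)
    (hl : ∀ c, (∀ b, sliceMap Δ ε d₀ (c * b) = 0) → sliceMap Δ ε d₀ c = 0)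
    (hr : ∀ c, (∀ b, sliceMap Δ ε d₀ (b * c) = 0) → sliceMap Δ ε d₀ c = 0)
    (hl' : ∀ x, ∃ s ∈ Submodule.span k {x | ∃ b d, x = (Δ b).left d},
      TensorProduct.map (sliceMap Δ ε d₀) (sliceMap Δ ε d₀) s =
        TensorProduct.map (sliceMap Δ ε d₀) (sliceMap Δ ε d₀) x)
    (hr' : ∀ x, ∃ s ∈ Submodule.span k {x | ∃ b d, x = (Δ b).right d},
      TensorProduct.map (sliceMap Δ ε d₀) (sliceMap Δ ε d₀) s =
        TensorProduct.map (sliceMap Δ ε d₀) (sliceMap Δ ε d₀) x) :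
    ∃ C : NonUnitalSubalgebra k B, C.toSubmodule = sliceSubspace Δ ε ∧
      ∃ ΔC : C →ₗ[k] M k (C ⊗[k] C), IsRestriction C Δ ΔC ∧ IsMultiplierBialgebra ΔC ∧
        IsLeftCounit ΔC (ε ∘ₗ C.toSubmodule.subtype) ∧
        IsRightCounit ΔC (ε ∘ₗ C.toSubmodule.subtype) := by
  have hC : (sliceSubalgebra h hε hd).toSubmodule = sliceSubspace Δ ε := by
    change LinearMap.range (sliceMap Δ ε d₀) = _
    apply le_antisymm
    · rintro _ ⟨c, rfl⟩
      exact Submodule.subset_span ⟨c, d₀, hd, rfl⟩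
    · refine Submodule.span_le.mpr ?_
      rintro _ ⟨a, b, hb, rfl⟩
      refine ⟨a, ?_⟩
      have := sliceR_one h hε hd a b
      rw [hb, one_smul] at this
      exact this.symm
  have r : IsSliceRetract (D := sliceSubalgebra h hε hd) Δ ε d₀
      (sliceSubalgebra h hε hd).toSubmodule.subtype (sliceMap Δ ε d₀).rangeRestrict :=
    { pre := h
      counit := hε
      counit_eq_one := hd
      map_mul := fun _ _ => rfl
      left_inv := by
        rintro ⟨_, c, rfl⟩
        exact Subtype.ext (sliceMap_sliceMap h hε hd c)
      comp_eq := fun _ => rfl }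
  have hD := r.nondegenerate hl hr
  exact ⟨sliceSubalgebra h hε hd, hC, r.comul,
    fun c x => ⟨r.map_comul_left c x, r.map_comul_right c x⟩,
    { toIsPreMultiplierBialgebra := r.isPreMultiplierBialgebra_comul hD
      nondegenerateHom := r.isNondegenerateHom_comul hl' hr' },
    r.isLeftCounit_comul hD, r.isRightCounit_comul hD⟩

end SliceSubalgebra

/-! ### The counit of a multiplier Hopf algebra -/

section Counit

variable {k : Type*} [Field k]
variable {A : Type*} [NonUnitalRing A] [Module k A] [SMulCommClass k A A] [IsScalarTower k A A]
variable {Δ : A →ₗ[k] M k (A ⊗[k] A)}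

/-- Applied to the canonical maps: an identity of linear maps on `A ⊗ A` need only be checked on
elements such as `Δ(a)(1 ⊗ b)`, where the axioms compute both sides. -/
theorem forall_of_surjective_lift {U V W : Type*} [AddCommGroup U] [Module k U]
    [AddCommGroup V] [Module k V] [AddCommGroup W] [Module k W] {X : Type*} [AddCommGroup X]
    [Module k X] {t : U →ₗ[k] V →ₗ[k] W} (ht : Function.Surjective (TensorProduct.lift t))
    {f g : W →ₗ[k] X} (h : ∀ u v, f (t u v) = g (t u v)) (w : W) : f w = g w := by
  obtain ⟨x, rfl⟩ := ht w
  induction x using TensorProduct.induction_on with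
  | zero => simp only [map_zero]
  | add x y hx hy => simp only [map_add, hx, hy]
  | tmul u v => exact h u v

/-- The inverse of `a ⊗ b ↦ Δ(a)(1 ⊗ b)`. -/
def IsMultiplierHopf.equivOne (h : IsMultiplierHopf Δ) : A ⊗[k] A ≃ₗ[k] A ⊗[k] A :=
  LinearEquiv.ofBijective (TensorProduct.lift (canonOne Δ)) h.bijective_one

/-- The inverse of `a ⊗ b ↦ (a ⊗ 1)Δ(b)`. -/
def IsMultiplierHopf.equivTwo (h : IsMultiplierHopf Δ) : A ⊗[k] A ≃ₗ[k] A ⊗[k] A :=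
  LinearEquiv.ofBijective (TensorProduct.lift (canonTwo Δ)) h.bijective_two

namespace IsMultiplierHopf

variable (h : IsMultiplierHopf Δ)
include h

theorem equivOne_symm_canonOne (a b : A) : h.equivOne.symm (canonOne Δ a b) = a ⊗ₜ[k] b :=
  h.equivOne.symm_apply_apply (a ⊗ₜ[k] b)

theorem equivTwo_symm_canonTwo (a b : A) : h.equivTwo.symm (canonTwo Δ a b) = a ⊗ₜ[k] b :=
  h.equivTwo.symm_apply_apply (a ⊗ₜ[k] b)

/-- `Δ(a)(1 ⊗ b) ↦ ab`. -/
def mulOne : A ⊗[k] A →ₗ[k] A := LinearMap.mul' k A ∘ₗ h.equivOne.symm.toLinearMap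

/-- `(a ⊗ 1)Δ(b) ↦ ab`. -/
def mulTwo : A ⊗[k] A →ₗ[k] A := LinearMap.mul' k A ∘ₗ h.equivTwo.symm.toLinearMap

theorem mulOne_canonOne (a b : A) : h.mulOne (canonOne Δ a b) = a * b := by
  rw [mulOne, LinearMap.comp_apply, LinearEquiv.coe_coe, h.equivOne_symm_canonOne,
    LinearMap.mul'_apply]

theorem mulTwo_canonTwo (a b : A) : h.mulTwo (canonTwo Δ a b) = a * b := by
  rw [mulTwo, LinearMap.comp_apply, LinearEquiv.coe_coe, h.equivTwo_symm_canonTwo,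
    LinearMap.mul'_apply]

/-- On `w = Δ(p)(1 ⊗ q)` coassociativity places `Δ(·)(1 ⊗ q)` on the second leg of `(a ⊗ 1)Δ(p)`;
`mulOne` turns it into right multiplication by `q`, giving `(a ⊗ 1)Δ(p)(1 ⊗ q)`. -/
theorem lTensor_mulOne (a : A) (w : A ⊗[k] A) :
    h.mulOne.lTensor A (TensorProduct.assoc k A A A ((canonTwo Δ a).rTensor A w)) =
      (LinearMap.mulLeft k a).rTensor A w := by
  refine forall_of_surjective_lift h.bijective_one.2
    (f := h.mulOne.lTensor A ∘ₗ (TensorProduct.assoc k A A A).toLinearMap ∘ₗ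
      (canonTwo Δ a).rTensor A) (g := (LinearMap.mulLeft k a).rTensor A) (fun p q => ?_) w
  simp only [LinearMap.comp_apply, LinearEquiv.coe_coe]
  rw [h.coassoc, lTensor_lTensor, h.mulLeft_one_eq_mulRight_two]
  congr 2
  exact LinearMap.ext fun x => h.mulOne_canonOne x q

/-- The left side has first leg `x` and the right side has second leg `c`. Such an equality forces
`mulOne (y ⊗ c)` to be a scalar multiple of `c` with a scalar depending on `y` alone: this scalar is
the counit. -/
theorem tmul_mulOne (x y c : A) :
    x ⊗ₜ[k] h.mulOne (y ⊗ₜ[k] c) = h.mulTwo (x ⊗ₜ[k] y) ⊗ₜ[k] c := by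
  refine forall_of_surjective_lift h.bijective_two.2
    (f := h.mulOne.lTensor A ∘ₗ (TensorProduct.assoc k A A A).toLinearMap ∘ₗ
      (TensorProduct.mk k (A ⊗[k] A) A).flip c)
    (g := (TensorProduct.mk k A A).flip c ∘ₗ h.mulTwo) (fun a b => ?_) (x ⊗ₜ[k] y)
  simp only [LinearMap.comp_apply, LinearEquiv.coe_coe, LinearMap.flip_apply,
    TensorProduct.mk_apply, h.mulTwo_canonTwo]
  exact h.lTensor_mulOne a (b ⊗ₜ[k] c)

theorem exists_counit : ∃ ε : A →ₗ[k] k, IsHopfCounit Δ ε := by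
  by_cases hA : ∃ x : A, x ≠ 0
  · obtain ⟨x, hx⟩ := hA
    obtain ⟨ω, hω⟩ := Module.Projective.exists_dual_ne_zero k hx
    -- The scalar is read off by slicing the first leg with a functional that does not vanish at the
    -- fixed `x`, normalised by its value there.
    let ε : A →ₗ[k] k := (ω x)⁻¹ • (ω ∘ₗ h.mulTwo ∘ₗ TensorProduct.mk k A A x)
    have h₁ : ∀ y c, h.mulOne (y ⊗ₜ[k] c) = ε y • c := by
      intro y c
      have := congrArg (sliceL ω) (h.tmul_mulOne x y c)
      rw [sliceL_tmul, sliceL_tmul] at this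
      change _ = ((ω x)⁻¹ * ω (h.mulTwo (x ⊗ₜ[k] y))) • c
      rw [mul_smul, ← this, smul_smul, inv_mul_cancel₀ hω, one_smul]
    have h₂ : h.mulOne = sliceL ε := TensorProduct.ext' h₁
    have h₃ : h.mulTwo = sliceR ε := by
      refine TensorProduct.ext' fun p q => ?_
      have := congrArg (sliceR ω) (h.tmul_mulOne p q x)
      rw [h₁, sliceR_tmul, sliceR_tmul, map_smul, smul_eq_mul, mul_comm, mul_smul] at this
      rw [sliceR_tmul]
      exact (smul_right_injective A hω this).symm
    exact ⟨ε, fun a b => ⟨(LinearMap.congr_fun h₂ _).symm.trans (h.mulOne_canonOne a b),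
      (LinearMap.congr_fun h₃ _).symm.trans (h.mulTwo_canonTwo a b)⟩⟩
  · have hA' : ∀ x : A, x = 0 := fun x => by_contra fun hx => hA ⟨x, hx⟩
    exact ⟨0, fun a b => ⟨(hA' _).trans (hA' _).symm, (hA' _).trans (hA' _).symm⟩⟩

theorem hopfCounit_spec : IsHopfCounit Δ (hopfCounit Δ) :=
  Classical.epsilon_spec h.exists_counit

end IsMultiplierHopf

namespace IsHopfCounit

variable {ε : A →ₗ[k] k} (hε : IsHopfCounit Δ ε)
include hε

theorem sliceL_one (a b : A) : sliceL ε (canonOne Δ a b) = a * b := (hε a b).1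

theorem sliceR_two (a b : A) : sliceR ε (canonTwo Δ a b) = a * b := (hε a b).2

theorem sliceR_three (h : IsPreMultiplierBialgebra Δ) (a b : A) :
    sliceR ε (canonThree Δ a b) = a * b := by
  refine h.nondegenerate.ext_left fun c => ?_
  rw [← LinearMap.mulLeft_apply (R := k), ← sliceR_rTensor, h.mulLeft_three_eq_mulRight_two,
    sliceR_rTensor, hε.sliceR_two, LinearMap.mulRight_apply, mul_assoc]

theorem sliceL_four (h : IsPreMultiplierBialgebra Δ) (a b : A) :
    sliceL ε (canonFour Δ a b) = a * b := by
  refine h.nondegenerate.ext_right fun c => ?_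
  rw [← LinearMap.mulRight_apply (R := k), ← sliceL_lTensor, ← h.mulLeft_one_eq_mulRight_four,
    sliceL_lTensor, hε.sliceL_one, LinearMap.mulLeft_apply, mul_assoc]

variable (h : IsMultiplierHopf Δ)
include h

/-- The identity `(ι ⊗ ε)((1 ⊗ a)w) = ε(a)(ι ⊗ ε)(w)` holds for `w = (p ⊗ 1)Δ(b)`, because `(p ⊗
a)Δ(b)` slices to `ε(a)pb`. Such `w` span, so it may be evaluated at `w = x ⊗ b` with `x ≠ 0`. -/
theorem map_mul (a b : A) : ε (a * b) = ε a * ε b := by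
  by_cases hA : ∃ x : A, x ≠ 0
  · obtain ⟨x, hx⟩ := hA
    have h₁ : ∀ (b : A) (w : A ⊗[k] A),
        sliceR ε ((Δ b).right w) = (LinearMap.mulRight k b ∘ₗ sliceR ε) w := by
      intro b w
      refine forall_of_surjective_lift h.bijective_two.2 (f := sliceR ε ∘ₗ (Δ b).right)
        (fun x a => ?_) w
      rw [LinearMap.comp_apply, ← h.two_mul_right, LinearMap.comp_apply, hε.sliceR_two,
        hε.sliceR_two, LinearMap.mulRight_apply, mul_assoc]
    have h₂ : sliceR ε ((LinearMap.mulLeft k a).lTensor A (x ⊗ₜ[k] b)) =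
        (ε a • sliceR ε) (x ⊗ₜ[k] b) := by
      refine forall_of_surjective_lift h.bijective_two.2
        (f := sliceR ε ∘ₗ (LinearMap.mulLeft k a).lTensor A) (g := ε a • sliceR ε)
        (fun p b => ?_) (x ⊗ₜ[k] b)
      rw [LinearMap.comp_apply, ← h.right_two, h₁, LinearMap.comp_apply, sliceR_tmul,
        LinearMap.smul_apply, hε.sliceR_two, LinearMap.mulRight_apply, smul_mul_assoc]
    rw [LinearMap.lTensor_tmul, sliceR_tmul, LinearMap.smul_apply, sliceR_tmul, smul_smul] at h₂
    exact smul_left_injective k hx h₂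
  · have hA' : ∀ x : A, x = 0 := fun x => by_contra fun hx => hA ⟨x, hx⟩
    rw [hA' (a * b), hA' a, map_zero, zero_mul]

/-- If the counit vanished, the counit law would make every product zero, against nondegeneracy. -/
theorem exists_eq_one (x : A) (hx : x ≠ 0) : ∃ c, ε c = 1 := by
  by_contra hc
  have h₀ : ε = 0 := by
    ext c
    by_contra h'
    exact hc ⟨(ε c)⁻¹ • c, by rw [map_smul, smul_eq_mul, inv_mul_cancel₀ h']⟩
  refine hx (h.nondegenerate.1 x fun b => ?_)
  rw [← hε.sliceL_one, h₀]
  simp [sliceL]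

/-- Composing the product with the inverse of `a ⊗ b ↦ Δ(a)(1 ⊗ b)` gives `ε ⊗ ι`, which is onto.
Thus `A` is spanned by products, a substitute for a unit in later arguments. -/
theorem mul'_surjective : Function.Surjective (LinearMap.mul' k A) := by
  intro x
  by_cases hx : x = 0
  · exact ⟨0, by rw [hx, map_zero]⟩
  · obtain ⟨c, hc⟩ := hε.exists_eq_one h x hx
    refine ⟨h.equivOne.symm (c ⊗ₜ[k] x), ?_⟩
    have := forall_of_surjective_lift h.bijective_one.2 (f := h.mulOne) (g := sliceL ε)
      (fun a b => by rw [h.mulOne_canonOne, hε.sliceL_one]) (c ⊗ₜ[k] x)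
    rw [sliceL_tmul, hc, one_smul] at this
    exact this

end IsHopfCounit

/-! ### The antipode, as a pairing -/

namespace IsMultiplierHopf

variable {ε : A →ₗ[k] k} (h : IsMultiplierHopf Δ) (hε : IsHopfCounit Δ ε)

/-- `a ⊗ b ↦ S(a)b`, the map with `Δ(a)(1 ⊗ b) ↦ ε(a)b`. -/
def antipodeL (ε : A →ₗ[k] k) : A ⊗[k] A →ₗ[k] A := sliceL ε ∘ₗ h.equivOne.symm.toLinearMap

/-- `a ⊗ b ↦ aS(b)`, the map with `(a ⊗ 1)Δ(b) ↦ aε(b)`. -/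
def antipodeR (ε : A →ₗ[k] k) : A ⊗[k] A →ₗ[k] A := sliceR ε ∘ₗ h.equivTwo.symm.toLinearMap

theorem antipodeL_canonOne (a b : A) : h.antipodeL ε (canonOne Δ a b) = ε a • b := by
  rw [antipodeL, LinearMap.comp_apply, LinearEquiv.coe_coe, h.equivOne_symm_canonOne, sliceL_tmul]

theorem antipodeR_canonTwo (a b : A) : h.antipodeR ε (canonTwo Δ a b) = ε b • a := by
  rw [antipodeR, LinearMap.comp_apply, LinearEquiv.coe_coe, h.equivTwo_symm_canonTwo, sliceR_tmul]

include hε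

theorem antipodeL_surjective : Function.Surjective (h.antipodeL ε) := by
  intro x
  by_cases hx : x = 0
  · exact ⟨0, by rw [hx, map_zero]⟩
  · obtain ⟨c, hc⟩ := hε.exists_eq_one h x hx
    exact ⟨canonOne Δ c x, by rw [h.antipodeL_canonOne, hc, one_smul]⟩

theorem antipodeR_surjective : Function.Surjective (h.antipodeR ε) := by
  intro x
  by_cases hx : x = 0
  · exact ⟨0, by rw [hx, map_zero]⟩
  · obtain ⟨c, hc⟩ := hε.exists_eq_one h x hx
    exact ⟨canonTwo Δ x c, by rw [h.antipodeR_canonTwo, hc, one_smul]⟩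

/-- A covered form of `v₍₁₎S(v₍₂₎) = ε(v)`. On `Δ(c)(1 ⊗ d)` it reads `r c₍₁₎S(c₍₂₎)c₍₃₎d = r c d`,
where coassociativity brings `S(c₍₂₎)c₍₃₎d` together and the defining property of `antipodeL`
evaluates it. -/
theorem mul_antipodeL_canonTwo (r : A) (v : A ⊗[k] A) :
    LinearMap.mul' k A ((h.antipodeL ε).lTensor A
      (TensorProduct.assoc k A A A ((canonTwo Δ r).rTensor A v))) = r * sliceL ε v := by
  refine forall_of_surjective_lift h.bijective_one.2
    (f := LinearMap.mul' k A ∘ₗ (h.antipodeL ε).lTensor A ∘ₗ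
      (TensorProduct.assoc k A A A).toLinearMap ∘ₗ (canonTwo Δ r).rTensor A)
    (g := LinearMap.mulLeft k r ∘ₗ sliceL ε) (fun c d => ?_) v
  simp only [LinearMap.comp_apply, LinearEquiv.coe_coe, LinearMap.mulLeft_apply]
  rw [h.coassoc, lTensor_lTensor, hε.sliceL_one, ← mul_assoc, ← hε.sliceR_two r c]
  induction canonTwo Δ r c using TensorProduct.induction_on with
  | zero => simp only [map_zero, zero_mul]
  | add x y hx hy => simp only [map_add, add_mul, hx, hy]
  | tmul u v =>
    rw [LinearMap.lTensor_tmul, LinearMap.comp_apply, LinearMap.flip_apply, h.antipodeL_canonOne,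
      LinearMap.mul'_apply, sliceR_tmul, mul_smul_comm, smul_mul_assoc]

/-- The associativity `(pS(q))y = p(S(q)y)`: both pairings come from the same multiplier `S(q)`,
although `S` itself is never constructed here. It is checked on `p ⊗ q = (r ⊗ 1)Δ(s)`. -/
theorem antipodeR_mul (p q y : A) :
    h.antipodeR ε (p ⊗ₜ[k] q) * y = p * h.antipodeL ε (q ⊗ₜ[k] y) := by
  refine (forall_of_surjective_lift h.bijective_two.2
    (f := LinearMap.mul' k A ∘ₗ (h.antipodeL ε).lTensor A ∘ₗ
      (TensorProduct.assoc k A A A).toLinearMap ∘ₗ (TensorProduct.mk k (A ⊗[k] A) A).flip y)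
    (g := LinearMap.mulRight k y ∘ₗ h.antipodeR ε) (fun r s => ?_) (p ⊗ₜ[k] q)).symm
  simp only [LinearMap.comp_apply, LinearEquiv.coe_coe, LinearMap.flip_apply,
    TensorProduct.mk_apply, LinearMap.mulRight_apply, h.antipodeR_canonTwo]
  rw [← LinearMap.rTensor_tmul, h.mul_antipodeL_canonTwo hε, sliceL_tmul, mul_smul_comm,
    smul_mul_assoc]

theorem mul'_lTensor_antipodeL (w : A ⊗[k] A) (y : A) :
    LinearMap.mul' k A ((h.antipodeL ε ∘ₗ (TensorProduct.mk k A A).flip y).lTensor A w) =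
      h.antipodeR ε w * y := by
  induction w using TensorProduct.induction_on with
  | zero => simp only [map_zero, zero_mul]
  | add u v hu hv => simp only [map_add, add_mul, hu, hv]
  | tmul p q => exact (h.antipodeR_mul hε p q y).symm

theorem mul'_rTensor_antipodeR (z : A) (w : A ⊗[k] A) :
    LinearMap.mul' k A ((h.antipodeR ε ∘ₗ TensorProduct.mk k A A z).rTensor A w) =
      z * h.antipodeL ε w := by
  induction w using TensorProduct.induction_on with
  | zero => simp only [map_zero, mul_zero]
  | add u v hu hv => simp only [map_add, mul_add, hu, hv]
  | tmul p q => exact h.antipodeR_mul hε z p q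

/-- In Sweedler form `S(r₍₁₎v₁)r₍₂₎v₂ = ε(r)S(v₁)v₂`. It follows from multiplicativity of `ε`, since
`Δ(r)` acts on `Δ(t)(1 ⊗ u)` by replacing `t` with `rt`. -/
theorem antipodeL_left (r : A) (v : A ⊗[k] A) :
    h.antipodeL ε ((Δ r).left v) = ε r • h.antipodeL ε v := by
  refine forall_of_surjective_lift h.bijective_one.2 (f := h.antipodeL ε ∘ₗ (Δ r).left)
    (g := ε r • h.antipodeL ε) (fun t u => ?_) v
  rw [LinearMap.comp_apply, ← h.one_mul_left, h.antipodeL_canonOne, LinearMap.smul_apply,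
    h.antipodeL_canonOne, hε.map_mul h, mul_smul]

theorem antipodeR_right (s : A) (v : A ⊗[k] A) :
    h.antipodeR ε ((Δ s).right v) = ε s • h.antipodeR ε v := by
  refine forall_of_surjective_lift h.bijective_two.2 (f := h.antipodeR ε ∘ₗ (Δ s).right)
    (g := ε s • h.antipodeR ε) (fun t u => ?_) v
  rw [LinearMap.comp_apply, ← h.two_mul_right, h.antipodeR_canonTwo, LinearMap.smul_apply,
    h.antipodeR_canonTwo, hε.map_mul h, mul_comm, mul_smul]

/-- Antimultiplicativity `S(w₁y)w₂ = S(y)(S(w₁)w₂)`. On `w = Δ(r)(1 ⊗ s)` it is the previous kind of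
identity with `v = y ⊗ s`. -/
theorem antipodeL_rTensor_mulRight (y : A) (w : A ⊗[k] A) :
    h.antipodeL ε ((LinearMap.mulRight k y).rTensor A w) =
      h.antipodeL ε (y ⊗ₜ[k] h.antipodeL ε w) := by
  refine forall_of_surjective_lift h.bijective_one.2
    (f := h.antipodeL ε ∘ₗ (LinearMap.mulRight k y).rTensor A)
    (g := h.antipodeL ε ∘ₗ TensorProduct.mk k A A y ∘ₗ h.antipodeL ε) (fun r s => ?_) w
  simp only [LinearMap.comp_apply, TensorProduct.mk_apply]
  rw [← h.left_one, h.antipodeL_left hε, h.antipodeL_canonOne, TensorProduct.tmul_smul, map_smul]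

theorem antipodeR_lTensor_mulLeft (q : A) (w : A ⊗[k] A) :
    h.antipodeR ε ((LinearMap.mulLeft k q).lTensor A w) =
      h.antipodeR ε (h.antipodeR ε w ⊗ₜ[k] q) := by
  refine forall_of_surjective_lift h.bijective_two.2
    (f := h.antipodeR ε ∘ₗ (LinearMap.mulLeft k q).lTensor A)
    (g := h.antipodeR ε ∘ₗ (TensorProduct.mk k A A).flip q ∘ₗ h.antipodeR ε) (fun r s => ?_) w
  simp only [LinearMap.comp_apply, LinearMap.flip_apply, TensorProduct.mk_apply]
  rw [← h.right_two, h.antipodeR_right hε, h.antipodeR_canonTwo, ← TensorProduct.smul_tmul',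
    map_smul]

/-- `q₍₁₎ S(y q₍₂₎) z = ε(q) S(y) z`. -/
theorem mul'_antipodeL_canonFour (y q z : A) :
    LinearMap.mul' k A ((h.antipodeL ε ∘ₗ (TensorProduct.mk k A A).flip z).lTensor A
      (canonFour Δ y q)) = ε q • h.antipodeL ε (y ⊗ₜ[k] z) := by
  refine h.nondegenerate.ext_left fun x => ?_
  have e₁ : ∀ w : A ⊗[k] A, x * LinearMap.mul' k A w =
      LinearMap.mul' k A ((LinearMap.mulLeft k x).rTensor A w) := by
    intro w
    induction w using TensorProduct.induction_on with
    | zero => simp only [map_zero, mul_zero]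
    | add u v hu hv => simp only [map_add, mul_add, hu, hv]
    | tmul u v => simp [mul_assoc]
  have e₂ : (h.antipodeL ε ∘ₗ (TensorProduct.mk k A A).flip z) ∘ₗ LinearMap.mulLeft k y =
      h.antipodeL ε ∘ₗ (TensorProduct.mk k A A).flip (h.antipodeL ε (y ⊗ₜ[k] z)) :=
    LinearMap.ext fun β => h.antipodeL_rTensor_mulRight hε β (y ⊗ₜ[k] z)
  -- Multiplying by `x` on the left gives `xq₍₁₎S(yq₍₂₎)z`; antimultiplicativity splits off `S(y)z`,
  -- and `xq₍₁₎S(q₍₂₎)` equals `ε(q)x`.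
  rw [e₁, rTensor_lTensor_comm, ← h.mulLeft_two_eq_mulLeft_four, lTensor_lTensor, e₂,
    h.mul'_lTensor_antipodeL hε, h.antipodeR_canonTwo, smul_mul_assoc, mul_smul_comm]

/-- `z S(q₍₁₎ y) q₍₂₎ = ε(q) z S(y)`. -/
theorem mul'_antipodeR_canonThree (z q y : A) :
    LinearMap.mul' k A ((h.antipodeR ε ∘ₗ TensorProduct.mk k A A z).rTensor A
      (canonThree Δ q y)) = ε q • h.antipodeR ε (z ⊗ₜ[k] y) := by
  refine h.nondegenerate.ext_right fun x => ?_
  have e₁ : ∀ w : A ⊗[k] A, LinearMap.mul' k A w * x =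
      LinearMap.mul' k A ((LinearMap.mulRight k x).lTensor A w) := by
    intro w
    induction w using TensorProduct.induction_on with
    | zero => simp only [map_zero, zero_mul]
    | add u v hu hv => simp only [map_add, add_mul, hu, hv]
    | tmul u v => simp [mul_assoc]
  have e₂ : (h.antipodeR ε ∘ₗ TensorProduct.mk k A A z) ∘ₗ LinearMap.mulRight k y =
      h.antipodeR ε ∘ₗ TensorProduct.mk k A A (h.antipodeR ε (z ⊗ₜ[k] y)) :=
    LinearMap.ext fun α => h.antipodeR_lTensor_mulLeft hε α (z ⊗ₜ[k] y)
  rw [e₁, ← rTensor_lTensor_comm, ← h.mulRight_one_eq_mulRight_three, rTensor_rTensor, e₂,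
    h.mul'_rTensor_antipodeR hε, h.antipodeL_canonOne, smul_mul_assoc, mul_smul_comm]

end IsMultiplierHopf

/-! ### The co-opposite -/

section Flip

theorem flip_emb (w : A ⊗[k] A) : M.flip (emb w) = emb (TensorProduct.comm k A A w) := by
  refine M.ext_both (LinearMap.ext fun x => ?_) (LinearMap.ext fun x => ?_)
  · change TensorProduct.comm k A A (w * (TensorProduct.comm k A A).symm x) = _
    rw [comm_map_mul, LinearEquiv.apply_symm_apply, emb_left]
  · change TensorProduct.comm k A A ((TensorProduct.comm k A A).symm x * w) = _
    rw [comm_map_mul, LinearEquiv.apply_symm_apply, emb_right]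

theorem flip_mul (m n : M k (A ⊗[k] A)) : M.flip (m * n) = M.flip m * M.flip n := by
  refine M.ext_both (LinearMap.ext fun x => ?_) (LinearMap.ext fun x => ?_) <;>
    simp [M.flip]

theorem flip_tensLin (m n : M k A) : M.flip (tensLin m n) = tensLin n m := by
  refine M.ext_both (TensorProduct.ext' fun x y => rfl) (TensorProduct.ext' fun x y => rfl)

variable (h : IsPreMultiplierBialgebra Δ)
include h

theorem canonOne_flip (a b : A) :
    canonOne (M.flip ∘ₗ Δ) a b = TensorProduct.comm k A A (canonThree Δ a b) := by
  rw [← pull_emb (k := k) h.nondegenerate_tensor (TensorProduct.comm k A A _), ← flip_emb,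
    h.emb_canonThree, flip_mul, flip_tensLin]
  rfl

theorem canonTwo_flip (a b : A) :
    canonTwo (M.flip ∘ₗ Δ) a b = TensorProduct.comm k A A (canonFour Δ a b) := by
  rw [← pull_emb (k := k) h.nondegenerate_tensor (TensorProduct.comm k A A _), ← flip_emb,
    h.emb_canonFour, flip_mul, flip_tensLin]
  rfl

theorem canonThree_flip (a b : A) :
    canonThree (M.flip ∘ₗ Δ) a b = TensorProduct.comm k A A (canonOne Δ a b) := by
  rw [← pull_emb (k := k) h.nondegenerate_tensor (TensorProduct.comm k A A _), ← flip_emb,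
    h.emb_canonOne, flip_mul, flip_tensLin]
  rfl

omit h in
theorem sliceL_comm (φ : A →ₗ[k] k) (x : A ⊗[k] A) :
    sliceL φ (TensorProduct.comm k A A x) = sliceR φ x := by
  induction x using TensorProduct.induction_on with
  | zero => simp only [map_zero]
  | add x y hx hy => simp only [map_add, hx, hy]
  | tmul u v => rfl

omit h in
theorem sliceR_comm (φ : A →ₗ[k] k) (x : A ⊗[k] A) :
    sliceR φ (TensorProduct.comm k A A x) = sliceL φ x := by
  induction x using TensorProduct.induction_on with
  | zero => simp only [map_zero]
  | add x y hx hy => simp only [map_add, hx, hy]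
  | tmul u v => rfl

/-- Needed because the right-hand spanning argument for `ρ` uses the antipode of the co-opposite of
`Y`, taken with respect to the counit of `Y`. -/
theorem IsHopfCounit.flip {ε : A →ₗ[k] k} (hε : IsHopfCounit Δ ε) :
    IsHopfCounit (M.flip ∘ₗ Δ) ε := by
  intro a b
  constructor
  · change sliceL ε _ = _
    rw [canonOne_flip h, sliceL_comm, hε.sliceR_three h]
  · change sliceR ε _ = _
    rw [canonTwo_flip h, sliceR_comm, hε.sliceL_four h]

omit h in
-- Up to the flip, `Δ(a)(b ⊗ 1)` is the first canonical map of the co-opposite. This is where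
-- regularity supplies a third canonical map that is onto.
theorem IsRegularMultiplierHopf.canonThree_surjective (h : IsRegularMultiplierHopf Δ) :
    Function.Surjective (TensorProduct.lift (canonThree Δ)) := by
  intro x
  obtain ⟨w, hw⟩ := h.flip.bijective_one.2 (TensorProduct.comm k A A x)
  refine ⟨w, (TensorProduct.comm k A A).injective ?_⟩
  rw [← hw]
  induction w using TensorProduct.induction_on generalizing x with
  | zero => simp only [map_zero]
  | add u v hu hv =>
    have hs : ∀ u, TensorProduct.lift (canonOne (M.flip ∘ₗ Δ)) u =
      TensorProduct.comm k A A ((TensorProduct.comm k A A).symm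
        (TensorProduct.lift (canonOne (M.flip ∘ₗ Δ)) u)) := fun u =>
        ((TensorProduct.comm k A A).apply_symm_apply _).symm
    rw [map_add, map_add, map_add, hu _ (hs u), hv _ (hs v)]
  | tmul a b =>
    rw [TensorProduct.lift.tmul, TensorProduct.lift.tmul,
      canonOne_flip h.toIsPreMultiplierBialgebra]

end Flip

end Counit

/-! ### The homomorphism `(ι ⊗ φ)Δ` -/

section ComulAct

variable {k : Type*} [Field k]
variable {Y : Type*} [NonUnitalRing Y] [Module k Y] [SMulCommClass k Y Y] [IsScalarTower k Y Y]
variable {X : Type*} [NonUnitalRing X] [Module k X] [SMulCommClass k X X] [IsScalarTower k X X]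
variable {Δ : Y →ₗ[k] M k (Y ⊗[k] Y)} {φ : Y →ₗ[k] M k X}

/-- `t ↦ φ(t)x`. -/
def actL (φ : Y →ₗ[k] M k X) (x : X) : Y →ₗ[k] X := (M.leftLin ∘ₗ φ).flip x

/-- `t ↦ xφ(t)`. -/
def actR (φ : Y →ₗ[k] M k X) (x : X) : Y →ₗ[k] X := (M.rightLin ∘ₗ φ).flip x

@[simp] theorem actL_apply (x : X) (t : Y) : actL φ x t = (φ t).left x := rfl

@[simp] theorem actR_apply (x : X) (t : Y) : actR φ x t = (φ t).right x := rfl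

theorem actL_add (x x' : X) : actL φ (x + x') = actL φ x + actL φ x' :=
  map_add (M.leftLin ∘ₗ φ).flip x x'

theorem actL_smul (c : k) (x : X) : actL φ (c • x) = c • actL φ x :=
  map_smul (M.leftLin ∘ₗ φ).flip c x

theorem actR_add (x x' : X) : actR φ (x + x') = actR φ x + actR φ x' :=
  map_add (M.rightLin ∘ₗ φ).flip x x'

theorem actR_smul (c : k) (x : X) : actR φ (c • x) = c • actR φ x :=
  map_smul (M.rightLin ∘ₗ φ).flip c x

/-- The left action `y' ⊗ x ↦ (ι ⊗ φ)(Δ(y)(y' ⊗ 1))(1 ⊗ x)` of `(ι ⊗ φ)Δ(y)`. -/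
def comulActLeft (Δ : Y →ₗ[k] M k (Y ⊗[k] Y)) (φ : Y →ₗ[k] M k X) :
    Y →ₗ[k] Y ⊗[k] X →ₗ[k] Y ⊗[k] X where
  toFun y := TensorProduct.lift
    ((LinearMap.lTensorHom Y ∘ₗ (M.leftLin ∘ₗ φ).flip).flip ∘ₗ canonThree Δ y)
  map_add' y z := TensorProduct.ext' fun u x => by
    simp only [TensorProduct.lift.tmul, map_add, LinearMap.add_apply, LinearMap.comp_apply]
  map_smul' c y := TensorProduct.ext' fun u x => by
    simp only [TensorProduct.lift.tmul, map_smul, LinearMap.smul_apply, LinearMap.comp_apply,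
      RingHom.id_apply]

/-- The right action `y' ⊗ x ↦ (1 ⊗ x)(ι ⊗ φ)((y' ⊗ 1)Δ(y))` of `(ι ⊗ φ)Δ(y)`. -/
def comulActRight (Δ : Y →ₗ[k] M k (Y ⊗[k] Y)) (φ : Y →ₗ[k] M k X) :
    Y →ₗ[k] Y ⊗[k] X →ₗ[k] Y ⊗[k] X where
  toFun y := TensorProduct.lift
    ((LinearMap.lTensorHom Y ∘ₗ (M.rightLin ∘ₗ φ).flip).flip ∘ₗ (canonTwo Δ).flip y)
  map_add' y z := TensorProduct.ext' fun u x => by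
    simp only [TensorProduct.lift.tmul, map_add, LinearMap.add_apply, LinearMap.comp_apply]
  map_smul' c y := TensorProduct.ext' fun u x => by
    simp only [TensorProduct.lift.tmul, map_smul, LinearMap.smul_apply, LinearMap.comp_apply,
      RingHom.id_apply]

theorem comulActLeft_tmul (y u : Y) (x : X) :
    comulActLeft Δ φ y (u ⊗ₜ[k] x) = (actL φ x).lTensor Y (canonThree Δ y u) := rfl

theorem comulActRight_tmul (y u : Y) (x : X) :
    comulActRight Δ φ y (u ⊗ₜ[k] x) = (actR φ x).lTensor Y (canonTwo Δ u y) := rfl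

theorem comulAct_compat (h : IsPreMultiplierBialgebra Δ) (y : Y) (a b : Y ⊗[k] X) :
    a * comulActLeft Δ φ y b = comulActRight Δ φ y a * b := by
  induction a using TensorProduct.induction_on with
  | zero => rw [zero_mul, map_zero, zero_mul]
  | add a a' h₁ h₂ => rw [add_mul, h₁, h₂, map_add, add_mul]
  | tmul p x =>
    induction b using TensorProduct.induction_on with
    | zero => rw [mul_zero, map_zero, mul_zero]
    | add b b' h₁ h₂ => rw [map_add, mul_add, h₁, h₂, mul_add]
    | tmul q x' =>
      have e : LinearMap.mulLeft k x ∘ₗ actL φ x' = LinearMap.mulRight k x' ∘ₗ actR φ x :=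
        LinearMap.ext fun t => M.compat (φ t) x x'
      rw [comulActLeft_tmul, comulActRight_tmul, tmul_mul, mul_tmul, rTensor_lTensor_comm,
        rTensor_lTensor_comm, lTensor_lTensor, lTensor_lTensor, e, h.mulLeft_three_eq_mulRight_two]

/-- The map `(ι ⊗ φ)Δ : Y → M(Y ⊗ X)`. -/
def comulAct (h : IsPreMultiplierBialgebra Δ) (φ : Y →ₗ[k] M k X) : Y →ₗ[k] M k (Y ⊗[k] X) :=
  M.mkLin (comulActLeft Δ φ) (comulActRight Δ φ) (comulAct_compat h)

variable (h : IsPreMultiplierBialgebra Δ) (hX : Nondegenerate X)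
  (hφ : ∀ s t, φ (s * t) = φ s * φ t)

theorem comulAct_left_tmul (y u : Y) (x : X) :
    (comulAct h φ y).left (u ⊗ₜ[k] x) = (actL φ x).lTensor Y (canonThree Δ y u) := rfl

section

include hφ

theorem actL_comp_mulRight (x : X) (q : Y) :
    actL φ x ∘ₗ LinearMap.mulRight k q = actL φ ((φ q).left x) :=
  LinearMap.ext fun t => by
    rw [LinearMap.comp_apply, LinearMap.mulRight_apply, actL_apply, actL_apply, hφ, M.left_mul]

theorem actR_comp_mulLeft (x : X) (q : Y) :
    actR φ x ∘ₗ LinearMap.mulLeft k q = actR φ ((φ q).right x) :=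
  LinearMap.ext fun t => by
    rw [LinearMap.comp_apply, LinearMap.mulLeft_apply, actR_apply, actR_apply, hφ, M.right_mul]

include hX in
theorem comulAct_mul (y z : Y) : comulAct h φ (y * z) = comulAct h φ y * comulAct h φ z := by
  refine M.ext_left (h.nondegenerate.tensor hX) fun w => ?_
  have key : ∀ (x : X) (v : Y ⊗[k] Y), (actL φ x).lTensor Y ((Δ y).left v) =
      (comulAct h φ y).left ((actL φ x).lTensor Y v) := by
    intro x v
    induction v using TensorProduct.induction_on with
    | zero => simp only [map_zero]
    | add v v' h₁ h₂ => simp only [map_add, h₁, h₂]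
    | tmul p q =>
      rw [h.left_three, LinearMap.lTensor_tmul, comulAct_left_tmul, lTensor_lTensor,
        actL_comp_mulRight hφ, actL_apply]
  induction w using TensorProduct.induction_on with
  | zero => simp only [map_zero]
  | add v v' h₁ h₂ => simp only [map_add, h₁, h₂]
  | tmul u x =>
    rw [M.left_mul, comulAct_left_tmul, comulAct_left_tmul, ← key, h.three_mul_left]

end

/-- Every `φ(t)x` is of the form `φ(t)x'` with `x'` in the span of `φ(Y)X`, and likewise on the
other side. -/
structure IsCovered (φ : Y →ₗ[k] M k X) : Prop where
  left : ∀ x, ∃ x' ∈ Submodule.span k {z : X | ∃ v w, z = (φ v).left w},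
    ∀ t, (φ t).left x = (φ t).left x'
  right : ∀ x, ∃ x' ∈ Submodule.span k {z : X | ∃ v w, z = (φ v).right w},
    ∀ t, (φ t).right x = (φ t).right x'

/-- The hypothesis `congr` restricts to properties that see `x` only through `t ↦ φ(t)x`. For these,
`x` may be replaced by its representative in the span of `φ(Y)X`. -/
theorem IsCovered.left_induction (hc : IsCovered φ) {P : X → Prop}
    (act : ∀ v x, P ((φ v).left x)) (zero : P 0) (add : ∀ x x', P x → P x' → P (x + x'))
    (smul : ∀ (c : k) x, P x → P (c • x))
    (congr : ∀ x x', actL φ x = actL φ x' → P x' → P x) (x : X) : P x := by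
  obtain ⟨x', hx', e⟩ := hc.left x
  refine congr x x' (LinearMap.ext e) ?_
  clear e
  induction hx' using Submodule.span_induction with
  | mem z hz =>
    obtain ⟨v, w, rfl⟩ := hz
    exact act v w
  | zero => exact zero
  | add z w _ _ h₁ h₂ => exact add z w h₁ h₂
  | smul c z _ h₁ => exact smul c z h₁

theorem IsCovered.right_induction (hc : IsCovered φ) {P : X → Prop}
    (act : ∀ v x, P ((φ v).right x)) (zero : P 0) (add : ∀ x x', P x → P x' → P (x + x'))
    (smul : ∀ (c : k) x, P x → P (c • x))
    (congr : ∀ x x', actR φ x = actR φ x' → P x' → P x) (x : X) : P x := by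
  obtain ⟨x', hx', e⟩ := hc.right x
  refine congr x x' (LinearMap.ext e) ?_
  clear e
  induction hx' using Submodule.span_induction with
  | mem z hz =>
    obtain ⟨v, w, rfl⟩ := hz
    exact act v w
  | zero => exact zero
  | add z w _ _ h₁ h₂ => exact add z w h₁ h₂
  | smul c z _ h₁ => exact smul c z h₁

variable (hc : IsCovered φ)

/-- For `x = φ(v)x'` the witness is `Δ(y)(1 ⊗ v)` with `φ(·)x'` applied to its second leg: since
`φ(t)φ(v) = φ(tv)`, the action itself supplies the missing covering of `Δ(y)`. -/
theorem exists_comulAct_right_leg (h : IsPreMultiplierBialgebra Δ)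
    (hφ : ∀ s t, φ (s * t) = φ s * φ t) (hc : IsCovered φ) (y : Y) (x : X) :
    ∃ w : Y ⊗[k] X, ∀ b, (actL φ x).lTensor Y (canonThree Δ y b) =
      (LinearMap.mulRight k b).rTensor X w := by
  refine hc.left_induction (P := fun x => ∃ w : Y ⊗[k] X, ∀ b,
    (actL φ x).lTensor Y (canonThree Δ y b) = (LinearMap.mulRight k b).rTensor X w) ?_ ?_ ?_ ?_ ?_ x
  · intro v x
    refine ⟨(actL φ x).lTensor Y (canonOne Δ y v), fun b => ?_⟩
    rw [rTensor_lTensor_comm, h.mulRight_one_eq_mulRight_three, lTensor_lTensor,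
      actL_comp_mulRight hφ]
  · refine ⟨0, fun b => ?_⟩
    rw [map_zero, show actL φ (0 : X) = 0 from map_zero (M.leftLin ∘ₗ φ).flip,
      LinearMap.lTensor_zero, LinearMap.zero_apply]
  · rintro x x' ⟨w, hw⟩ ⟨w', hw'⟩
    refine ⟨w + w', fun b => ?_⟩
    rw [actL_add, LinearMap.lTensor_add, LinearMap.add_apply, hw, hw', map_add]
  · rintro c x ⟨w, hw⟩
    refine ⟨c • w, fun b => ?_⟩
    rw [actL_smul, LinearMap.lTensor_smul, LinearMap.smul_apply, hw, map_smul]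
  · rintro x x' e ⟨w, hw⟩
    exact ⟨w, fun b => by rw [e, hw]⟩

theorem exists_right_leg_comulAct (h : IsPreMultiplierBialgebra Δ)
    (hφ : ∀ s t, φ (s * t) = φ s * φ t) (hc : IsCovered φ) (x : X) (y : Y) :
    ∃ w : Y ⊗[k] X, ∀ b, (actR φ x).lTensor Y (canonTwo Δ b y) =
      (LinearMap.mulLeft k b).rTensor X w := by
  refine hc.right_induction (P := fun x => ∃ w : Y ⊗[k] X, ∀ b,
    (actR φ x).lTensor Y (canonTwo Δ b y) = (LinearMap.mulLeft k b).rTensor X w) ?_ ?_ ?_ ?_ ?_ x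
  · intro v x
    refine ⟨(actR φ x).lTensor Y (canonFour Δ v y), fun b => ?_⟩
    rw [rTensor_lTensor_comm, ← h.mulLeft_two_eq_mulLeft_four, lTensor_lTensor,
      actR_comp_mulLeft hφ]
  · refine ⟨0, fun b => ?_⟩
    rw [map_zero, show actR φ (0 : X) = 0 from map_zero (M.rightLin ∘ₗ φ).flip,
      LinearMap.lTensor_zero, LinearMap.zero_apply]
  · rintro x x' ⟨w, hw⟩ ⟨w', hw'⟩
    refine ⟨w + w', fun b => ?_⟩
    rw [actR_add, LinearMap.lTensor_add, LinearMap.add_apply, hw, hw', map_add]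
  · rintro c x ⟨w, hw⟩
    refine ⟨c • w, fun b => ?_⟩
    rw [actR_smul, LinearMap.lTensor_smul, LinearMap.smul_apply, hw, map_smul]
  · rintro x x' e ⟨w, hw⟩
    exact ⟨w, fun b => by rw [e, hw]⟩

/-- A pointwise choice determined by jointly injective linear conditions is automatically bilinear.
-/
theorem exists_bilinear_of_exists_unique {U V W : Type*} [AddCommGroup U] [Module k U]
    [AddCommGroup V] [Module k V] [AddCommGroup W] [Module k W] {ι : Type*} {Z : Type*}
    [AddCommGroup Z] [Module k Z] (f : ι → U →ₗ[k] V →ₗ[k] Z) (g : ι → W →ₗ[k] Z)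
    (hg : ∀ w w', (∀ i, g i w = g i w') → w = w')
    (hfg : ∀ u v, ∃ w, ∀ i, f i u v = g i w) :
    ∃ F : U →ₗ[k] V →ₗ[k] W, ∀ i u v, g i (F u v) = f i u v := by
  choose F hF using hfg
  refine ⟨LinearMap.mk₂ k F ?_ ?_ ?_ ?_, fun i u v => (hF u v i).symm⟩
  · intro u u' v
    refine hg _ _ fun i => ?_
    rw [map_add, ← hF, ← hF, ← hF, map_add, LinearMap.add_apply]
  · intro c u v
    refine hg _ _ fun i => ?_
    rw [map_smul, ← hF, ← hF, map_smul, LinearMap.smul_apply]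
  · intro u v v'
    refine hg _ _ fun i => ?_
    rw [map_add, ← hF, ← hF, ← hF, map_add]
  · intro c u v
    refine hg _ _ fun i => ?_
    rw [map_smul, ← hF, ← hF, map_smul]

theorem exists_coverR (h : IsPreMultiplierBialgebra Δ) (hφ : ∀ s t, φ (s * t) = φ s * φ t)
    (hc : IsCovered φ) : ∃ F : Y →ₗ[k] X →ₗ[k] Y ⊗[k] X, ∀ b y x,
      (LinearMap.mulRight k b).rTensor X (F y x) = (actL φ x).lTensor Y (canonThree Δ y b) :=
  exists_bilinear_of_exists_unique
    (fun b => LinearMap.mk₂ k (fun y x => (actL φ x).lTensor Y (canonThree Δ y b))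
      (by intros; rw [map_add, LinearMap.add_apply, map_add])
      (by intros; rw [map_smul, LinearMap.smul_apply, map_smul])
      (by intros; rw [actL_add, LinearMap.lTensor_add, LinearMap.add_apply])
      (by intros; rw [actL_smul, LinearMap.lTensor_smul, LinearMap.smul_apply]))
    (fun b => (LinearMap.mulRight k b).rTensor X)
    (fun _ _ e => ext_mulRight_rTensor h.nondegenerate e)
    (exists_comulAct_right_leg h hφ hc)

theorem exists_coverL (h : IsPreMultiplierBialgebra Δ) (hφ : ∀ s t, φ (s * t) = φ s * φ t)
    (hc : IsCovered φ) : ∃ F : X →ₗ[k] Y →ₗ[k] Y ⊗[k] X, ∀ b x y,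
      (LinearMap.mulLeft k b).rTensor X (F x y) = (actR φ x).lTensor Y (canonTwo Δ b y) :=
  exists_bilinear_of_exists_unique
    (fun b => LinearMap.mk₂ k (fun x y => (actR φ x).lTensor Y (canonTwo Δ b y))
      (by intros; rw [actR_add, LinearMap.lTensor_add, LinearMap.add_apply])
      (by intros; rw [actR_smul, LinearMap.lTensor_smul, LinearMap.smul_apply])
      (by intros; rw [map_add, map_add])
      (by intros; rw [map_smul, map_smul]))
    (fun b => (LinearMap.mulLeft k b).rTensor X)
    (fun _ _ e => ext_mulLeft_rTensor h.nondegenerate e)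
    (exists_right_leg_comulAct h hφ hc)

/-- `(ι ⊗ φ)(Δ(y))(1 ⊗ x)` as an element of `Y ⊗ X`, bilinear in `y` and `x`. -/
def coverR (h : IsPreMultiplierBialgebra Δ) (hφ : ∀ s t, φ (s * t) = φ s * φ t)
    (hc : IsCovered φ) : Y →ₗ[k] X →ₗ[k] Y ⊗[k] X := (exists_coverR h hφ hc).choose

/-- `(1 ⊗ x)(ι ⊗ φ)(Δ(y))` as an element of `Y ⊗ X`, bilinear in `x` and `y`. -/
def coverL (h : IsPreMultiplierBialgebra Δ) (hφ : ∀ s t, φ (s * t) = φ s * φ t)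
    (hc : IsCovered φ) : X →ₗ[k] Y →ₗ[k] Y ⊗[k] X := (exists_coverL h hφ hc).choose

theorem mulRight_coverR (y : Y) (x : X) (b : Y) :
    (LinearMap.mulRight k b).rTensor X (coverR h hφ hc y x) =
      (actL φ x).lTensor Y (canonThree Δ y b) :=
  (exists_coverR h hφ hc).choose_spec b y x

theorem mulLeft_coverR (b y : Y) (x : X) :
    (LinearMap.mulLeft k b).rTensor X (coverR h hφ hc y x) =
      (actL φ x).lTensor Y (canonTwo Δ b y) := by
  refine ext_mulRight_rTensor h.nondegenerate fun q => ?_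
  rw [rTensor_rTensor, ← mulLeft_mulRight_comm, ← rTensor_rTensor, mulRight_coverR,
    rTensor_lTensor_comm, rTensor_lTensor_comm, h.mulLeft_three_eq_mulRight_two]

theorem mulLeft_coverL (b y : Y) (x : X) :
    (LinearMap.mulLeft k b).rTensor X (coverL h hφ hc x y) =
      (actR φ x).lTensor Y (canonTwo Δ b y) :=
  (exists_coverL h hφ hc).choose_spec b x y

theorem mulRight_coverL (y : Y) (x : X) (b : Y) :
    (LinearMap.mulRight k b).rTensor X (coverL h hφ hc x y) =
      (actR φ x).lTensor Y (canonThree Δ y b) := by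
  refine ext_mulLeft_rTensor h.nondegenerate fun q => ?_
  rw [rTensor_rTensor, mulLeft_mulRight_comm, ← rTensor_rTensor, mulLeft_coverL,
    rTensor_lTensor_comm, rTensor_lTensor_comm, h.mulLeft_three_eq_mulRight_two]

theorem coverR_congr {x x' : X} (e : actL φ x = actL φ x') :
    (coverR h hφ hc).flip x = (coverR h hφ hc).flip x' :=
  LinearMap.ext fun y => ext_mulRight_rTensor h.nondegenerate fun b => by
    rw [LinearMap.flip_apply, LinearMap.flip_apply, mulRight_coverR, mulRight_coverR, e]

theorem coverR_act (y v : Y) (x : X) :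
    coverR h hφ hc y ((φ v).left x) = (actL φ x).lTensor Y (canonOne Δ y v) :=
  ext_mulRight_rTensor h.nondegenerate fun b => by
    rw [mulRight_coverR, rTensor_lTensor_comm, h.mulRight_one_eq_mulRight_three, lTensor_lTensor,
      actL_comp_mulRight hφ]

/-- `coverR` commutes with maps that commute with `φ`. -/
theorem coverR_map (f : X →ₗ[k] X) (x : X) (hf : ∀ t, (φ t).left (f x) = f ((φ t).left x)) (y : Y) :
    coverR h hφ hc y (f x) = f.lTensor Y (coverR h hφ hc y x) :=
  ext_mulRight_rTensor h.nondegenerate fun b => by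
    rw [rTensor_lTensor_comm, mulRight_coverR, mulRight_coverR, lTensor_lTensor]
    congr 2
    exact LinearMap.ext hf

theorem coverL_map (f : X →ₗ[k] X) (x : X) (hf : ∀ t, (φ t).right (f x) = f ((φ t).right x))
    (y : Y) : coverL h hφ hc (f x) y = f.lTensor Y (coverL h hφ hc x y) :=
  ext_mulLeft_rTensor h.nondegenerate fun b => by
    rw [rTensor_lTensor_comm, mulLeft_coverL, mulLeft_coverL, lTensor_lTensor]
    congr 2
    exact LinearMap.ext hf

/-- A covered form of `(ε ⊗ φ)Δ = φ`; on `φ(v)x` it reduces to the counit law for `Δ(y)(1 ⊗ v)`. -/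
theorem sliceL_coverR {ε : Y →ₗ[k] k} (hε : IsHopfCounit Δ ε) (y : Y) (x : X) :
    sliceL ε (coverR h hφ hc y x) = (φ y).left x := by
  refine hc.left_induction (P := fun x => sliceL ε ((coverR h hφ hc).flip x y) = actL φ x y)
    ?_ ?_ ?_ ?_ ?_ x
  · intro v x
    rw [LinearMap.flip_apply, coverR_act, sliceL_lTensor, hε.sliceL_one, actL_apply, actL_apply, hφ,
      M.left_mul]
  · simp only [map_zero, LinearMap.zero_apply, actL_apply]
  · intro x x' h₁ h₂
    rw [map_add, LinearMap.add_apply, map_add, h₁, h₂, actL_add, LinearMap.add_apply]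
  · intro c x h₁
    rw [map_smul, LinearMap.smul_apply, map_smul, h₁, actL_smul, LinearMap.smul_apply]
  · intro x x' e h₁
    rw [coverR_congr h hφ hc e, h₁, e]

/-- Coassociativity of `Δ`, with `φ` applied to the last factor. -/
theorem canonTwo_coverR (u y : Y) (x : X) :
    TensorProduct.assoc k Y Y X ((canonTwo Δ u).rTensor X (coverR h hφ hc y x)) =
      ((coverR h hφ hc).flip x).lTensor Y (canonTwo Δ u y) := by
  refine hc.left_induction (P := fun x =>
    TensorProduct.assoc k Y Y X ((canonTwo Δ u).rTensor X ((coverR h hφ hc).flip x y)) =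
      ((coverR h hφ hc).flip x).lTensor Y (canonTwo Δ u y)) ?_ ?_ ?_ ?_ ?_ x
  · intro v x
    have e : (coverR h hφ hc).flip ((φ v).left x) =
        (actL φ x).lTensor Y ∘ₗ (canonOne Δ).flip v :=
      LinearMap.ext fun y => coverR_act h hφ hc y v x
    have e' : ∀ w : (Y ⊗[k] Y) ⊗[k] Y,
        TensorProduct.assoc k Y Y X ((actL φ x).lTensor (Y ⊗[k] Y) w) =
          ((actL φ x).lTensor Y).lTensor Y (TensorProduct.assoc k Y Y Y w) := by
      intro w
      induction w using TensorProduct.induction_on with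
      | zero => simp only [map_zero]
      | add v v' h₁ h₂ => simp only [map_add, h₁, h₂]
      | tmul p t =>
        induction p using TensorProduct.induction_on with
        | zero => simp only [map_zero, TensorProduct.zero_tmul]
        | add v v' h₁ h₂ => simp only [map_add, TensorProduct.add_tmul, h₁, h₂]
        | tmul p q => rfl
    rw [e, LinearMap.comp_apply, rTensor_lTensor_comm, e', LinearMap.flip_apply, h.coassoc,
      lTensor_lTensor]
  · simp only [map_zero, LinearMap.zero_apply, LinearMap.lTensor_zero]
  · intro x x' h₁ h₂
    rw [map_add, LinearMap.add_apply, map_add, map_add, h₁, h₂, LinearMap.lTensor_add,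
      LinearMap.add_apply]
  · intro c x h₁
    rw [map_smul, LinearMap.smul_apply, map_smul, map_smul, h₁, LinearMap.lTensor_smul,
      LinearMap.smul_apply]
  · intro x x' e h₁
    rw [coverR_congr h hφ hc e, h₁]

end ComulAct

/-! ### Multipliers of `A ⊗ Y` for commutative `A` -/

section CommLeg

variable {k : Type*} [Field k]
variable {A : Type*} [NonUnitalRing A] [Module k A] [SMulCommClass k A A] [IsScalarTower k A A]
variable {Y : Type*} [NonUnitalRing Y] [Module k Y] [SMulCommClass k Y Y] [IsScalarTower k Y Y]

theorem tensor_mul_comm (hA : ∀ a b : A, a * b = b * a) (hY : ∀ a b : Y, a * b = b * a)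
    (u v : A ⊗[k] Y) : u * v = v * u := by
  induction u using TensorProduct.induction_on with
  | zero => rw [zero_mul, mul_zero]
  | add x y hx hy => rw [add_mul, mul_add, hx, hy]
  | tmul p q =>
    induction v using TensorProduct.induction_on with
    | zero => rw [zero_mul, mul_zero]
    | add x y hx hy => rw [add_mul, mul_add, hx, hy]
    | tmul p' q' =>
      rw [Algebra.TensorProduct.tmul_mul_tmul, Algebra.TensorProduct.tmul_mul_tmul, hA p, hY q]

theorem tensLin_one_left_eq_right (hA : Nondegenerate A) (hc : ∀ a b : A, a * b = b * a)
    (s : M k A) (x : A ⊗[k] Y) : (tensLin s (1 : M k Y)).left x = (tensLin s 1).right x := by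
  have e : s.left = s.right := LinearMap.ext (M.left_eq_right_of_comm hA hc s)
  rw [tensLin_left, tensLin_right, e]
  rfl

/-- A multiplier of commutative `A` acts equally from both sides, so on the first leg it is central.
Consequently `T` and `T̄` take the same values, and antipode factors pass through `E` and `ρ`. -/
theorem tensLin_one_central (hA : Nondegenerate A) (hY : Nondegenerate Y)
    (hc : ∀ a b : A, a * b = b * a) (s : M k A) (m : M k (A ⊗[k] Y)) :
    tensLin s 1 * m = m * tensLin s 1 :=
  M.central (hA.tensor hY) (tensLin_one_left_eq_right hA hc s) m

theorem left_tensLin_one (hA : Nondegenerate A) (hY : Nondegenerate Y)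
    (hc : ∀ a b : A, a * b = b * a) (m : M k (A ⊗[k] Y)) (s : M k A) (x : A ⊗[k] Y) :
    m.left (s.left.rTensor Y x) = s.left.rTensor Y (m.left x) :=
  congrArg (fun n : M k (A ⊗[k] Y) => n.left x) (tensLin_one_central hA hY hc s m).symm

theorem right_tensLin_one (hA : Nondegenerate A) (hY : Nondegenerate Y)
    (hc : ∀ a b : A, a * b = b * a) (m : M k (A ⊗[k] Y)) (s : M k A) (x : A ⊗[k] Y) :
    m.right (s.left.rTensor Y x) = s.left.rTensor Y (m.right x) := by
  have e : s.left = s.right := LinearMap.ext (M.left_eq_right_of_comm hA hc s)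
  rw [e]
  exact congrArg (fun n : M k (A ⊗[k] Y) => n.right x) (tensLin_one_central hA hY hc s m)

theorem ext_tensLin_emb_one_mul (hA : Nondegenerate A) (hY : Nondegenerate Y)
    {m n : M k (A ⊗[k] Y)} (h : ∀ a, tensLin (emb a) 1 * m = tensLin (emb a) 1 * n) : m = n := by
  refine M.ext_right (hA.tensor hY) hA fun x => ?_
  induction x using TensorProduct.induction_on with
  | zero => simp only [map_zero]
  | add x y hx hy => rw [map_add, map_add, hx, hy]
  | tmul p t =>
    refine ext_tmul_mul hA hY fun u v => ?_
    rw [← M.right_mul_apply (hA.tensor hY), ← M.right_mul_apply (hA.tensor hY),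
      Algebra.TensorProduct.tmul_mul_tmul]
    exact congrArg (fun n : M k (A ⊗[k] Y) => n.right (u ⊗ₜ[k] (v * t))) (h p)

end CommLeg

/-! ### The antipode of a commutative multiplier Hopf algebra -/

section Antipode

variable {k : Type*} [Field k]
variable {A : Type*} [NonUnitalRing A] [Module k A] [SMulCommClass k A A] [IsScalarTower k A A]
variable {ΔA : A →ₗ[k] M k (A ⊗[k] A)}

theorem IsMultiplierHopf.antipodeL_mul (h : IsMultiplierHopf ΔA) (ε : A →ₗ[k] k) (p q y : A) :
    h.antipodeL ε (p ⊗ₜ[k] (q * y)) = h.antipodeL ε (p ⊗ₜ[k] q) * y := by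
  refine forall_of_surjective_lift h.bijective_one.2
    (f := h.antipodeL ε ∘ₗ (LinearMap.mulRight k y).lTensor A)
    (g := LinearMap.mulRight k y ∘ₗ h.antipodeL ε) (fun r s => ?_) (p ⊗ₜ[k] q)
  rw [LinearMap.comp_apply, LinearMap.comp_apply, ← h.one_mul_right, h.antipodeL_canonOne,
    h.antipodeL_canonOne, map_smul, LinearMap.mulRight_apply]

/-- The antipode of a commutative multiplier Hopf algebra, as a map to multipliers. -/
def IsMultiplierHopf.antipodeM (h : IsMultiplierHopf ΔA) (hc : ∀ a b : A, a * b = b * a)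
    (ε : A →ₗ[k] k) (p : A) : M k A :=
  M.mk (h.antipodeL ε ∘ₗ TensorProduct.mk k A A p) (h.antipodeL ε ∘ₗ TensorProduct.mk k A A p)
    (fun a b => by
      change a * h.antipodeL ε (p ⊗ₜ[k] b) = h.antipodeL ε (p ⊗ₜ[k] a) * b
      rw [hc, ← h.antipodeL_mul, ← h.antipodeL_mul, hc])

/-- `p ⊗ x ↦ (S(p) ⊗ 1)x`. -/
def IsMultiplierHopf.antipodeAct (Y : Type*) [AddCommGroup Y] [Module k Y]
    (h : IsMultiplierHopf ΔA) (ε : A →ₗ[k] k) : A ⊗[k] (A ⊗[k] Y) →ₗ[k] A ⊗[k] Y :=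
  (h.antipodeL ε).rTensor Y ∘ₗ (TensorProduct.assoc k A A Y).symm.toLinearMap

theorem IsMultiplierHopf.antipodeAct_tmul (Y : Type*) [AddCommGroup Y] [Module k Y]
    (h : IsMultiplierHopf ΔA) (hc : ∀ a b : A, a * b = b * a)
    (ε : A →ₗ[k] k) (p : A) (x : A ⊗[k] Y) :
    h.antipodeAct Y ε (p ⊗ₜ[k] x) = (h.antipodeM hc ε p).left.rTensor Y x := by
  induction x using TensorProduct.induction_on with
  | zero => rw [TensorProduct.tmul_zero, map_zero, map_zero]
  | add x y hx hy => rw [TensorProduct.tmul_add, map_add, map_add, hx, hy]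
  | tmul q y => rfl

end Antipode

/-! ### The span of `ρ(Y)(A ⊗ Y)` -/

section CoactionSpan

variable {k : Type*} [Field k]
variable {A : Type*} [NonUnitalRing A] [Module k A] [SMulCommClass k A A] [IsScalarTower k A A]
variable {Y : Type*} [NonUnitalRing Y] [Module k Y] [SMulCommClass k Y Y] [IsScalarTower k Y Y]
variable {ΔA : A →ₗ[k] M k (A ⊗[k] A)} {ε : A →ₗ[k] k}

/-- The antipode argument for `E(1 ⊗ y) = (S(y₋₁) ⊗ 1)ρ(y₀)`, abstracted so that left and right
actions are covered at once: `f` is the action of `E`, `r` that of `ρ`, `N` that of `(Δ_A ⊗ ι)ρ(y)`,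
and `T` is `a ↦ T(y ⊗ a)`. Applying `S` to the first leg and multiplying into the second puts the
`ρ` side in the span, while the `E` side collapses by `S(p₍₁₎)p₍₂₎ = ε(p)`. -/
theorem mem_span_of_iterated (h : IsMultiplierHopf ΔA) (hε : IsHopfCounit ΔA ε)
    (hc : ∀ a b : A, a * b = b * a) (f : A ⊗[k] Y →ₗ[k] A ⊗[k] Y)
    (r : Y →ₗ[k] A ⊗[k] Y →ₗ[k] A ⊗[k] Y)
    (hf : ∀ (s : M k A) x, f (s.left.rTensor Y x) = s.left.rTensor Y (f x))
    (hr : ∀ t (s : M k A) x, r t (s.left.rTensor Y x) = s.left.rTensor Y (r t x))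
    (y : Y) (N : A ⊗[k] (A ⊗[k] Y) →ₗ[k] A ⊗[k] (A ⊗[k] Y)) (T : A →ₗ[k] A ⊗[k] Y)
    (hT : ∀ a, sliceL ε (T a) = ε a • y)
    (h₁ : ∀ a b x, f.lTensor A (N ((b * a) ⊗ₜ[k] x)) =
      TensorProduct.map (LinearMap.mulLeft k b) (r.flip x) (T a))
    (g : Y →ₗ[k] Y) (g₀ : Y) (h₂ : ∀ a b c,
      N (TensorProduct.assoc k A A Y ((ΔA a).left (b ⊗ₜ[k] c) ⊗ₜ[k] g₀)) =
        TensorProduct.assoc k A A Y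
          (TensorProduct.map ((M.leftLin ∘ₗ ΔA).flip (b ⊗ₜ[k] c)) g (T a))) (a : A) :
    f (a ⊗ₜ[k] g y) ∈ Submodule.span k {x | ∃ v x', x = r v x'} := by
  set R := Submodule.span k {x | ∃ v x', x = r v x'} with hR
  have hΘf : ∀ v, h.antipodeAct Y ε (f.lTensor A v) = f (h.antipodeAct Y ε v) := by
    intro v
    induction v using TensorProduct.induction_on with
    | zero => simp only [map_zero]
    | add x y hx hy => simp only [map_add, hx, hy]
    | tmul p x =>
      rw [LinearMap.lTensor_tmul, h.antipodeAct_tmul Y hc, h.antipodeAct_tmul Y hc, hf]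
  have hmem : ∀ v, h.antipodeAct Y ε (f.lTensor A (N v)) ∈ R := by
    intro v
    induction v using TensorProduct.induction_on with
    | zero => simp only [map_zero, Submodule.zero_mem]
    | add x y hx hy => simpa only [map_add] using Submodule.add_mem _ hx hy
    | tmul p x =>
      -- The hypothesis `h₁` needs a first leg of the form `b * a`; such products span `A`.
      obtain ⟨w, rfl⟩ := hε.mul'_surjective h p
      induction w using TensorProduct.induction_on with
      | zero => simp only [map_zero, TensorProduct.zero_tmul, Submodule.zero_mem]
      | add x y hx hy =>
        simpa only [map_add, TensorProduct.add_tmul] using Submodule.add_mem _ hx hy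
      | tmul b a =>
        rw [LinearMap.mul'_apply, h₁]
        generalize T a = u
        induction u using TensorProduct.induction_on with
        | zero => simp only [map_zero, Submodule.zero_mem]
        | add x y hx hy => simpa only [map_add] using Submodule.add_mem _ hx hy
        | tmul p t =>
          rw [TensorProduct.map_tmul, h.antipodeAct_tmul Y hc, LinearMap.flip_apply, ← hr]
          exact Submodule.subset_span ⟨_, _, rfl⟩
  have key : ∀ a b c, ε a • f (h.antipodeL ε (b ⊗ₜ[k] c) ⊗ₜ[k] g y) ∈ R := by
    intro a b c
    have e : ∀ u, h.antipodeAct Y ε (TensorProduct.assoc k A A Y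
        (TensorProduct.map ((M.leftLin ∘ₗ ΔA).flip (b ⊗ₜ[k] c)) g u)) =
          h.antipodeL ε (b ⊗ₜ[k] c) ⊗ₜ[k] g (sliceL ε u) := by
      intro u
      induction u using TensorProduct.induction_on with
      | zero => simp only [map_zero, TensorProduct.tmul_zero]
      | add x y hx hy => simp only [map_add, hx, hy, TensorProduct.tmul_add]
      | tmul p t =>
        rw [TensorProduct.map_tmul, IsMultiplierHopf.antipodeAct, LinearMap.comp_apply,
          LinearEquiv.coe_coe, LinearEquiv.symm_apply_apply, LinearMap.rTensor_tmul,
          LinearMap.flip_apply, LinearMap.comp_apply, M.leftLin_apply, h.antipodeL_left hε,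
          sliceL_tmul, map_smul, TensorProduct.smul_tmul]
    -- This choice of argument puts `Δ_A(p)(b ⊗ c)` on the first two legs, where the antipode
    -- contracts it to `ε(p)S(b)c`; summing over `T a` leaves `ε(a)` and `y`.
    have := hmem (TensorProduct.assoc k A A Y ((ΔA a).left (b ⊗ₜ[k] c) ⊗ₜ[k] g₀))
    rwa [hΘf, h₂, e, hT, map_smul, TensorProduct.tmul_smul, map_smul] at this
  by_cases ha : a = 0
  · rw [ha, TensorProduct.zero_tmul, map_zero]
    exact Submodule.zero_mem _
  · obtain ⟨a₁, ha₁⟩ := hε.exists_eq_one h a ha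
    -- The elements `S(b)c` span `A`, so an arbitrary first leg is reached.
    obtain ⟨w, rfl⟩ := h.antipodeL_surjective hε a
    clear ha
    induction w using TensorProduct.induction_on with
    | zero => simp only [map_zero, TensorProduct.zero_tmul, Submodule.zero_mem]
    | add x y hx hy =>
      simpa only [map_add, TensorProduct.add_tmul] using Submodule.add_mem _ hx hy
    | tmul b c => simpa only [ha₁, one_smul] using key a₁ b c

/-- `Y` is spanned by triple products. The argument for `E` spends two of the three factors: one
covers `ρ(y)` so that `Δ_A ⊗ ι` can be applied, the other is the element on which the resulting
multiplier is tested. -/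
theorem mem_of_tmul_mul {ΔY : Y →ₗ[k] M k (Y ⊗[k] Y)} (hY : IsMultiplierHopf ΔY)
    (f : A ⊗[k] Y →ₗ[k] A ⊗[k] Y) (R : Submodule k (A ⊗[k] Y))
    (h : ∀ a u v w, f (a ⊗ₜ[k] (u * v * w)) ∈ R) (x : A ⊗[k] Y) : f x ∈ R := by
  induction x using TensorProduct.induction_on with
  | zero => simp only [map_zero, Submodule.zero_mem]
  | add x y hx hy => simpa only [map_add] using Submodule.add_mem _ hx hy
  | tmul a y =>
    obtain ⟨v, rfl⟩ := hY.hopfCounit_spec.mul'_surjective hY y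
    induction v using TensorProduct.induction_on with
    | zero => simp only [map_zero, TensorProduct.tmul_zero, Submodule.zero_mem]
    | add x y hx hy =>
      simpa only [map_add, TensorProduct.tmul_add] using Submodule.add_mem _ hx hy
    | tmul u w =>
      obtain ⟨v, rfl⟩ := hY.hopfCounit_spec.mul'_surjective hY u
      induction v using TensorProduct.induction_on with
      | zero =>
        simp only [map_zero, TensorProduct.zero_tmul, TensorProduct.tmul_zero, Submodule.zero_mem]
      | add x y hx hy =>
        simpa only [map_add, TensorProduct.add_tmul, TensorProduct.tmul_add]
          using Submodule.add_mem _ hx hy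
      | tmul u v => exact h a u v w

end CoactionSpan

/-! ### Symmetric partial comodule bialgebras over a commutative algebra -/

namespace IsSymmetricPartialComoduleBialgebra

variable {k : Type*} [Field k]
variable {A : Type*} [NonUnitalRing A] [Module k A] [SMulCommClass k A A] [IsScalarTower k A A]
variable {Y : Type*} [NonUnitalRing Y] [Module k Y] [SMulCommClass k Y Y] [IsScalarTower k Y Y]
variable {ΔA : A →ₗ[k] M k (A ⊗[k] A)} {ΔY : Y →ₗ[k] M k (Y ⊗[k] Y)}
variable {ρ : Y →ₗ[k] M k (A ⊗[k] Y)} {E : M k (A ⊗[k] Y)}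

theorem emb_coactT (hρ : IsSymmetricPartialComoduleBialgebra ΔA ΔY ρ E) (hA : Nondegenerate A)
    (hY : Nondegenerate Y) (y : Y) (a : A) : emb (coactT ρ y a) = ρ y * tensLin (emb a) 1 :=
  emb_pull (hA.tensor hY) (hρ.coalgebra.mem_T y a)

theorem coactTbar_eq (hA : Nondegenerate A) (hY : Nondegenerate Y)
    (hc : ∀ a b : A, a * b = b * a) (a : A) (y : Y) : coactTbar ρ a y = coactT ρ y a :=
  congrArg pull (tensLin_one_central hA hY hc (emb a) (ρ y))

theorem emb_coactT' (hρ : IsSymmetricPartialComoduleBialgebra ΔA ΔY ρ E) (hA : Nondegenerate A)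
    (hY : Nondegenerate Y) (hc : ∀ a b : A, a * b = b * a) (y : Y) (a : A) :
    emb (coactT ρ y a) = tensLin (emb a) 1 * ρ y := by
  rw [hρ.emb_coactT hA hY, tensLin_one_central hA hY hc]

theorem left_tmul (hρ : IsSymmetricPartialComoduleBialgebra ΔA ΔY ρ E) (hA : Nondegenerate A)
    (hY : Nondegenerate Y) (y : Y) (a : A) (w : Y) :
    (ρ y).left (a ⊗ₜ[k] w) = (LinearMap.mulRight k w).lTensor A (coactT ρ y a) :=
  left_tmul_of_left_leg hA hY (hρ.emb_coactT hA hY y a).symm w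

theorem right_tmul (hρ : IsSymmetricPartialComoduleBialgebra ΔA ΔY ρ E) (hA : Nondegenerate A)
    (hY : Nondegenerate Y) (hc : ∀ a b : A, a * b = b * a) (y : Y) (a : A) (w : Y) :
    (ρ y).right (a ⊗ₜ[k] w) = (LinearMap.mulLeft k w).lTensor A (coactT ρ y a) :=
  right_tmul_of_left_leg hA hY (hρ.emb_coactT' hA hY hc y a).symm w

theorem coactT_mul_right (hρ : IsSymmetricPartialComoduleBialgebra ΔA ΔY ρ E)
    (hA : Nondegenerate A) (hY : Nondegenerate Y) (y : Y) (a b : A) :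
    coactT ρ y (a * b) = (LinearMap.mulRight k b).rTensor Y (coactT ρ y a) := by
  apply emb_injective (k := k) (hA.tensor hY)
  rw [← emb_mul_tens_emb_one hA hY, hρ.emb_coactT hA hY, hρ.emb_coactT hA hY, mul_assoc,
    tensLin_mul, one_mul, emb_mul_emb]

/-- After covering by `a`, `ρ(y)` has the form `xE`, which the idempotent fixes. -/
theorem mul_idempotent (hρ : IsSymmetricPartialComoduleBialgebra ΔA ΔY ρ E) (hA : Nondegenerate A)
    (hY : Nondegenerate Y) (y : Y) : ρ y * E = ρ y := by
  refine ext_tensLin_emb_one_mul hA hY fun a => ?_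
  obtain ⟨x, hx⟩ := hρ.algebra.coact_left a y
  rw [← mul_assoc, hx, mul_assoc, hρ.algebra.idempotent]

theorem idempotent_mul (hρ : IsSymmetricPartialComoduleBialgebra ΔA ΔY ρ E) (hA : Nondegenerate A)
    (hY : Nondegenerate Y) (hc : ∀ a b : A, a * b = b * a) (y : Y) : E * ρ y = ρ y := by
  refine ext_tensLin_emb_one_mul hA hY fun a => ?_
  obtain ⟨x, hx⟩ := hρ.algebra.coact_right y a
  rw [tensLin_one_central hA hY hc, tensLin_one_central hA hY hc, mul_assoc, hx, ← mul_assoc,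
    hρ.algebra.idempotent]

theorem left_mem_span (hρ : IsSymmetricPartialComoduleBialgebra ΔA ΔY ρ E)
    (hA : IsMultiplierHopf ΔA) (hY : IsMultiplierHopf ΔY) (hc : ∀ a b : A, a * b = b * a)
    (x : A ⊗[k] Y) : E.left x ∈ Submodule.span k {x | ∃ v w, x = (ρ v).left w} := by
  have nA := hA.nondegenerate
  have nY := hY.nondegenerate
  have key : ∀ a y w w', E.left (a ⊗ₜ[k] (y * w * w')) ∈
      Submodule.span k {x | ∃ v w, x = (ρ v).left w} := by
    intro a y w w'
    obtain ⟨n, hn, hm, -⟩ := hρ.algebra.coassoc y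
    refine mem_span_of_iterated hA hA.hopfCounit_spec hc E.left (M.leftLin ∘ₗ ρ)
      (left_tensLin_one nA nY hc E) (fun t => left_tensLin_one nA nY hc (ρ t)) y
      (M.assoc n).left (coactT ρ y) (hρ.coalgebra.counit_right y) (fun a b x => ?_)
      (LinearMap.mulRight k w' ∘ₗ LinearMap.mulRight k w) (w * w') (fun a b c => ?_) a
    · have e := congrArg (fun m : M k (A ⊗[k] (A ⊗[k] Y)) => m.left (b ⊗ₜ[k] x)) (hm a).1
      have e' : ∀ u, (tensMap emb ρ u).left (b ⊗ₜ[k] x) = TensorProduct.map (LinearMap.mulLeft k b)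
          ((M.leftLin ∘ₗ ρ).flip x) u := by
        intro u
        induction u using TensorProduct.induction_on with
        | zero => simp only [map_zero]; rfl
        | add u v hu hv => rw [map_add, map_add, ← hu, ← hv]; rfl
        | tmul p t =>
          rw [TensorProduct.map_tmul, LinearMap.mulLeft_apply, hc]
          rfl
      rw [← e', ← e, hc b a]
      rfl
    · have e := congrArg (fun m : M k ((A ⊗[k] A) ⊗[k] Y) => m.left ((b ⊗ₜ[k] c) ⊗ₜ[k] w'))
        (hn (a ⊗ₜ[k] w)).1
      have e' : ∀ u, (tensMap ΔA emb ((LinearMap.mulRight k w).lTensor A u)).left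
          ((b ⊗ₜ[k] c) ⊗ₜ[k] w') = TensorProduct.map ((M.leftLin ∘ₗ ΔA).flip (b ⊗ₜ[k] c))
            (LinearMap.mulRight k w' ∘ₗ LinearMap.mulRight k w) u := by
        intro u
        induction u using TensorProduct.induction_on with
        | zero => simp only [map_zero]; rfl
        | add u v hu hv => simp only [map_add]; rw [← hu, ← hv]; rfl
        | tmul p t => rfl
      rw [← e', ← hρ.left_tmul nA nY, ← e, M.assoc, congr_left, LinearEquiv.symm_apply_apply]
      rfl
  exact mem_of_tmul_mul hY E.left _ key x

theorem right_mem_span (hρ : IsSymmetricPartialComoduleBialgebra ΔA ΔY ρ E)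
    (hA : IsMultiplierHopf ΔA) (hY : IsMultiplierHopf ΔY) (hc : ∀ a b : A, a * b = b * a)
    (x : A ⊗[k] Y) : E.right x ∈ Submodule.span k {x | ∃ v w, x = (ρ v).right w} := by
  have nA := hA.nondegenerate
  have nY := hY.nondegenerate
  -- `A ⊗ A` is commutative, so right actions of `Δ_A(p)` may be read as left actions. This lets the
  -- same antipode lemma serve for the right-hand span.
  have hc' := tensor_mul_comm (k := k) hc hc
  have key : ∀ a w' w y, E.right (a ⊗ₜ[k] (w' * w * y)) ∈
      Submodule.span k {x | ∃ v w, x = (ρ v).right w} := by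
    intro a w' w y
    obtain ⟨n, hn, -, hm⟩ := hρ.algebra.coassoc y
    have := mem_span_of_iterated hA hA.hopfCounit_spec hc E.right (M.rightLin ∘ₗ ρ)
      (right_tensLin_one nA nY hc E) (fun t => right_tensLin_one nA nY hc (ρ t)) y
      (M.assoc n).right (coactT ρ y) (hρ.coalgebra.counit_right y) (fun a b x => ?_)
      (LinearMap.mulLeft k w' ∘ₗ LinearMap.mulLeft k w) (w' * w) (fun a b c => ?_) a
    · rwa [mul_assoc]
    · have e := congrArg (fun m : M k (A ⊗[k] (A ⊗[k] Y)) => m.right (b ⊗ₜ[k] x)) (hm a).2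
      have e' : ∀ u, (tensMap emb ρ u).right (b ⊗ₜ[k] x) =
          TensorProduct.map (LinearMap.mulLeft k b) ((M.rightLin ∘ₗ ρ).flip x) u := by
        intro u
        induction u using TensorProduct.induction_on with
        | zero => simp only [map_zero]; rfl
        | add u v hu hv => rw [map_add, map_add, ← hu, ← hv]; rfl
        | tmul p t => rfl
      rw [← e', ← coactTbar_eq nA nY hc, ← e]
      rfl
    · have e := congrArg (fun m : M k ((A ⊗[k] A) ⊗[k] Y) => m.right ((b ⊗ₜ[k] c) ⊗ₜ[k] w'))
        (hn (a ⊗ₜ[k] w)).2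
      have e' : ∀ u, (tensMap ΔA emb ((LinearMap.mulLeft k w).lTensor A u)).right
          ((b ⊗ₜ[k] c) ⊗ₜ[k] w') = TensorProduct.map ((M.leftLin ∘ₗ ΔA).flip (b ⊗ₜ[k] c))
            (LinearMap.mulLeft k w' ∘ₗ LinearMap.mulLeft k w) u := by
        intro u
        induction u using TensorProduct.induction_on with
        | zero => simp only [map_zero]; rfl
        | add u v hu hv => simp only [map_add]; rw [← hu, ← hv]; rfl
        | tmul p t =>
          change (ΔA p).right (b ⊗ₜ[k] c) ⊗ₜ[k] _ = (ΔA p).left (b ⊗ₜ[k] c) ⊗ₜ[k] _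
          rw [M.left_eq_right_of_comm (nA.tensor nA) hc']
          rfl
      rw [← e', ← hρ.right_tmul nA nY hc, ← e, M.assoc, congr_right,
        LinearEquiv.symm_apply_apply, M.left_eq_right_of_comm (nA.tensor nA) hc']
      rfl
  exact mem_of_tmul_mul hY E.right _ key x

/-- The representative of `x` is `Ex` (respectively `xE`): `ρ` does not notice the idempotent, and
the idempotent lands in the span. -/
theorem isCovered (hρ : IsSymmetricPartialComoduleBialgebra ΔA ΔY ρ E)
    (hA : IsMultiplierHopf ΔA) (hY : IsMultiplierHopf ΔY) (hc : ∀ a b : A, a * b = b * a) :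
    IsCovered ρ where
  left x := ⟨E.left x, hρ.left_mem_span hA hY hc x, fun t => by
    rw [← M.left_mul, hρ.mul_idempotent hA.nondegenerate hY.nondegenerate]⟩
  right x := ⟨E.right x, hρ.right_mem_span hA hY hc x, fun t => by
    rw [← M.right_mul, hρ.idempotent_mul hA.nondegenerate hY.nondegenerate hc]⟩

end IsSymmetricPartialComoduleBialgebra

/-! ### The coaction and the comultiplication of `Y` -/

section Datum

variable {k : Type*} [Field k]
variable {A : Type*} [NonUnitalRing A] [Module k A] [SMulCommClass k A A] [IsScalarTower k A A]
variable {Y : Type*} [NonUnitalRing Y] [Module k Y] [SMulCommClass k Y Y] [IsScalarTower k Y Y]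

/-- The data of a smash coproduct: a symmetric partial comodule bialgebra over a commutative
regular multiplier Hopf algebra. -/
structure IsSmashDatum (ΔA : A →ₗ[k] M k (A ⊗[k] A)) (ΔY : Y →ₗ[k] M k (Y ⊗[k] Y))
    (ρ : Y →ₗ[k] M k (A ⊗[k] Y)) (E : M k (A ⊗[k] Y)) : Prop where
  left : IsRegularMultiplierHopf ΔA
  right : IsRegularMultiplierHopf ΔY
  comm : ∀ a b : A, a * b = b * a
  bialgebra : IsSymmetricPartialComoduleBialgebra ΔA ΔY ρ E

/-- `(T ⊗ ι) : Y ⊗ A ⊗ Y → A ⊗ Y ⊗ Y`, with the other association of the factors. -/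
def coactLegs (ρ : Y →ₗ[k] M k (A ⊗[k] Y)) (V : Type*) [AddCommGroup V] [Module k V] :
    Y ⊗[k] (A ⊗[k] V) →ₗ[k] A ⊗[k] (Y ⊗[k] V) :=
  (TensorProduct.assoc k A Y V).toLinearMap ∘ₗ (TensorProduct.lift (coactT ρ)).rTensor V ∘ₗ
    (TensorProduct.assoc k Y A V).symm.toLinearMap

/-- `(ι ⊗ ε_Y)T` as a bilinear map. -/
def coactChar (ΔY : Y →ₗ[k] M k (Y ⊗[k] Y)) (ρ : Y →ₗ[k] M k (A ⊗[k] Y)) : Y →ₗ[k] A →ₗ[k] A :=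
  (coactT ρ).compr₂ (sliceR (hopfCounit ΔY))

theorem coactLegs_tmul (ρ : Y →ₗ[k] M k (A ⊗[k] Y)) (V : Type*) [AddCommGroup V] [Module k V]
    (s : Y) (a : A) (v : V) : coactLegs ρ V (s ⊗ₜ[k] (a ⊗ₜ[k] v)) =
      TensorProduct.assoc k A Y V (coactT ρ s a ⊗ₜ[k] v) := rfl

theorem coactLegs_lTensor (ρ : Y →ₗ[k] M k (A ⊗[k] Y)) {V W : Type*} [AddCommGroup V] [Module k V]
    [AddCommGroup W] [Module k W] (g : V →ₗ[k] W) (z : Y ⊗[k] (A ⊗[k] V)) :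
    coactLegs ρ W ((g.lTensor A).lTensor Y z) =
      (g.lTensor Y).lTensor A (coactLegs ρ V z) := by
  have e : ∀ (p : A ⊗[k] Y) (v : V), TensorProduct.assoc k A Y W (p ⊗ₜ[k] g v) =
      (g.lTensor Y).lTensor A (TensorProduct.assoc k A Y V (p ⊗ₜ[k] v)) := by
    intro p v
    induction p using TensorProduct.induction_on with
    | zero => simp only [TensorProduct.zero_tmul, map_zero]
    | add x y hx hy => simp only [TensorProduct.add_tmul, map_add, hx, hy]
    | tmul a y => rfl
  induction z using TensorProduct.induction_on with
  | zero => simp only [map_zero]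
  | add x y hx hy => simp only [map_add, hx, hy]
  | tmul s x =>
    induction x using TensorProduct.induction_on with
    | zero => simp only [TensorProduct.tmul_zero, map_zero]
    | add x y hx hy => simp only [TensorProduct.tmul_add, map_add, hx, hy]
    | tmul a v =>
      rw [LinearMap.lTensor_tmul, LinearMap.lTensor_tmul, coactLegs_tmul, coactLegs_tmul, e]

theorem counitT_tmul (ΔY : Y →ₗ[k] M k (Y ⊗[k] Y)) (ρ : Y →ₗ[k] M k (A ⊗[k] Y)) :
    counitT ΔY ρ = TensorProduct.lift (coactChar ΔY ρ) :=
  TensorProduct.ext' fun _ _ => rfl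

/-- `(T₁ ⊗ ι)(ι ⊗ ι ⊗ a')`, rearranged. -/
def comulLegs (ΔA : A →ₗ[k] M k (A ⊗[k] A)) (Y : Type*) [AddCommGroup Y] [Module k Y] (a' : A) :
    Y ⊗[k] (A ⊗[k] Y) →ₗ[k] (Y ⊗[k] A) ⊗[k] (A ⊗[k] Y) :=
  (TensorProduct.assoc k Y A (A ⊗[k] Y)).symm.toLinearMap ∘ₗ
    ((TensorProduct.assoc k A A Y).toLinearMap ∘ₗ ((canonOne ΔA).flip a').rTensor Y).lTensor Y

end Datum

namespace IsSmashDatum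

variable {k : Type*} [Field k]
variable {A : Type*} [NonUnitalRing A] [Module k A] [SMulCommClass k A A] [IsScalarTower k A A]
variable {Y : Type*} [NonUnitalRing Y] [Module k Y] [SMulCommClass k Y Y] [IsScalarTower k Y Y]
variable {ΔA : A →ₗ[k] M k (A ⊗[k] A)} {ΔY : Y →ₗ[k] M k (Y ⊗[k] Y)}
variable {ρ : Y →ₗ[k] M k (A ⊗[k] Y)} {E : M k (A ⊗[k] Y)} (S : IsSmashDatum ΔA ΔY ρ E)

local notation "εY" => hopfCounit ΔY
local notation "εA" => hopfCounit ΔA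

include S

theorem pre_left : IsPreMultiplierBialgebra ΔA :=
  S.left.toIsMultiplierHopf.toIsMultiplierBialgebra.toIsPreMultiplierBialgebra

theorem pre_right : IsPreMultiplierBialgebra ΔY :=
  S.right.toIsMultiplierHopf.toIsMultiplierBialgebra.toIsPreMultiplierBialgebra

theorem nondeg_left : Nondegenerate A := S.pre_left.nondegenerate

theorem nondeg_right : Nondegenerate Y := S.pre_right.nondegenerate

theorem counit_left : IsHopfCounit ΔA εA := S.left.toIsMultiplierHopf.hopfCounit_spec

theorem counit_right : IsHopfCounit ΔY εY := S.right.toIsMultiplierHopf.hopfCounit_spec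

theorem covered : IsCovered ρ :=
  S.bialgebra.isCovered S.left.toIsMultiplierHopf S.right.toIsMultiplierHopf S.comm

/-- `Δ_Y(y)_{13} ρ`-cover: `y₍₁₎ ⊗ ρ(y₍₂₎)x`. -/
def covR : Y →ₗ[k] A ⊗[k] Y →ₗ[k] Y ⊗[k] (A ⊗[k] Y) :=
  coverR S.pre_right S.bialgebra.algebra.map_mul S.covered

/-- `y₍₁₎ ⊗ xρ(y₍₂₎)`. -/
def covL : A ⊗[k] Y →ₗ[k] Y →ₗ[k] Y ⊗[k] (A ⊗[k] Y) :=
  coverL S.pre_right S.bialgebra.algebra.map_mul S.covered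

theorem actL_tmul (a : A) (w : Y) :
    actL ρ (a ⊗ₜ[k] w) = (LinearMap.mulRight k w).lTensor A ∘ₗ (coactT ρ).flip a :=
  LinearMap.ext fun y => S.bialgebra.left_tmul S.nondeg_left S.nondeg_right y a w

theorem actR_tmul (a : A) (w : Y) :
    actR ρ (a ⊗ₜ[k] w) = (LinearMap.mulLeft k w).lTensor A ∘ₗ (coactT ρ).flip a :=
  LinearMap.ext fun y => S.bialgebra.right_tmul S.nondeg_left S.nondeg_right S.comm y a w

theorem coactT_mul (y : Y) (a b : A) :
    coactT ρ y (a * b) = (LinearMap.mulRight k b).rTensor Y (coactT ρ y a) :=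
  S.bialgebra.coactT_mul_right S.nondeg_left S.nondeg_right y a b

theorem coactT_mul' (y : Y) (a b : A) :
    coactT ρ y (a * b) = (LinearMap.mulLeft k a).rTensor Y (coactT ρ y b) := by
  have e : LinearMap.mulLeft k a = LinearMap.mulRight k a := LinearMap.ext fun x => S.comm a x
  rw [e, S.comm, S.coactT_mul]

theorem coactChar_mul (y : Y) (a b : A) :
    coactChar ΔY ρ y (a * b) = coactChar ΔY ρ y a * b := by
  change sliceR εY (coactT ρ y (a * b)) = sliceR εY (coactT ρ y a) * b
  rw [S.coactT_mul, sliceR_rTensor, LinearMap.mulRight_apply]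

theorem mul_coactChar (y : Y) (a b : A) :
    coactChar ΔY ρ y (a * b) = a * coactChar ΔY ρ y b := by
  rw [S.comm, S.coactChar_mul, S.comm]

/-- The bilinear cover satisfies the condition over which the coalgebra axioms quantify, so those
axioms become identities about `covR`. -/
theorem isComulCoactRight (y : Y) (a : A) (w : Y) :
    IsComulCoactRight ΔY ρ y a w (S.covR y (a ⊗ₜ[k] w)) := by
  intro u
  rw [covR, mulRight_coverR, mulLeft_coverR, S.actL_tmul, lTensor_lTensor, lTensor_lTensor]
  exact ⟨rfl, rfl⟩

theorem isComulCoactLeft (w y : Y) (a : A) :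
    IsComulCoactLeft ΔY ρ w y a (S.covL (a ⊗ₜ[k] w) y) := by
  intro u
  rw [covL, mulRight_coverL, mulLeft_coverL, S.actR_tmul, lTensor_lTensor, lTensor_lTensor]
  exact ⟨rfl, rfl⟩

theorem coactLegs_covR (y : Y) (a : A) (w : Y) :
    coactLegs ρ Y (S.covR y (a ⊗ₜ[k] w)) = ((canonOne ΔY).flip w).lTensor A (coactT ρ y a) :=
  (S.bialgebra.coalgebra.comul_right y a w _ (S.isComulCoactRight y a w)).symm

theorem coactLegs_covL (y : Y) (a : A) (w : Y) :
    coactLegs ρ Y (S.covL (a ⊗ₜ[k] w) y) = (canonFour ΔY w).lTensor A (coactT ρ y a) :=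
  (S.bialgebra.coalgebra.comul_left w y a _ (S.isComulCoactLeft w y a)).symm

/-- `P` stands for `e ⊗ f ↦` the result of applying `ρ(·)(f ⊗ w)` to the second leg of `T(y ⊗ e)`.
Only additivity and values on pure tensors matter, so any presentation of this map may be supplied.
-/
theorem coassoc_covR (y : Y) (a a' : A) (w : Y) (P : A ⊗[k] A → A ⊗[k] (A ⊗[k] Y))
    (hP : ∀ e f, P (e ⊗ₜ[k] f) = (actL ρ (f ⊗ₜ[k] w)).lTensor A (coactT ρ y e))
    (hP₀ : P 0 = 0) (hadd : ∀ u v, P (u + v) = P u + P v) :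
    (counitT ΔY ρ).rTensor (A ⊗[k] Y) (comulLegs ΔA Y a' (S.covR y (a ⊗ₜ[k] w))) =
      P (canonOne ΔA a a') := by
  have e : ∀ v : A ⊗[k] A, ((LinearMap.mulRight k w).lTensor A).lTensor A
        ((TensorProduct.lift (coactT ρ)).lTensor A
          (TensorProduct.assoc k A Y A ((coactT ρ y).rTensor A v))) = P v := by
    intro v
    induction v using TensorProduct.induction_on with
    | zero => simp only [map_zero, hP₀]
    | add x y hx hy => simp only [map_add, hx, hy, hadd]
    | tmul e f =>
      rw [hP, S.actL_tmul, LinearMap.rTensor_tmul]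
      generalize coactT ρ y e = u
      induction u using TensorProduct.induction_on with
      | zero => simp only [TensorProduct.zero_tmul, map_zero]
      | add x y hx hy => simp only [TensorProduct.add_tmul, map_add, hx, hy]
      | tmul a y => rfl
  rw [← e, S.bialgebra.coalgebra.coassoc y a a' w _ (S.isComulCoactRight y a w), comulLegs,
    LinearMap.lTensor_comp]
  rfl

end IsSmashDatum

/-! ### Rearrangements of tensor factors -/

section Rearrange

variable {k : Type*} [Field k]
variable {B : Type*} [NonUnitalRing B] [Module k B] [SMulCommClass k B B] [IsScalarTower k B B]
variable {D : Type*} [NonUnitalRing D] [Module k D] [SMulCommClass k D D] [IsScalarTower k D D]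
variable {F : Type*} [NonUnitalRing F] [Module k F] [SMulCommClass k F F] [IsScalarTower k F F]

theorem map_eq_lTensor_rTensor {U V W X : Type*} [AddCommGroup U] [Module k U] [AddCommGroup V]
    [Module k V] [AddCommGroup W] [Module k W] [AddCommGroup X] [Module k X] (f : U →ₗ[k] V)
    (g : W →ₗ[k] X) (x : U ⊗[k] W) :
    TensorProduct.map f g x = g.lTensor V (f.rTensor W x) := by
  rw [← LinearMap.comp_apply, LinearMap.lTensor_comp_rTensor]

theorem mulRight_tmul (b : B) (d : D) : LinearMap.mulRight k (b ⊗ₜ[k] d) =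
    TensorProduct.map (LinearMap.mulRight k b) (LinearMap.mulRight k d) :=
  LinearMap.ext fun x => by
    rw [LinearMap.mulRight_apply, mul_tmul, ← LinearMap.comp_apply, LinearMap.lTensor_comp_rTensor]

theorem mulLeft_tmul (b : B) (d : D) : LinearMap.mulLeft k (b ⊗ₜ[k] d) =
    TensorProduct.map (LinearMap.mulLeft k b) (LinearMap.mulLeft k d) :=
  LinearMap.ext fun x => by
    rw [LinearMap.mulLeft_apply, tmul_mul, ← LinearMap.comp_apply, LinearMap.lTensor_comp_rTensor]

/-- The extension `m ↦ m ⊗ 1` of multipliers along an isomorphism `U ⊗ V ≃ F`. -/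
def M.legOne (e : B ⊗[k] D ≃ₗ[k] F)
    (he : ∀ b d b' d', e (b ⊗ₜ[k] d) * e (b' ⊗ₜ[k] d') = e ((b * b') ⊗ₜ[k] (d * d'))) :
    M k B →ₗ[k] M k F where
  toFun m := M.mk (e.toLinearMap ∘ₗ m.left.rTensor D ∘ₗ e.symm.toLinearMap)
    (e.toLinearMap ∘ₗ m.right.rTensor D ∘ₗ e.symm.toLinearMap) (by
      intro x y
      obtain ⟨x, rfl⟩ := e.surjective x
      obtain ⟨y, rfl⟩ := e.surjective y
      simp only [LinearMap.comp_apply, LinearEquiv.coe_coe, LinearEquiv.symm_apply_apply]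
      induction x using TensorProduct.induction_on with
      | zero => simp only [map_zero, zero_mul]
      | add x x' h₁ h₂ => simp only [map_add, add_mul, h₁, h₂]
      | tmul b d =>
        induction y using TensorProduct.induction_on with
        | zero => simp only [map_zero, mul_zero]
        | add y y' h₁ h₂ => simp only [map_add, mul_add, h₁, h₂]
        | tmul b' d' =>
          rw [LinearMap.rTensor_tmul, LinearMap.rTensor_tmul, he, he, M.compat])
  map_add' m n := M.ext_both
    (LinearMap.ext fun x => (congrArg e (LinearMap.congr_fun
      (LinearMap.rTensor_add D m.left n.left) (e.symm x))).trans (map_add e _ _))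
    (LinearMap.ext fun x => (congrArg e (LinearMap.congr_fun
      (LinearMap.rTensor_add D m.right n.right) (e.symm x))).trans (map_add e _ _))
  map_smul' c m := M.ext_both
    (LinearMap.ext fun x => (congrArg e (LinearMap.congr_fun
      (LinearMap.rTensor_smul D c m.left) (e.symm x))).trans (map_smul e _ _))
    (LinearMap.ext fun x => (congrArg e (LinearMap.congr_fun
      (LinearMap.rTensor_smul D c m.right) (e.symm x))).trans (map_smul e _ _))

theorem M.legOne_left (e : B ⊗[k] D ≃ₗ[k] F) (he) (m : M k B) (z : B ⊗[k] D) :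
    (M.legOne e he m).left (e z) = e (m.left.rTensor D z) :=
  congrArg (fun w => e (m.left.rTensor D w)) (e.symm_apply_apply z)

theorem M.legOne_right (e : B ⊗[k] D ≃ₗ[k] F) (he) (m : M k B) (z : B ⊗[k] D) :
    (M.legOne e he m).right (e z) = e (m.right.rTensor D z) :=
  congrArg (fun w => e (m.right.rTensor D w)) (e.symm_apply_apply z)

theorem M.legOne_mul (e : B ⊗[k] D ≃ₗ[k] F) (he) (m n : M k B) :
    M.legOne e he (m * n) = M.legOne e he m * M.legOne e he n := by
  refine M.ext_both (LinearMap.ext fun x => ?_) (LinearMap.ext fun x => ?_) <;>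
    obtain ⟨x, rfl⟩ := e.surjective x
  · rw [M.left_mul, M.legOne_left, M.legOne_left, M.legOne_left, rTensor_rTensor]
    rfl
  · rw [M.right_mul, M.legOne_right, M.legOne_right, M.legOne_right, rTensor_rTensor]
    rfl

/-- The product `b ⊗ d ↦ φ(b)ψ(d)` of two maps to a multiplier algebra. -/
def mulMap (φ : B →ₗ[k] M k F) (ψ : D →ₗ[k] M k F) : B ⊗[k] D →ₗ[k] M k F :=
  TensorProduct.lift ((LinearMap.mul k (M k F)).compl₁₂ φ ψ)

theorem mulMap_tmul (φ : B →ₗ[k] M k F) (ψ : D →ₗ[k] M k F) (b : B) (d : D) :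
    mulMap φ ψ (b ⊗ₜ[k] d) = φ b * ψ d := rfl

theorem mulMap_mul (φ : B →ₗ[k] M k F) (ψ : D →ₗ[k] M k F) (hφ : ∀ x y, φ (x * y) = φ x * φ y)
    (hψ : ∀ x y, ψ (x * y) = ψ x * ψ y) (hc : ∀ b d, ψ d * φ b = φ b * ψ d) (x y : B ⊗[k] D) :
    mulMap φ ψ (x * y) = mulMap φ ψ x * mulMap φ ψ y := by
  induction x using TensorProduct.induction_on with
  | zero => rw [zero_mul, map_zero, zero_mul]
  | add x x' h₁ h₂ => rw [add_mul, map_add, map_add, add_mul, h₁, h₂]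
  | tmul b d =>
    induction y using TensorProduct.induction_on with
    | zero => rw [mul_zero, map_zero, mul_zero]
    | add y y' h₁ h₂ => rw [mul_add, map_add, map_add, mul_add, h₁, h₂]
    | tmul b' d' =>
      rw [Algebra.TensorProduct.tmul_mul_tmul, mulMap_tmul, mulMap_tmul, mulMap_tmul, hφ, hψ,
        mul_assoc, mul_assoc, ← mul_assoc (φ b'), ← hc, mul_assoc]

end Rearrange

/-! ### Rearranging the four legs of (Y ⊗ A) ⊗ (Y ⊗ A) -/

section Place

variable {k : Type*} [Field k]
variable (A : Type*) [NonUnitalRing A] [Module k A] [SMulCommClass k A A] [IsScalarTower k A A]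
variable (Y : Type*) [NonUnitalRing Y] [Module k Y] [SMulCommClass k Y Y] [IsScalarTower k Y Y]

/-- `(y ⊗ (a ⊗ y')) ⊗ a' ↦ (y ⊗ a) ⊗ (y' ⊗ a')`. -/
def place : (Y ⊗[k] (A ⊗[k] Y)) ⊗[k] A ≃ₗ[k] (Y ⊗[k] A) ⊗[k] (Y ⊗[k] A) :=
  TensorProduct.assoc k Y (A ⊗[k] Y) A ≪≫ₗ (TensorProduct.assoc k A Y A).lTensor Y ≪≫ₗ
    (TensorProduct.assoc k Y A (Y ⊗[k] A)).symm

variable {A Y}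

theorem place_tmul (s : Y) (a : A) (t : Y) (q : A) :
    place A Y ((s ⊗ₜ[k] (a ⊗ₜ[k] t)) ⊗ₜ[k] q) = (s ⊗ₜ[k] a) ⊗ₜ[k] (t ⊗ₜ[k] q) := rfl

theorem map_place (f : Y →ₗ[k] Y) (g : A →ₗ[k] A) (f' : Y →ₗ[k] Y) (g' : A →ₗ[k] A)
    (z : (Y ⊗[k] (A ⊗[k] Y)) ⊗[k] A) :
    TensorProduct.map (TensorProduct.map f g) (TensorProduct.map f' g') (place A Y z) =
      place A Y (TensorProduct.map (TensorProduct.map f (TensorProduct.map g f')) g' z) := by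
  induction z using TensorProduct.induction_on with
  | zero => simp only [map_zero]
  | add x y hx hy => simp only [map_add, hx, hy]
  | tmul z q =>
    induction z using TensorProduct.induction_on with
    | zero => simp only [map_zero, TensorProduct.zero_tmul]
    | add x y hx hy => simp only [map_add, hx, hy, TensorProduct.add_tmul]
    | tmul s x =>
      induction x using TensorProduct.induction_on with
      | zero => simp only [map_zero, TensorProduct.zero_tmul, TensorProduct.tmul_zero]
      | add x y hx hy =>
        simp only [map_add, hx, hy, TensorProduct.add_tmul, TensorProduct.tmul_add]
      | tmul a t => rfl

theorem tmul_mul_place (u : Y) (p : A) (t : Y) (q : A) (z : Y ⊗[k] (A ⊗[k] Y)) (q' : A) :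
    ((u ⊗ₜ[k] p) ⊗ₜ[k] (t ⊗ₜ[k] q)) * place A Y (z ⊗ₜ[k] q') =
      place A Y (TensorProduct.map (LinearMap.mulLeft k u) (TensorProduct.map
        (LinearMap.mulLeft k p) (LinearMap.mulLeft k t)) z ⊗ₜ[k] (q * q')) := by
  rw [← LinearMap.mulLeft_apply (R := k), mulLeft_tmul, mulLeft_tmul, mulLeft_tmul, map_place,
    TensorProduct.map_tmul, LinearMap.mulLeft_apply]

theorem place_mul_tmul (u : Y) (p : A) (t : Y) (q : A) (z : Y ⊗[k] (A ⊗[k] Y)) (q' : A) :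
    place A Y (z ⊗ₜ[k] q) * ((u ⊗ₜ[k] p) ⊗ₜ[k] (t ⊗ₜ[k] q')) =
      place A Y (TensorProduct.map (LinearMap.mulRight k u) (TensorProduct.map
        (LinearMap.mulRight k p) (LinearMap.mulRight k t)) z ⊗ₜ[k] (q * q')) := by
  rw [← LinearMap.mulRight_apply (R := k), mulRight_tmul, mulRight_tmul, mulRight_tmul, map_place,
    TensorProduct.map_tmul, LinearMap.mulRight_apply]

/-- The extension of an operator on `Y ⊗ (A ⊗ Y)` to `Y ⊗ A ⊗ Y ⊗ A`. -/
def placeOp (f : Y ⊗[k] (A ⊗[k] Y) →ₗ[k] Y ⊗[k] (A ⊗[k] Y)) :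
    (Y ⊗[k] A) ⊗[k] (Y ⊗[k] A) →ₗ[k] (Y ⊗[k] A) ⊗[k] (Y ⊗[k] A) :=
  (place A Y).toLinearMap ∘ₗ f.rTensor A ∘ₗ (place A Y).symm.toLinearMap

theorem placeOp_place (f : Y ⊗[k] (A ⊗[k] Y) →ₗ[k] Y ⊗[k] (A ⊗[k] Y)) (z : Y ⊗[k] (A ⊗[k] Y))
    (q : A) : placeOp f (place A Y (z ⊗ₜ[k] q)) = place A Y (f z ⊗ₜ[k] q) :=
  congrArg (fun w => place A Y (f.rTensor A w)) ((place A Y).symm_apply_apply _)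

theorem placeOp_add (f g : Y ⊗[k] (A ⊗[k] Y) →ₗ[k] Y ⊗[k] (A ⊗[k] Y)) :
    placeOp (f + g) = placeOp f + placeOp g := by
  rw [placeOp, LinearMap.rTensor_add, LinearMap.add_comp, LinearMap.comp_add]
  rfl

theorem placeOp_smul (c : k) (f : Y ⊗[k] (A ⊗[k] Y) →ₗ[k] Y ⊗[k] (A ⊗[k] Y)) :
    placeOp (c • f) = c • placeOp f := by
  rw [placeOp, LinearMap.rTensor_smul, LinearMap.smul_comp, LinearMap.comp_smul]
  rfl

theorem placeOp_comp (f g : Y ⊗[k] (A ⊗[k] Y) →ₗ[k] Y ⊗[k] (A ⊗[k] Y))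
    (x : (Y ⊗[k] A) ⊗[k] (Y ⊗[k] A)) : placeOp (f ∘ₗ g) x = placeOp f (placeOp g x) := by
  obtain ⟨x, rfl⟩ := (place A Y).surjective x
  induction x using TensorProduct.induction_on with
  | zero => simp only [map_zero]
  | add x y hx hy => simp only [map_add, hx, hy]
  | tmul z q => rw [placeOp_place, placeOp_place, placeOp_place, LinearMap.comp_apply]

/-- Induction on the elements of `Y ⊗ A ⊗ Y ⊗ A`. -/
theorem place_induction {P : (Y ⊗[k] A) ⊗[k] (Y ⊗[k] A) → Prop} (zero : P 0)
    (add : ∀ x y, P x → P y → P (x + y))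
    (tmul : ∀ y a y' a', P ((y ⊗ₜ[k] a) ⊗ₜ[k] (y' ⊗ₜ[k] a'))) (x : (Y ⊗[k] A) ⊗[k] (Y ⊗[k] A)) :
    P x := by
  induction x using TensorProduct.induction_on with
  | zero => exact zero
  | add x y hx hy => exact add x y hx hy
  | tmul b c =>
    induction b using TensorProduct.induction_on with
    | zero => rwa [TensorProduct.zero_tmul]
    | add x y hx hy => rw [TensorProduct.add_tmul]; exact add _ _ hx hy
    | tmul y a =>
      induction c using TensorProduct.induction_on with
      | zero => rwa [TensorProduct.tmul_zero]
      | add x y hx hy => rw [TensorProduct.tmul_add]; exact add _ _ hx hy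
      | tmul y' a' => exact tmul y a y' a'

/-- `(a ⊗ a') ⊗ (y ⊗ y') ↦ (y ⊗ a) ⊗ (y' ⊗ a')`. -/
def placeComm (A : Type*) [NonUnitalRing A] [Module k A] [SMulCommClass k A A]
    [IsScalarTower k A A] (Y : Type*) [NonUnitalRing Y] [Module k Y] [SMulCommClass k Y Y]
    [IsScalarTower k Y Y] : (A ⊗[k] A) ⊗[k] (Y ⊗[k] Y) ≃ₗ[k] (Y ⊗[k] A) ⊗[k] (Y ⊗[k] A) :=
  TensorProduct.comm k (A ⊗[k] A) (Y ⊗[k] Y) ≪≫ₗ TensorProduct.tensorTensorTensorComm k Y Y A A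

theorem placeComm_tmul (a a' : A) (y y' : Y) :
    placeComm A Y ((a ⊗ₜ[k] a') ⊗ₜ[k] (y ⊗ₜ[k] y')) = (y ⊗ₜ[k] a) ⊗ₜ[k] (y' ⊗ₜ[k] a') := rfl

theorem placeComm_mul_placeComm (w : A ⊗[k] A) (v : Y ⊗[k] Y) (w' : A ⊗[k] A) (v' : Y ⊗[k] Y) :
    placeComm A Y (w ⊗ₜ[k] v) * placeComm A Y (w' ⊗ₜ[k] v') =
      placeComm A Y ((w * w') ⊗ₜ[k] (v * v')) := by
  induction w using TensorProduct.induction_on with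
  | zero => simp only [TensorProduct.zero_tmul, map_zero, zero_mul]
  | add x x' h₁ h₂ => simp only [TensorProduct.add_tmul, map_add, add_mul, h₁, h₂]
  | tmul b d =>
    induction w' using TensorProduct.induction_on with
    | zero => simp only [TensorProduct.zero_tmul, map_zero, mul_zero]
    | add x x' h₁ h₂ => simp only [TensorProduct.add_tmul, map_add, mul_add, h₁, h₂]
    | tmul b' d' =>
      induction v using TensorProduct.induction_on with
      | zero => simp only [TensorProduct.tmul_zero, map_zero, zero_mul]
      | add x x' h₁ h₂ => simp only [TensorProduct.tmul_add, map_add, add_mul, h₁, h₂]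
      | tmul f g =>
        induction v' using TensorProduct.induction_on with
        | zero => simp only [TensorProduct.tmul_zero, map_zero, mul_zero]
        | add x x' h₁ h₂ => simp only [TensorProduct.tmul_add, map_add, mul_add, h₁, h₂]
        | tmul f' g' =>
          simp only [placeComm_tmul, Algebra.TensorProduct.tmul_mul_tmul]

/-- `p ↦ (ι ⊗ T(· ⊗ p))v`. -/
def slotT (ρ : Y →ₗ[k] M k (A ⊗[k] Y)) : Y ⊗[k] Y →ₗ[k] A →ₗ[k] Y ⊗[k] (A ⊗[k] Y) :=
  (LinearMap.lTensorHom Y ∘ₗ (coactT ρ).flip).flip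

theorem slotT_apply (ρ : Y →ₗ[k] M k (A ⊗[k] Y)) (v : Y ⊗[k] Y) (p : A) :
    slotT ρ v p = ((coactT ρ).flip p).lTensor Y v := rfl

theorem middleT_eq (ρ : Y →ₗ[k] M k (A ⊗[k] Y)) (v : Y ⊗[k] Y) (w : A ⊗[k] A) :
    middleT ρ (v ⊗ₜ[k] w) = place A Y ((slotT ρ v).rTensor A w) := by
  induction v using TensorProduct.induction_on with
  | zero => simp only [map_zero, TensorProduct.zero_tmul, LinearMap.rTensor_zero,
      LinearMap.zero_apply]
  | add x y hx hy => simp only [map_add, hx, hy, TensorProduct.add_tmul, LinearMap.rTensor_add,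
      LinearMap.add_apply]
  | tmul s t =>
    induction w using TensorProduct.induction_on with
    | zero => simp only [map_zero, TensorProduct.tmul_zero]
    | add x y hx hy => simp only [map_add, hx, hy, TensorProduct.tmul_add]
    | tmul p q => rfl

end Place

/-! ### The smash coproduct -/

namespace IsSmashDatum

variable {k : Type*} [Field k]
variable {A : Type*} [NonUnitalRing A] [Module k A] [SMulCommClass k A A] [IsScalarTower k A A]
variable {Y : Type*} [NonUnitalRing Y] [Module k Y] [SMulCommClass k Y Y] [IsScalarTower k Y Y]
variable {ΔA : A →ₗ[k] M k (A ⊗[k] A)} {ΔY : Y →ₗ[k] M k (Y ⊗[k] Y)}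
variable {ρ : Y →ₗ[k] M k (A ⊗[k] Y)} {E : M k (A ⊗[k] Y)} (S : IsSmashDatum ΔA ΔY ρ E)

/-- `p ↦ (ι ⊗ ρ)Δ_Y(y) · (y' ⊗ p ⊗ y'')`. -/
def slotL (ΔY : Y →ₗ[k] M k (Y ⊗[k] Y)) (ρ : Y →ₗ[k] M k (A ⊗[k] Y)) (y y' y'' : Y) :
    A →ₗ[k] Y ⊗[k] (A ⊗[k] Y) :=
  comulActLeft ΔY ρ y ∘ₗ TensorProduct.mk k Y (A ⊗[k] Y) y' ∘ₗ (TensorProduct.mk k A Y).flip y''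

/-- `p ↦ (y' ⊗ p ⊗ y'') · (ι ⊗ ρ)Δ_Y(y)`. -/
def slotR (ΔY : Y →ₗ[k] M k (Y ⊗[k] Y)) (ρ : Y →ₗ[k] M k (A ⊗[k] Y)) (y y' y'' : Y) :
    A →ₗ[k] Y ⊗[k] (A ⊗[k] Y) :=
  comulActRight ΔY ρ y ∘ₗ TensorProduct.mk k Y (A ⊗[k] Y) y' ∘ₗ (TensorProduct.mk k A Y).flip y''

theorem slotL_apply (y y' y'' : Y) (p : A) :
    slotL ΔY ρ y y' y'' p = (actL ρ (p ⊗ₜ[k] y'')).lTensor Y (canonThree ΔY y y') := rfl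

theorem slotR_apply (y y' y'' : Y) (p : A) :
    slotR ΔY ρ y y' y'' p = (actR ρ (p ⊗ₜ[k] y'')).lTensor Y (canonTwo ΔY y' y) := rfl

theorem actL_actR_compat (p p' : A) (t t' : Y) :
    TensorProduct.map (LinearMap.mulLeft k p) (LinearMap.mulLeft k t) ∘ₗ actL ρ (p' ⊗ₜ[k] t') =
      TensorProduct.map (LinearMap.mulRight k p') (LinearMap.mulRight k t') ∘ₗ
        actR ρ (p ⊗ₜ[k] t) := by
  rw [← mulLeft_tmul, ← mulRight_tmul]
  exact LinearMap.ext fun s => M.compat (ρ s) (p ⊗ₜ[k] t) (p' ⊗ₜ[k] t')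

theorem slot_compat (h : IsPreMultiplierBialgebra ΔY) (y u u' : Y) (p p' : A) (t t' : Y) :
    TensorProduct.map (LinearMap.mulLeft k u) (TensorProduct.map (LinearMap.mulLeft k p)
      (LinearMap.mulLeft k t)) (slotL ΔY ρ y u' t' p') =
    TensorProduct.map (LinearMap.mulRight k u') (TensorProduct.map (LinearMap.mulRight k p')
      (LinearMap.mulRight k t')) (slotR ΔY ρ y u t p) := by
  rw [map_eq_lTensor_rTensor, map_eq_lTensor_rTensor, slotL_apply, slotR_apply, rTensor_lTensor_comm, rTensor_lTensor_comm,
    lTensor_lTensor, lTensor_lTensor, actL_actR_compat, h.mulLeft_three_eq_mulRight_two]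

/-- `(ι ⊗ ρ)Δ_Y(y) ⊗ 1`, as a multiplier of `Y ⊗ A ⊗ Y ⊗ A`. -/
def coactFactor : Y →ₗ[k] M k ((Y ⊗[k] A) ⊗[k] (Y ⊗[k] A)) :=
  M.mkLin
    { toFun := fun y => placeOp (comulActLeft ΔY ρ y)
      map_add' := fun y z => by rw [map_add, placeOp_add]
      map_smul' := fun c y => by rw [map_smul, placeOp_smul, RingHom.id_apply] }
    { toFun := fun y => placeOp (comulActRight ΔY ρ y)
      map_add' := fun y z => by rw [map_add, placeOp_add]
      map_smul' := fun c y => by rw [map_smul, placeOp_smul, RingHom.id_apply] }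
    (fun y a b => by
      refine place_induction (P := fun a => a * placeOp (comulActLeft ΔY ρ y) b =
        placeOp (comulActRight ΔY ρ y) a * b) ?_ ?_ ?_ a
      · rw [zero_mul, map_zero, zero_mul]
      · intro a a' h₁ h₂
        rw [add_mul, map_add, add_mul, h₁, h₂]
      intro u p t q
      refine place_induction (P := fun b =>
        ((u ⊗ₜ[k] p) ⊗ₜ[k] (t ⊗ₜ[k] q)) * placeOp (comulActLeft ΔY ρ y) b =
        placeOp (comulActRight ΔY ρ y) ((u ⊗ₜ[k] p) ⊗ₜ[k] (t ⊗ₜ[k] q)) * b) ?_ ?_ ?_ b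
      · rw [mul_zero, map_zero, mul_zero]
      · intro a a' h₁ h₂
        rw [mul_add, map_add, mul_add, h₁, h₂]
      intro u' p' t' q'
      rw [← place_tmul u', ← place_tmul u p, placeOp_place, placeOp_place, place_tmul, place_tmul,
        tmul_mul_place, place_mul_tmul]
      congr 2
      exact slot_compat S.pre_right y u u' p p' t t')

/-- `Δ_A(a)` in the factors `A`, as a multiplier of `Y ⊗ A ⊗ Y ⊗ A`. -/
def comulFactor (Y : Type*) [NonUnitalRing Y] [Module k Y] [SMulCommClass k Y Y]
    [IsScalarTower k Y Y] (ΔA : A →ₗ[k] M k (A ⊗[k] A)) :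
    A →ₗ[k] M k ((Y ⊗[k] A) ⊗[k] (Y ⊗[k] A)) :=
  M.legOne (placeComm A Y) placeComm_mul_placeComm ∘ₗ ΔA

/-- The comultiplication of the smash coproduct. -/
def smashComul : Y ⊗[k] A →ₗ[k] M k ((Y ⊗[k] A) ⊗[k] (Y ⊗[k] A)) :=
  mulMap S.coactFactor (comulFactor Y ΔA)

include S

theorem nondeg_tensor : Nondegenerate (Y ⊗[k] A) := S.nondeg_right.tensor S.nondeg_left

theorem nondeg_tensor₂ : Nondegenerate ((Y ⊗[k] A) ⊗[k] (Y ⊗[k] A)) :=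
  S.nondeg_tensor.tensor S.nondeg_tensor

theorem slotL_eq (y y' y'' : Y) (p : A) :
    slotL ΔY ρ y y' y'' p =
      ((LinearMap.mulRight k y'').lTensor A).lTensor Y (slotT ρ (canonThree ΔY y y') p) := by
  rw [slotL_apply, S.actL_tmul, slotT_apply, lTensor_lTensor]

theorem slotR_eq (y y' y'' : Y) (p : A) :
    slotR ΔY ρ y y' y'' p =
      ((LinearMap.mulLeft k y'').lTensor A).lTensor Y (slotT ρ (canonTwo ΔY y' y) p) := by
  rw [slotR_apply, S.actR_tmul, slotT_apply, lTensor_lTensor]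

theorem slotT_mul (v : Y ⊗[k] Y) (p a : A) :
    slotT ρ v (p * a) = ((LinearMap.mulRight k a).rTensor Y).lTensor Y (slotT ρ v p) := by
  rw [slotT_apply, slotT_apply, lTensor_lTensor]
  congr 2
  exact LinearMap.ext fun t => S.coactT_mul t p a

/-- Commutativity of `A` makes the two actions of `Δ_A(a)` agree, and a multiplier with equal
actions is central. -/
theorem comulFactor_central (a : A) (m : M k ((Y ⊗[k] A) ⊗[k] (Y ⊗[k] A))) :
    comulFactor Y ΔA a * m = m * comulFactor Y ΔA a := by
  refine M.central S.nondeg_tensor₂ (fun x => ?_) m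
  have e : (ΔA a).left = (ΔA a).right := LinearMap.ext
    (M.left_eq_right_of_comm (S.nondeg_left.tensor S.nondeg_left) (tensor_mul_comm S.comm S.comm) _)
  change placeComm A Y ((ΔA a).left.rTensor _ _) = placeComm A Y ((ΔA a).right.rTensor _ _)
  rw [e]

theorem coactFactor_left (y u : Y) (p : A) (t : Y) (q : A) :
    (S.coactFactor y).left ((u ⊗ₜ[k] p) ⊗ₜ[k] (t ⊗ₜ[k] q)) =
      place A Y (slotL ΔY ρ y u t p ⊗ₜ[k] q) :=
  placeOp_place (comulActLeft ΔY ρ y) (u ⊗ₜ[k] (p ⊗ₜ[k] t)) q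

theorem coactFactor_right (y u : Y) (p : A) (t : Y) (q : A) :
    (S.coactFactor y).right ((u ⊗ₜ[k] p) ⊗ₜ[k] (t ⊗ₜ[k] q)) =
      place A Y (slotR ΔY ρ y u t p ⊗ₜ[k] q) :=
  placeOp_place (comulActRight ΔY ρ y) (u ⊗ₜ[k] (p ⊗ₜ[k] t)) q

theorem coactFactor_mul (y z : Y) :
    S.coactFactor (y * z) = S.coactFactor y * S.coactFactor z := by
  have e : comulActLeft ΔY ρ (y * z) = comulActLeft ΔY ρ y ∘ₗ comulActLeft ΔY ρ z :=
    LinearMap.ext fun w => congrArg (fun m : M k (Y ⊗[k] (A ⊗[k] Y)) => m.left w)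
      (comulAct_mul S.pre_right (S.nondeg_left.tensor S.nondeg_right)
        S.bialgebra.algebra.map_mul y z)
  refine M.ext_left S.nondeg_tensor₂ fun x => ?_
  change placeOp (comulActLeft ΔY ρ (y * z)) x =
    placeOp (comulActLeft ΔY ρ y) (placeOp (comulActLeft ΔY ρ z) x)
  rw [e, placeOp_comp]

theorem smashComul_left (y : Y) (a : A) (y' : Y) (a' : A) (y'' : Y) (a'' : A) :
    (S.smashComul (y ⊗ₜ[k] a)).left ((y' ⊗ₜ[k] a') ⊗ₜ[k] (y'' ⊗ₜ[k] a'')) =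
      place A Y ((slotL ΔY ρ y y' y'').rTensor A ((ΔA a).left (a' ⊗ₜ[k] a''))) := by
  change (S.coactFactor y).left ((comulFactor Y ΔA a).left (placeComm A Y
    ((a' ⊗ₜ[k] a'') ⊗ₜ[k] (y' ⊗ₜ[k] y'')))) = _
  rw [comulFactor, LinearMap.comp_apply, M.legOne_left, LinearMap.rTensor_tmul]
  generalize (ΔA a).left (a' ⊗ₜ[k] a'') = w
  induction w using TensorProduct.induction_on with
  | zero => simp only [map_zero, TensorProduct.zero_tmul]
  | add x y hx hy => simp only [map_add, TensorProduct.add_tmul, hx, hy]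
  | tmul p q => exact S.coactFactor_left y y' p y'' q

theorem smashComul_right (y : Y) (a : A) (y' : Y) (a' : A) (y'' : Y) (a'' : A) :
    (S.smashComul (y ⊗ₜ[k] a)).right ((y' ⊗ₜ[k] a') ⊗ₜ[k] (y'' ⊗ₜ[k] a'')) =
      place A Y ((slotR ΔY ρ y y' y'').rTensor A ((ΔA a).right (a' ⊗ₜ[k] a''))) := by
  rw [smashComul, mulMap_tmul, ← S.comulFactor_central]
  change (S.coactFactor y).right ((comulFactor Y ΔA a).right (placeComm A Y
    ((a' ⊗ₜ[k] a'') ⊗ₜ[k] (y' ⊗ₜ[k] y'')))) = _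
  rw [comulFactor, LinearMap.comp_apply, M.legOne_right, LinearMap.rTensor_tmul]
  generalize (ΔA a).right (a' ⊗ₜ[k] a'') = w
  induction w using TensorProduct.induction_on with
  | zero => simp only [map_zero, TensorProduct.zero_tmul]
  | add x y hx hy => simp only [map_add, TensorProduct.add_tmul, hx, hy]
  | tmul p q => exact S.coactFactor_right y y' p y'' q

/-- A product of two homomorphisms is a homomorphism when their values commute, which centrality of
the `Δ_A` factor provides. -/
theorem smashComul_map_mul (b c : Y ⊗[k] A) :
    S.smashComul (b * c) = S.smashComul b * S.smashComul c := by
  refine mulMap_mul _ _ (fun y z => ?_) (fun a a' => ?_) (fun y a => S.comulFactor_central a _) b c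
  · exact S.coactFactor_mul y z
  · rw [comulFactor, LinearMap.comp_apply, S.pre_left.map_mul, M.legOne_mul]
    rfl

theorem isSmashComul : IsSmashComul ΔA ΔY ρ S.smashComul := by
  intro y y' y'' a a' a''
  constructor
  · rw [S.smashComul_left, middleT_eq, S.pre_left.left_one]
    generalize canonOne ΔA a a'' = w
    refine Eq.trans ?_ (map_place (LinearMap.id) (LinearMap.mulRight k a')
      (LinearMap.mulRight k y'') LinearMap.id _).symm
    congr 1
    induction w using TensorProduct.induction_on with
    | zero => simp only [map_zero]
    | add x y hx hy => simp only [map_add, hx, hy]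
    | tmul p q =>
      rw [LinearMap.rTensor_tmul, LinearMap.rTensor_tmul, LinearMap.rTensor_tmul,
        TensorProduct.map_tmul, LinearMap.id_apply, LinearMap.mulRight_apply, S.slotL_eq,
        S.slotT_mul, lTensor_lTensor, LinearMap.lTensor_comp_rTensor]
      rfl
  · rw [smashComul, mulMap_tmul, smashTwo]
    have e : (S.coactFactor y * comulFactor Y ΔA a).right
        ((y' ⊗ₜ[k] a') ⊗ₜ[k] (y'' ⊗ₜ[k] a'')) =
          (comulFactor Y ΔA a).right (place A Y (slotR ΔY ρ y y' y'' a' ⊗ₜ[k] a'')) :=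
      congrArg (comulFactor Y ΔA a).right (S.coactFactor_right y y' a' y'' a'')
    rw [e]
    rw [S.slotR_eq]
    generalize canonTwo ΔY y' y = v
    induction v using TensorProduct.induction_on with
    | zero => simp only [map_zero, LinearMap.zero_apply, TensorProduct.zero_tmul]
    | add x y hx hy =>
      simp only [map_add, LinearMap.add_apply, TensorProduct.add_tmul, hx, hy]
    | tmul s t =>
      rw [slotT_apply, LinearMap.lTensor_tmul, LinearMap.lTensor_tmul, LinearMap.lTensor_tmul,
        LinearMap.comp_apply, LinearMap.comp_apply, LinearMap.comp_apply,
        IsSymmetricPartialComoduleBialgebra.coactTbar_eq S.nondeg_left S.nondeg_right S.comm, LinearMap.flip_apply]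
      generalize coactT ρ t a' = u
      induction u using TensorProduct.induction_on with
      | zero => simp only [map_zero, TensorProduct.tmul_zero, TensorProduct.zero_tmul]
      | add x y hx hy =>
        simp only [map_add, TensorProduct.add_tmul, TensorProduct.tmul_add, hx, hy]
      | tmul α β =>
        change (comulFactor Y ΔA a).right (placeComm A Y
          ((α ⊗ₜ[k] a'') ⊗ₜ[k] (s ⊗ₜ[k] (y'' * β)))) = _
        rw [comulFactor, LinearMap.comp_apply, M.legOne_right, LinearMap.rTensor_tmul,
          S.pre_left.right_two, LinearMap.rTensor_tmul, LinearMap.flip_apply]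
        generalize canonTwo ΔA α a = w
        induction w using TensorProduct.induction_on with
        | zero => simp only [map_zero, TensorProduct.tmul_zero, TensorProduct.zero_tmul]
        | add x y hx hy =>
          simp only [map_add, TensorProduct.add_tmul, TensorProduct.tmul_add, hx, hy]
        | tmul p q =>
          change (s ⊗ₜ[k] p) ⊗ₜ[k] ((y'' * β) ⊗ₜ[k] (a'' * q)) =
            (s ⊗ₜ[k] p) ⊗ₜ[k] ((y'' ⊗ₜ[k] a'') * (β ⊗ₜ[k] q))
          rw [Algebra.TensorProduct.tmul_mul_tmul]

end IsSmashDatum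

/-! ### The canonical maps of the smash coproduct -/

section PlaceLegs

variable {k : Type*} [Field k]
variable {A : Type*} [NonUnitalRing A] [Module k A] [SMulCommClass k A A] [IsScalarTower k A A]
variable {Y : Type*} [NonUnitalRing Y] [Module k Y] [SMulCommClass k Y Y] [IsScalarTower k Y Y]

theorem rTensor_map_place (f : Y →ₗ[k] Y) (g : A →ₗ[k] A) (z : Y ⊗[k] (A ⊗[k] Y)) (q : A) :
    (TensorProduct.map f g).rTensor (Y ⊗[k] A) (place A Y (z ⊗ₜ[k] q)) =
      place A Y (f.rTensor (A ⊗[k] Y) ((g.rTensor Y).lTensor Y z) ⊗ₜ[k] q) := by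
  have e := map_place f g LinearMap.id LinearMap.id (z ⊗ₜ[k] q)
  rw [TensorProduct.map_id, TensorProduct.map_tmul, LinearMap.id_apply, map_eq_lTensor_rTensor f,
    ← rTensor_lTensor_comm] at e
  exact e

theorem lTensor_map_place (f : Y →ₗ[k] Y) (g : A →ₗ[k] A) (z : Y ⊗[k] (A ⊗[k] Y)) (q : A) :
    (TensorProduct.map f g).lTensor (Y ⊗[k] A) (place A Y (z ⊗ₜ[k] q)) =
      place A Y ((f.lTensor A).lTensor Y z ⊗ₜ[k] g q) := by
  have e := map_place LinearMap.id LinearMap.id f g (z ⊗ₜ[k] q)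
  rw [TensorProduct.map_id, TensorProduct.map_tmul] at e
  exact e

theorem mul_mem_range_emb {U V : Type*} [AddCommGroup U] [Module k U] [AddCommGroup V]
    [Module k V] (φ ψ : U ⊗[k] V →ₗ[k] M k A)
    (h : ∀ u v u' v', φ (u ⊗ₜ[k] v) * ψ (u' ⊗ₜ[k] v') ∈
      LinearMap.range (emb (k := k) (B := A))) (b c : U ⊗[k] V) :
    φ b * ψ c ∈ LinearMap.range (emb (k := k) (B := A)) := by
  induction b using TensorProduct.induction_on with
  | zero => rw [map_zero, zero_mul]; exact Submodule.zero_mem _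
  | add x y hx hy => rw [map_add, add_mul]; exact Submodule.add_mem _ hx hy
  | tmul u v =>
    induction c using TensorProduct.induction_on with
    | zero => rw [map_zero, mul_zero]; exact Submodule.zero_mem _
    | add x y hx hy => rw [map_add, mul_add]; exact Submodule.add_mem _ hx hy
    | tmul u' v' => exact h u v u' v'

/-- `b ↦ b ⊗ 1`. -/
def embOne (A Y : Type*) [NonUnitalRing A] [Module k A] [SMulCommClass k A A]
    [IsScalarTower k A A] [NonUnitalRing Y] [Module k Y] [SMulCommClass k Y Y]
    [IsScalarTower k Y Y] : A →ₗ[k] M k (A ⊗[k] Y) := tensLin.flip 1 ∘ₗ emb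

theorem embOne_apply (a : A) : embOne A Y a = tensLin (emb (k := k) a) 1 := rfl

/-- `b ↦ 1 ⊗ b`. -/
def oneEmb (A Y : Type*) [NonUnitalRing A] [Module k A] [SMulCommClass k A A]
    [IsScalarTower k A A] [NonUnitalRing Y] [Module k Y] [SMulCommClass k Y Y]
    [IsScalarTower k Y Y] : Y →ₗ[k] M k (A ⊗[k] Y) := tensLin 1 ∘ₗ emb

theorem oneEmb_apply (y : Y) : oneEmb A Y y = tensLin 1 (emb (k := k) y) := rfl

end PlaceLegs

namespace IsSmashDatum

variable {k : Type*} [Field k]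
variable {A : Type*} [NonUnitalRing A] [Module k A] [SMulCommClass k A A] [IsScalarTower k A A]
variable {Y : Type*} [NonUnitalRing Y] [Module k Y] [SMulCommClass k Y Y] [IsScalarTower k Y Y]
variable {ΔA : A →ₗ[k] M k (A ⊗[k] A)} {ΔY : Y →ₗ[k] M k (Y ⊗[k] Y)}
variable {ρ : Y →ₗ[k] M k (A ⊗[k] Y)} {E : M k (A ⊗[k] Y)} (S : IsSmashDatum ΔA ΔY ρ E)

/-- `p ↦ y₍₁₎ ⊗ ρ(y₍₂₎)(p ⊗ y'')`. -/
def slotOne (y y'' : Y) : A →ₗ[k] Y ⊗[k] (A ⊗[k] Y) :=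
  S.covR y ∘ₗ (TensorProduct.mk k A Y).flip y''

/-- `p ↦ y₍₁₎ ⊗ (p ⊗ y'')ρ(y₍₂₎)`. -/
def slotFour (y'' y : Y) : A →ₗ[k] Y ⊗[k] (A ⊗[k] Y) :=
  S.covL.flip y ∘ₗ (TensorProduct.mk k A Y).flip y''

include S

theorem covR_mul (y : Y) (p a : A) (w : Y) :
    S.covR y ((p * a) ⊗ₜ[k] w) =
      ((LinearMap.mulRight k a).rTensor Y).lTensor Y (S.covR y (p ⊗ₜ[k] w)) := by
  have e : LinearMap.mulRight k a = (emb a).left := LinearMap.ext fun x => S.comm x a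
  rw [e]
  refine Eq.trans ?_ (coverR_map _ _ _ ((emb a).left.rTensor Y) (p ⊗ₜ[k] w) (fun t =>
    left_tensLin_one S.nondeg_left S.nondeg_right S.comm (ρ t) (emb a) _) y)
  rw [LinearMap.rTensor_tmul, emb_left, S.comm]
  rfl

theorem covL_mul (y : Y) (p a : A) (w : Y) :
    S.covL ((a * p) ⊗ₜ[k] w) y =
      ((LinearMap.mulLeft k a).rTensor Y).lTensor Y (S.covL (p ⊗ₜ[k] w) y) := by
  refine Eq.trans ?_ (coverL_map _ _ _ ((emb a).left.rTensor Y) (p ⊗ₜ[k] w) (fun t =>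
    right_tensLin_one S.nondeg_left S.nondeg_right S.comm (ρ t) (emb a) _) y)
  rfl

/-- With only the last two legs covered, the leg `y₍₁₎` is free, so the slot must be filled by the
cover `covR`. When the first two legs are covered, as in the second and third canonical maps, `T`
alone suffices. -/
theorem smashComul_mul_one (y : Y) (a : A) (y'' : Y) (a'' : A) :
    S.smashComul (y ⊗ₜ[k] a) * tensLin 1 (emb (y'' ⊗ₜ[k] a'')) =
      emb (place A Y ((S.slotOne y y'').rTensor A (canonOne ΔA a a''))) := by
  refine mul_tens_one_emb_eq S.nondeg_tensor S.nondeg_tensor fun b => ?_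
  induction b using TensorProduct.induction_on with
  | zero => rw [TensorProduct.zero_tmul, map_zero, LinearMap.mulRight_zero_eq_zero,
      LinearMap.rTensor_zero, LinearMap.zero_apply]
  | add b c hb hc =>
    have e : LinearMap.mulRight k (b + c) = LinearMap.mulRight k b + LinearMap.mulRight k c :=
      LinearMap.ext fun x => mul_add x b c
    rw [TensorProduct.add_tmul, map_add, hb, hc, e, LinearMap.rTensor_add, LinearMap.add_apply]
  | tmul y' a' =>
    rw [S.smashComul_left, S.pre_left.left_one, mulRight_tmul]
    generalize canonOne ΔA a a'' = w
    induction w using TensorProduct.induction_on with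
    | zero => simp only [map_zero]
    | add x y hx hy => simp only [map_add, hx, hy]
    | tmul p q =>
      rw [LinearMap.rTensor_tmul, LinearMap.rTensor_tmul, LinearMap.rTensor_tmul,
        rTensor_map_place]
      congr 2
      change _ = (LinearMap.mulRight k y').rTensor _ (((LinearMap.mulRight k a').rTensor Y).lTensor Y
        (S.covR y (p ⊗ₜ[k] y'')))
      rw [← S.covR_mul, slotL_apply, covR, mulRight_coverR]
      rfl

theorem smashComul_mul_three (y : Y) (a : A) (y' : Y) (a' : A) :
    S.smashComul (y ⊗ₜ[k] a) * tensLin (emb (y' ⊗ₜ[k] a')) 1 =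
      emb (place A Y ((slotT ρ (canonThree ΔY y y')).rTensor A (canonThree ΔA a a'))) := by
  refine mul_tens_emb_one_eq S.nondeg_tensor S.nondeg_tensor fun b => ?_
  induction b using TensorProduct.induction_on with
  | zero => rw [TensorProduct.tmul_zero, map_zero, LinearMap.mulRight_zero_eq_zero,
      LinearMap.lTensor_zero, LinearMap.zero_apply]
  | add b c hb hc =>
    have e : LinearMap.mulRight k (b + c) = LinearMap.mulRight k b + LinearMap.mulRight k c :=
      LinearMap.ext fun x => mul_add x b c
    rw [TensorProduct.tmul_add, map_add, hb, hc, e, LinearMap.lTensor_add, LinearMap.add_apply]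
  | tmul y'' a'' =>
    rw [S.smashComul_left, S.pre_left.left_three, mulRight_tmul]
    generalize canonThree ΔA a a' = w
    induction w using TensorProduct.induction_on with
    | zero => simp only [map_zero]
    | add x y hx hy => simp only [map_add, hx, hy]
    | tmul p q =>
      rw [LinearMap.lTensor_tmul, LinearMap.rTensor_tmul, LinearMap.rTensor_tmul,
        lTensor_map_place, S.slotL_eq]

theorem smashComul_two_mul (y' : Y) (a' : A) (y : Y) (a : A) :
    tensLin (emb (y' ⊗ₜ[k] a')) 1 * S.smashComul (y ⊗ₜ[k] a) =
      emb (place A Y ((slotT ρ (canonTwo ΔY y' y)).rTensor A (canonTwo ΔA a' a))) := by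
  refine tens_emb_one_mul_eq S.nondeg_tensor S.nondeg_tensor fun b => ?_
  induction b using TensorProduct.induction_on with
  | zero => rw [TensorProduct.tmul_zero, map_zero, LinearMap.mulLeft_zero_eq_zero,
      LinearMap.lTensor_zero, LinearMap.zero_apply]
  | add b c hb hc =>
    have e : LinearMap.mulLeft k (b + c) = LinearMap.mulLeft k b + LinearMap.mulLeft k c :=
      LinearMap.ext fun x => add_mul b c x
    rw [TensorProduct.tmul_add, map_add, hb, hc, e, LinearMap.lTensor_add, LinearMap.add_apply]
  | tmul y'' a'' =>
    rw [S.smashComul_right, S.pre_left.right_two, mulLeft_tmul]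
    generalize canonTwo ΔA a' a = w
    induction w using TensorProduct.induction_on with
    | zero => simp only [map_zero]
    | add x y hx hy => simp only [map_add, hx, hy]
    | tmul p q =>
      rw [LinearMap.lTensor_tmul, LinearMap.rTensor_tmul, LinearMap.rTensor_tmul,
        lTensor_map_place, S.slotR_eq]

theorem smashComul_four_mul (y'' : Y) (a'' : A) (y : Y) (a : A) :
    tensLin 1 (emb (y'' ⊗ₜ[k] a'')) * S.smashComul (y ⊗ₜ[k] a) =
      emb (place A Y ((S.slotFour y'' y).rTensor A (canonFour ΔA a'' a))) := by
  refine tens_one_emb_mul_eq S.nondeg_tensor S.nondeg_tensor fun b => ?_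
  induction b using TensorProduct.induction_on with
  | zero => rw [TensorProduct.zero_tmul, map_zero, LinearMap.mulLeft_zero_eq_zero,
      LinearMap.rTensor_zero, LinearMap.zero_apply]
  | add b c hb hc =>
    have e : LinearMap.mulLeft k (b + c) = LinearMap.mulLeft k b + LinearMap.mulLeft k c :=
      LinearMap.ext fun x => add_mul b c x
    rw [TensorProduct.add_tmul, map_add, hb, hc, e, LinearMap.rTensor_add, LinearMap.add_apply]
  | tmul y' a' =>
    rw [S.smashComul_right, S.pre_left.right_four, mulLeft_tmul]
    generalize canonFour ΔA a'' a = w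
    induction w using TensorProduct.induction_on with
    | zero => simp only [map_zero]
    | add x y hx hy => simp only [map_add, hx, hy]
    | tmul p q =>
      rw [LinearMap.rTensor_tmul, LinearMap.rTensor_tmul, LinearMap.rTensor_tmul,
        rTensor_map_place]
      congr 2
      change _ = (LinearMap.mulLeft k y').rTensor _ (((LinearMap.mulLeft k a').rTensor Y).lTensor Y
        (S.covL (p ⊗ₜ[k] y'') y))
      rw [← S.covL_mul, slotR_apply, covL, mulLeft_coverL]
      rfl

theorem canonOne_smashComul (y : Y) (a : A) (y'' : Y) (a'' : A) :
    canonOne S.smashComul (y ⊗ₜ[k] a) (y'' ⊗ₜ[k] a'') =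
      place A Y ((S.slotOne y y'').rTensor A (canonOne ΔA a a'')) :=
  (congrArg pull (S.smashComul_mul_one y a y'' a'')).trans (pull_emb S.nondeg_tensor₂ _)

theorem canonTwo_smashComul (y' : Y) (a' : A) (y : Y) (a : A) :
    canonTwo S.smashComul (y' ⊗ₜ[k] a') (y ⊗ₜ[k] a) =
      place A Y ((slotT ρ (canonTwo ΔY y' y)).rTensor A (canonTwo ΔA a' a)) :=
  (congrArg pull (S.smashComul_two_mul y' a' y a)).trans (pull_emb S.nondeg_tensor₂ _)

theorem smashComul_mem_one (b c : Y ⊗[k] A) : S.smashComul b * tensLin 1 (emb c) ∈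
    LinearMap.range (emb (k := k) (B := (Y ⊗[k] A) ⊗[k] (Y ⊗[k] A))) := by
  rw [← oneEmb_apply]
  refine mul_mem_range_emb S.smashComul (oneEmb (Y ⊗[k] A) (Y ⊗[k] A))
    (fun y a y' a' => ?_) b c
  rw [oneEmb_apply, S.smashComul_mul_one]
  exact LinearMap.mem_range_self _ _

theorem smashComul_mem_two (b c : Y ⊗[k] A) : tensLin (emb b) 1 * S.smashComul c ∈
    LinearMap.range (emb (k := k) (B := (Y ⊗[k] A) ⊗[k] (Y ⊗[k] A))) := by
  rw [← embOne_apply]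
  refine mul_mem_range_emb (embOne (Y ⊗[k] A) (Y ⊗[k] A)) S.smashComul
    (fun y a y' a' => ?_) b c
  rw [embOne_apply, S.smashComul_two_mul]
  exact LinearMap.mem_range_self _ _

theorem smashComul_mem_three (b c : Y ⊗[k] A) : S.smashComul b * tensLin (emb c) 1 ∈
    LinearMap.range (emb (k := k) (B := (Y ⊗[k] A) ⊗[k] (Y ⊗[k] A))) := by
  rw [← embOne_apply]
  refine mul_mem_range_emb S.smashComul (embOne (Y ⊗[k] A) (Y ⊗[k] A))
    (fun y a y' a' => ?_) b c
  rw [embOne_apply, S.smashComul_mul_three]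
  exact LinearMap.mem_range_self _ _

theorem smashComul_mem_four (b c : Y ⊗[k] A) : tensLin 1 (emb b) * S.smashComul c ∈
    LinearMap.range (emb (k := k) (B := (Y ⊗[k] A) ⊗[k] (Y ⊗[k] A))) := by
  rw [← oneEmb_apply]
  refine mul_mem_range_emb (oneEmb (Y ⊗[k] A) (Y ⊗[k] A)) S.smashComul
    (fun y a y' a' => ?_) b c
  rw [oneEmb_apply, S.smashComul_four_mul]
  exact LinearMap.mem_range_self _ _

theorem isPreMultiplierBialgebra_smashComul (hco : ∀ b c d : Y ⊗[k] A,
    TensorProduct.assoc k (Y ⊗[k] A) (Y ⊗[k] A) (Y ⊗[k] A)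
      ((canonTwo S.smashComul b).rTensor (Y ⊗[k] A) (canonOne S.smashComul c d)) =
      ((canonOne S.smashComul).flip d).lTensor (Y ⊗[k] A) (canonTwo S.smashComul b c)) :
    IsPreMultiplierBialgebra S.smashComul where
  nondegenerate := S.nondeg_tensor
  map_mul := S.smashComul_map_mul
  mem_one := S.smashComul_mem_one
  mem_two := S.smashComul_mem_two
  mem_three := S.smashComul_mem_three
  mem_four := S.smashComul_mem_four
  coassoc := hco

end IsSmashDatum

/-! ### Coassociativity of the smash coproduct -/

section Legs

variable {k : Type*} [Field k]
variable {U V W R X Z : Type*} [AddCommGroup U] [Module k U] [AddCommGroup V] [Module k V]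
variable [AddCommGroup W] [Module k W] [AddCommGroup R] [Module k R] [AddCommGroup X] [Module k X]
variable [AddCommGroup Z] [Module k Z]

theorem assoc_rTensor (f : U →ₗ[k] W ⊗[k] R) (g : X →ₗ[k] Z) (x : U ⊗[k] X) :
    TensorProduct.assoc k W R Z (f.rTensor Z (g.lTensor U x)) =
      (g.lTensor R).lTensor W (TensorProduct.assoc k W R X (f.rTensor X x)) := by
  have e : ∀ (w : W ⊗[k] R) (y : X), TensorProduct.assoc k W R Z (w ⊗ₜ[k] g y) =
      (g.lTensor R).lTensor W (TensorProduct.assoc k W R X (w ⊗ₜ[k] y)) := by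
    intro w y
    induction w using TensorProduct.induction_on with
    | zero => simp only [map_zero, TensorProduct.zero_tmul]
    | add w w' h₁ h₂ => simp only [map_add, TensorProduct.add_tmul, h₁, h₂]
    | tmul p q => rfl
  induction x using TensorProduct.induction_on with
  | zero => simp only [map_zero]
  | add x y hx hy => simp only [map_add, hx, hy]
  | tmul u y => rw [LinearMap.lTensor_tmul, LinearMap.rTensor_tmul, LinearMap.rTensor_tmul, e]

/-- The action of `f` on the first two factors. -/
def onLegs (X : Type*) [AddCommGroup X] [Module k X] (f : U ⊗[k] V →ₗ[k] W ⊗[k] R) :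
    U ⊗[k] (V ⊗[k] X) →ₗ[k] W ⊗[k] (R ⊗[k] X) :=
  (TensorProduct.assoc k W R X).toLinearMap ∘ₗ f.rTensor X ∘ₗ
    (TensorProduct.assoc k U V X).symm.toLinearMap

theorem onLegs_ext {f g : U ⊗[k] (V ⊗[k] X) →ₗ[k] Z}
    (h : ∀ u v x, f (u ⊗ₜ[k] (v ⊗ₜ[k] x)) = g (u ⊗ₜ[k] (v ⊗ₜ[k] x))) : f = g :=
  TensorProduct.ext' fun u y => by
    induction y using TensorProduct.induction_on with
    | zero => simp only [map_zero, TensorProduct.tmul_zero]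
    | add x y hx hy => simp only [map_add, TensorProduct.tmul_add, hx, hy]
    | tmul v x => exact h u v x

theorem rTensor_onLegs (f : U ⊗[k] V →ₗ[k] W ⊗[k] R) (g : W →ₗ[k] Z) (x : U ⊗[k] (V ⊗[k] X)) :
    g.rTensor (R ⊗[k] X) (onLegs X f x) = onLegs X (g.rTensor R ∘ₗ f) x := by
  refine LinearMap.congr_fun (f := g.rTensor (R ⊗[k] X) ∘ₗ onLegs X f)
    (onLegs_ext fun u v x => ?_) x
  change g.rTensor (R ⊗[k] X) (TensorProduct.assoc k W R X (f (u ⊗ₜ[k] v) ⊗ₜ[k] x)) =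
    TensorProduct.assoc k Z R X (g.rTensor R (f (u ⊗ₜ[k] v)) ⊗ₜ[k] x)
  induction f (u ⊗ₜ[k] v) using TensorProduct.induction_on with
  | zero => simp only [map_zero, TensorProduct.zero_tmul]
  | add w w' h₁ h₂ => simp only [map_add, TensorProduct.add_tmul, h₁, h₂]
  | tmul p q => rfl

theorem onLegs_assoc (f : U →ₗ[k] W ⊗[k] R) (g : R ⊗[k] V →ₗ[k] Z) (x : U ⊗[k] (V ⊗[k] X)) :
    onLegs X (g.lTensor W ∘ₗ (TensorProduct.assoc k W R V).toLinearMap ∘ₗ f.rTensor V) x =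
      (g.rTensor X ∘ₗ (TensorProduct.assoc k R V X).symm.toLinearMap).lTensor W
        (TensorProduct.assoc k W R (V ⊗[k] X) (f.rTensor (V ⊗[k] X) x)) := by
  refine LinearMap.congr_fun (g := (g.rTensor X ∘ₗ
    (TensorProduct.assoc k R V X).symm.toLinearMap).lTensor W ∘ₗ
      (TensorProduct.assoc k W R (V ⊗[k] X)).toLinearMap ∘ₗ f.rTensor (V ⊗[k] X))
    (onLegs_ext fun u v x => ?_) x
  change TensorProduct.assoc k W Z X
      (g.lTensor W (TensorProduct.assoc k W R V (f u ⊗ₜ[k] v)) ⊗ₜ[k] x) =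
    (g.rTensor X ∘ₗ (TensorProduct.assoc k R V X).symm.toLinearMap).lTensor W
      (TensorProduct.assoc k W R (V ⊗[k] X) (f u ⊗ₜ[k] (v ⊗ₜ[k] x)))
  induction f u using TensorProduct.induction_on with
  | zero => simp only [map_zero, TensorProduct.zero_tmul]
  | add w w' h₁ h₂ => simp only [map_add, TensorProduct.add_tmul, h₁, h₂]
  | tmul p q => rfl

end Legs

theorem IsHopfCounit.sliceR_one {k : Type*} [Field k] {A : Type*} [NonUnitalRing A] [Module k A]
    [SMulCommClass k A A] [IsScalarTower k A A] {Δ : A →ₗ[k] M k (A ⊗[k] A)} {ε : A →ₗ[k] k}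
    (hε : IsHopfCounit Δ ε) (h : IsMultiplierHopf Δ) (a b : A) :
    sliceR ε (canonOne Δ a b) = ε b • a := by
  have h' := h.toIsMultiplierBialgebra.toIsPreMultiplierBialgebra
  refine h'.nondegenerate.ext_right fun c => ?_
  rw [← LinearMap.mulRight_apply (R := k), ← sliceR_rTensor, h'.mulRight_one_eq_mulRight_three,
    sliceR_lTensor_smul ε ε _ (ε b) (fun v => by
      rw [LinearMap.mulRight_apply, hε.map_mul h, mul_comm]), hε.sliceR_three h', smul_mul_assoc]

namespace IsSmashDatum

variable {k : Type*} [Field k]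
variable {A : Type*} [NonUnitalRing A] [Module k A] [SMulCommClass k A A] [IsScalarTower k A A]
variable {Y : Type*} [NonUnitalRing Y] [Module k Y] [SMulCommClass k Y Y] [IsScalarTower k Y Y]
variable {ΔA : A →ₗ[k] M k (A ⊗[k] A)} {ΔY : Y →ₗ[k] M k (Y ⊗[k] Y)}
variable {ρ : Y →ₗ[k] M k (A ⊗[k] Y)} {E : M k (A ⊗[k] Y)} (S : IsSmashDatum ΔA ΔY ρ E)

local notation "εY" => hopfCounit ΔY
local notation "εA" => hopfCounit ΔA

/-- `w = e ⊗ f ↦ (ι ⊗ g(f))T(t ⊗ e)`. -/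
def coactThen (ρ : Y →ₗ[k] M k (A ⊗[k] Y)) {Z : Type*} [AddCommGroup Z] [Module k Z]
    (g : A →ₗ[k] Y →ₗ[k] Z) : A ⊗[k] A →ₗ[k] Y →ₗ[k] A ⊗[k] Z :=
  TensorProduct.lift (LinearMap.mk₂ k (fun e f => (g f).lTensor A ∘ₗ (coactT ρ).flip e)
    (by intros; rw [map_add, LinearMap.comp_add])
    (by intros; rw [map_smul, LinearMap.comp_smul])
    (by intros; rw [map_add, LinearMap.lTensor_add, LinearMap.add_comp])
    (by intros; rw [map_smul, LinearMap.lTensor_smul, LinearMap.smul_comp]))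

theorem coactThen_tmul {Z : Type*} [AddCommGroup Z] [Module k Z]
    (g : A →ₗ[k] Y →ₗ[k] Z) (e f : A) (t : Y) :
    coactThen ρ g (e ⊗ₜ[k] f) t = (g f).lTensor A (coactT ρ t e) := rfl

/-- `y₍₁₎ ⊗ (ι ⊗ ε)T(y₍₂₎ ⊗ a)`. -/
def partialSlice (y₀ : Y) : Y →ₗ[k] A →ₗ[k] Y ⊗[k] A :=
  LinearMap.mk₂ k (fun y a => (sliceR εY).lTensor Y (S.covR y (a ⊗ₜ[k] y₀)))
    (by intros; rw [map_add, LinearMap.add_apply, map_add])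
    (by intros; rw [map_smul, LinearMap.smul_apply, map_smul])
    (by intros; rw [TensorProduct.add_tmul, map_add, map_add])
    (by intros; rw [← TensorProduct.smul_tmul', map_smul, map_smul])

theorem partialSlice_apply (y₀ y : Y) (a : A) :
    S.partialSlice y₀ y a = (sliceR εY).lTensor Y (S.covR y (a ⊗ₜ[k] y₀)) := rfl

/-- `f ↦ ρ(·)(f ⊗ v)`. -/
def actCurry (ρ : Y →ₗ[k] M k (A ⊗[k] Y)) (v : Y) : A →ₗ[k] Y →ₗ[k] A ⊗[k] Y :=
  (M.leftLin ∘ₗ ρ).flip ∘ₗ (TensorProduct.mk k A Y).flip v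

/-- `f ↦ (y ↦ y₍₁₎ ⊗ ρ(y₍₂₎)(f ⊗ v))`. -/
def covCurry (v : Y) : A →ₗ[k] Y →ₗ[k] Y ⊗[k] (A ⊗[k] Y) :=
  S.covR.flip ∘ₗ (TensorProduct.mk k A Y).flip v

include S

theorem actL_coact_comp (p : A) (y₀ : Y) (hy₀ : εY y₀ = 1) :
    sliceR εY ∘ₗ actL ρ (p ⊗ₜ[k] y₀) = (coactChar ΔY ρ).flip p :=
  LinearMap.ext fun t => by
    rw [LinearMap.comp_apply, S.actL_tmul, LinearMap.comp_apply,
      sliceR_lTensor_smul εY εY _ 1 (fun v => by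
        rw [LinearMap.mulRight_apply, S.counit_right.map_mul S.right.toIsMultiplierHopf, hy₀,
          mul_comm]), one_smul]
    rfl

theorem mulLeft_partialSlice {y₀ : Y} (hy₀ : εY y₀ = 1) (u y : Y) (a : A) :
    (LinearMap.mulLeft k u).rTensor A (S.partialSlice y₀ y a) =
      ((coactChar ΔY ρ).flip a).lTensor Y (canonTwo ΔY u y) := by
  rw [partialSlice_apply, rTensor_lTensor_comm, covR, mulLeft_coverR, lTensor_lTensor,
    S.actL_coact_comp a y₀ hy₀]

theorem mulRight_partialSlice {y₀ : Y} (hy₀ : εY y₀ = 1) (u y : Y) (a : A) :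
    (LinearMap.mulRight k u).rTensor A (S.partialSlice y₀ y a) =
      ((coactChar ΔY ρ).flip a).lTensor Y (canonThree ΔY y u) := by
  rw [partialSlice_apply, rTensor_lTensor_comm, covR, mulRight_coverR, lTensor_lTensor,
    S.actL_coact_comp a y₀ hy₀]

/-- Slicing the last leg of the compatibility of `T` with `Δ_Y` by `ε_Y` gives `ρ(y₍₁₎)(χ(y₍₂₎) ⊗ 1)
= ρ(y)`: the factor `χ` produced by partial coassociativity is absorbed by a neighbouring `ρ`. -/
theorem coact_partialSlice {y₀ : Y} (hy₀ : εY y₀ = 1) (y : Y) (a : A) :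
    TensorProduct.lift (coactT ρ) (S.partialSlice y₀ y a) = coactT ρ y a := by
  have e := congrArg ((sliceR εY).lTensor A) (S.coactLegs_covR y a y₀)
  have e₁ : sliceR εY ∘ₗ (canonOne ΔY).flip y₀ = LinearMap.id := LinearMap.ext fun t => by
    rw [LinearMap.comp_apply, LinearMap.flip_apply,
      S.counit_right.sliceR_one S.right.toIsMultiplierHopf, hy₀, one_smul, LinearMap.id_apply]
  rw [lTensor_lTensor, e₁, LinearMap.lTensor_id, LinearMap.id_apply] at e
  rw [← e, partialSlice_apply, coactLegs, LinearMap.comp_apply, LinearEquiv.coe_coe,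
    lTensor_sliceR_assoc, LinearMap.comp_apply, sliceR_rTensor, LinearEquiv.coe_coe,
    ← lTensor_sliceR_assoc, LinearEquiv.apply_symm_apply]

/-- Both sides of the compatibility of `ρ` with `Δ_Y` are here followed by `φ(·)x` on the last leg.
For `x = φ(v)x'` the witness comes from `covR`, covered by `v`, and the compatibility axiom applies
to it. -/
theorem exists_coact_cover {X : Type*} [NonUnitalRing X] [Module k X] [SMulCommClass k X X]
    [IsScalarTower k X X] {φ : Y →ₗ[k] M k X} (hφ : ∀ s t, φ (s * t) = φ s * φ t)
    (hc : IsCovered φ) (t : Y) (e : A) (x : X) :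
    ∃ Q : Y ⊗[k] (A ⊗[k] X),
      (∀ u, (LinearMap.mulLeft k u).rTensor (A ⊗[k] X) Q =
        ((actL φ x).lTensor A ∘ₗ (coactT ρ).flip e).lTensor Y (canonTwo ΔY u t)) ∧
      coactLegs ρ X Q = ((coverR S.pre_right hφ hc).flip x).lTensor A (coactT ρ t e) := by
  refine hc.left_induction (P := fun x => ∃ Q : Y ⊗[k] (A ⊗[k] X),
      (∀ u, (LinearMap.mulLeft k u).rTensor (A ⊗[k] X) Q =
        ((actL φ x).lTensor A ∘ₗ (coactT ρ).flip e).lTensor Y (canonTwo ΔY u t)) ∧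
      coactLegs ρ X Q = ((coverR S.pre_right hφ hc).flip x).lTensor A (coactT ρ t e))
    ?_ ?_ ?_ ?_ ?_ x
  · intro v x
    refine ⟨((actL φ x).lTensor A).lTensor Y (S.covR t (e ⊗ₜ[k] v)), fun u => ?_, ?_⟩
    · rw [rTensor_lTensor_comm, covR, mulLeft_coverR, lTensor_lTensor, S.actL_tmul,
        ← LinearMap.comp_assoc, ← LinearMap.lTensor_comp, actL_comp_mulRight hφ]
    · have e' : (coverR S.pre_right hφ hc).flip ((φ v).left x) =
          (actL φ x).lTensor Y ∘ₗ (canonOne ΔY).flip v :=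
        LinearMap.ext fun y => coverR_act _ hφ hc y v x
      rw [coactLegs_lTensor, S.coactLegs_covR, lTensor_lTensor, e']
  · refine ⟨0, fun u => ?_, ?_⟩
    · rw [show actL φ (0 : X) = 0 from map_zero (M.leftLin ∘ₗ φ).flip, LinearMap.lTensor_zero,
        LinearMap.zero_comp, LinearMap.lTensor_zero, map_zero, LinearMap.zero_apply]
    · rw [map_zero, map_zero, LinearMap.lTensor_zero, LinearMap.zero_apply]
  · rintro x x' ⟨Q, h₁, h₂⟩ ⟨Q', h₁', h₂'⟩
    refine ⟨Q + Q', fun u => ?_, ?_⟩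
    · rw [actL_add, LinearMap.lTensor_add, LinearMap.add_comp, LinearMap.lTensor_add, map_add, h₁,
        h₁', LinearMap.add_apply]
    · rw [map_add, map_add, LinearMap.lTensor_add, LinearMap.add_apply, h₂, h₂']
  · rintro c x ⟨Q, h₁, h₂⟩
    refine ⟨c • Q, fun u => ?_, ?_⟩
    · rw [actL_smul, LinearMap.lTensor_smul, LinearMap.smul_comp, LinearMap.lTensor_smul, map_smul,
        h₁, LinearMap.smul_apply]
    · rw [map_smul, map_smul, LinearMap.lTensor_smul, LinearMap.smul_apply, h₂]
  · rintro x x' he ⟨Q, h₁, h₂⟩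
    exact ⟨Q, fun u => by rw [he, h₁], by rw [coverR_congr _ hφ hc he, h₂]⟩

theorem exists_coactThen_cover (t v : Y) (w : A ⊗[k] A) :
    ∃ Q : Y ⊗[k] (A ⊗[k] (A ⊗[k] Y)),
      (∀ u, (LinearMap.mulLeft k u).rTensor (A ⊗[k] (A ⊗[k] Y)) Q =
        (coactThen ρ (actCurry ρ v) w).lTensor Y (canonTwo ΔY u t)) ∧
      coactLegs ρ (A ⊗[k] Y) Q = coactThen ρ (S.covCurry v) w t := by
  induction w using TensorProduct.induction_on with
  | zero =>
    refine ⟨0, fun u => ?_, ?_⟩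
    · rw [map_zero, map_zero, LinearMap.lTensor_zero, LinearMap.zero_apply]
    · rw [map_zero, map_zero, LinearMap.zero_apply]
  | add x y hx hy =>
    obtain ⟨Q, h₁, h₂⟩ := hx
    obtain ⟨Q', h₁', h₂'⟩ := hy
    refine ⟨Q + Q', fun u => ?_, ?_⟩
    · rw [map_add, map_add, LinearMap.lTensor_add, LinearMap.add_apply, h₁, h₁']
    · rw [map_add, map_add, LinearMap.add_apply, h₂, h₂']
  | tmul e f =>
    exact S.exists_coact_cover S.bialgebra.algebra.map_mul S.covered t e (f ⊗ₜ[k] v)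

/-- The heart of coassociativity: with coverings suppressed, `t₍₁₎₋₁(t₍₂₎₋₁)₍₁₎ ⊗ t₍₁₎₀ ⊗
(t₍₂₎₋₁)₍₂₎ ⊗ t₍₂₎₀` equals `t₋₁ ⊗ t₀₍₁₎ ⊗ ρ(t₀₍₂₎)`. Inserting the harmless factor `χ` on the left
makes partial coassociativity applicable. -/
theorem coactLegs_comul_covR {y₀ : Y} (hy₀ : εY y₀ = 1) (t v : Y) (f a' : A) :
    coactLegs ρ (A ⊗[k] Y) (((TensorProduct.assoc k A A Y).toLinearMap ∘ₗ
      ((canonOne ΔA).flip a').rTensor Y).lTensor Y (S.covR t (f ⊗ₜ[k] v))) =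
      coactThen ρ (S.covCurry v) (canonOne ΔA f a') t := by
  set x := ((TensorProduct.assoc k A A Y).toLinearMap ∘ₗ
      ((canonOne ΔA).flip a').rTensor Y).lTensor Y (S.covR t (f ⊗ₜ[k] v)) with hx
  obtain ⟨Q, h₁, h₂⟩ := S.exists_coactThen_cover t v (canonOne ΔA f a')
  -- Replacing `s ⊗ p` by `s₍₁₎ ⊗ χ(s₍₂₎)p` on the first two legs yields `t₍₁₎ ⊗ t₍₂₎₋₁ ⊗ ρ(t₍₂₎₀)`,
  -- by coassociativity of `Δ_Y` followed by partial coassociativity of `ρ`.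
  have hQ : onLegs (A ⊗[k] Y) (TensorProduct.lift (S.partialSlice y₀)) x = Q := by
    refine ext_mulLeft_rTensor S.nondeg_right fun u => ?_
    have e₁ : (LinearMap.mulLeft k u).rTensor A ∘ₗ TensorProduct.lift (S.partialSlice y₀) =
        (counitT ΔY ρ).lTensor Y ∘ₗ (TensorProduct.assoc k Y Y A).toLinearMap ∘ₗ
          (canonTwo ΔY u).rTensor A := TensorProduct.ext' fun y a => by
      change (LinearMap.mulLeft k u).rTensor A (S.partialSlice y₀ y a) = (counitT ΔY ρ).lTensor Y
        (TensorProduct.assoc k Y Y A (canonTwo ΔY u y ⊗ₜ[k] a))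
      rw [S.mulLeft_partialSlice hy₀, counitT_tmul]
      induction canonTwo ΔY u y using TensorProduct.induction_on with
      | zero => simp only [map_zero, TensorProduct.zero_tmul]
      | add w w' h₁ h₂ => simp only [map_add, TensorProduct.add_tmul, h₁, h₂]
      | tmul p q => rfl
    rw [h₁, rTensor_onLegs, e₁, onLegs_assoc, hx, assoc_rTensor, covR, canonTwo_coverR,
      lTensor_lTensor, lTensor_lTensor]
    congr 2
    refine LinearMap.ext fun s => ?_
    have := S.coassoc_covR s f a' v (fun w => coactThen ρ (actCurry ρ v) w s) (fun e f => rfl)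
      (by rw [map_zero, LinearMap.zero_apply]) (fun u v => by rw [map_add, LinearMap.add_apply])
    exact this
  rw [← h₂, ← hQ]
  -- Applying `T` to the first two legs removes the inserted `χ` again.
  have e : TensorProduct.lift (coactT ρ) ∘ₗ TensorProduct.lift (S.partialSlice y₀) =
      TensorProduct.lift (coactT ρ) :=
    TensorProduct.ext' fun y a => S.coact_partialSlice hy₀ y a
  change TensorProduct.assoc k A Y _ ((TensorProduct.lift (coactT ρ)).rTensor _ _) =
    TensorProduct.assoc k A Y _ ((TensorProduct.lift (coactT ρ)).rTensor _
      ((TensorProduct.assoc k Y A _).symm (TensorProduct.assoc k Y A _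
        ((TensorProduct.lift (S.partialSlice y₀)).rTensor _ _))))
  rw [LinearEquiv.symm_apply_apply, rTensor_rTensor, e]

end IsSmashDatum

/-! ### Testing equality on the third of four legs -/

section ThirdLeg

variable {k : Type*} [Field k]
variable {B : Type*} [NonUnitalRing B] [Module k B] [SMulCommClass k B B] [IsScalarTower k B B]
variable {U V W : Type*} [AddCommGroup U] [Module k U] [AddCommGroup V] [Module k V]
variable [AddCommGroup W] [Module k W]

theorem lift_zero : TensorProduct.lift (0 : U →ₗ[k] V →ₗ[k] W) = 0 :=
  TensorProduct.ext' fun _ _ => rfl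

theorem lift_add (f g : U →ₗ[k] V →ₗ[k] W) :
    TensorProduct.lift (f + g) = TensorProduct.lift f + TensorProduct.lift g :=
  TensorProduct.ext' fun _ _ => rfl

theorem ext_mulRight_third (hB : Nondegenerate B) {x y : U ⊗[k] (V ⊗[k] (B ⊗[k] W))}
    (h : ∀ b : B, (((LinearMap.mulRight k b).rTensor W).lTensor V).lTensor U x =
      (((LinearMap.mulRight k b).rTensor W).lTensor V).lTensor U y) : x = y := by
  rw [← sub_eq_zero]
  have h₁ : ∀ v : B ⊗[k] W, (∀ b, (LinearMap.mulRight k b).rTensor W v = 0) →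
      (LinearMap.id : B ⊗[k] W →ₗ[k] B ⊗[k] W) v = 0 := fun v hv =>
    ext_mulRight_rTensor hB fun b => (hv b).trans (map_zero _).symm
  have h₂ : ∀ v : V ⊗[k] (B ⊗[k] W), (∀ b, ((LinearMap.mulRight k b).rTensor W).lTensor V v = 0) →
      (LinearMap.id : V ⊗[k] (B ⊗[k] W) →ₗ[k] V ⊗[k] (B ⊗[k] W)) v = 0 := fun v hv => by
    have := lTensor_eq_zero_of_joint _ _ h₁ v hv
    rwa [LinearMap.lTensor_id] at this
  have := lTensor_eq_zero_of_joint (fun b : B => ((LinearMap.mulRight k b).rTensor W).lTensor V)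
    _ h₂ (x - y) fun b => by rw [map_sub, h, sub_self]
  rwa [LinearMap.lTensor_id] at this

end ThirdLeg

section Place₂

variable {k : Type*} [Field k]
variable {A : Type*} [NonUnitalRing A] [Module k A] [SMulCommClass k A A] [IsScalarTower k A A]
variable {Y : Type*} [NonUnitalRing Y] [Module k Y] [SMulCommClass k Y Y] [IsScalarTower k Y Y]

/-- `(s ⊗ (α ⊗ z)) ⊗ q ↦ (s ⊗ α) ⊗ (z ⊗ q)`, followed by the rearrangement of `z ⊗ q`. -/
def place₂ (A Y : Type*) [NonUnitalRing A] [Module k A] [SMulCommClass k A A]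
    [IsScalarTower k A A] [NonUnitalRing Y] [Module k Y] [SMulCommClass k Y Y]
    [IsScalarTower k Y Y] : A →ₗ[k] Y ⊗[k] (A ⊗[k] (Y ⊗[k] (A ⊗[k] Y))) →ₗ[k]
      (Y ⊗[k] A) ⊗[k] ((Y ⊗[k] A) ⊗[k] (Y ⊗[k] A)) where
  toFun q := ((place A Y).toLinearMap ∘ₗ (TensorProduct.mk k _ A).flip q).lTensor (Y ⊗[k] A) ∘ₗ
    (TensorProduct.assoc k Y A (Y ⊗[k] (A ⊗[k] Y))).symm.toLinearMap
  map_add' p q := by rw [map_add, LinearMap.comp_add, LinearMap.lTensor_add, LinearMap.add_comp]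
  map_smul' c q := by
    rw [map_smul, LinearMap.comp_smul, LinearMap.lTensor_smul, LinearMap.smul_comp]; rfl

end Place₂

namespace IsSmashDatum

variable {k : Type*} [Field k]
variable {A : Type*} [NonUnitalRing A] [Module k A] [SMulCommClass k A A] [IsScalarTower k A A]
variable {Y : Type*} [NonUnitalRing Y] [Module k Y] [SMulCommClass k Y Y] [IsScalarTower k Y Y]
variable {ΔA : A →ₗ[k] M k (A ⊗[k] A)} {ΔY : Y →ₗ[k] M k (Y ⊗[k] Y)}
variable {ρ : Y →ₗ[k] M k (A ⊗[k] Y)} {E : M k (A ⊗[k] Y)} (S : IsSmashDatum ΔA ΔY ρ E)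

local notation "εY" => hopfCounit ΔY

include S

theorem mulLeft_coactLegs {X : Type*} [AddCommGroup X] [Module k X] (a : A)
    (x : Y ⊗[k] (A ⊗[k] X)) : (LinearMap.mulLeft k a).rTensor (Y ⊗[k] X) (coactLegs ρ X x) =
      coactLegs ρ X (((LinearMap.mulLeft k a).rTensor X).lTensor Y x) := by
  refine LinearMap.congr_fun (f := (LinearMap.mulLeft k a).rTensor (Y ⊗[k] X) ∘ₗ coactLegs ρ X)
    (g := coactLegs ρ X ∘ₗ ((LinearMap.mulLeft k a).rTensor X).lTensor Y)
    (onLegs_ext fun s b v => ?_) x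
  change (LinearMap.mulLeft k a).rTensor (Y ⊗[k] X)
      (TensorProduct.assoc k A Y X (coactT ρ s b ⊗ₜ[k] v)) =
    TensorProduct.assoc k A Y X (coactT ρ s (a * b) ⊗ₜ[k] v)
  rw [S.coactT_mul']
  induction coactT ρ s b using TensorProduct.induction_on with
  | zero => simp only [map_zero, TensorProduct.zero_tmul]
  | add w w' h₁ h₂ => simp only [map_add, TensorProduct.add_tmul, h₁, h₂]
  | tmul p q => rfl

theorem coactThen_mulLeft {Z : Type*} [AddCommGroup Z] [Module k Z] (g : A →ₗ[k] Y →ₗ[k] Z)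
    (a : A) (w : A ⊗[k] A) (t : Y) :
    coactThen ρ g ((LinearMap.mulLeft k a).rTensor A w) t =
      (LinearMap.mulLeft k a).rTensor Z (coactThen ρ g w t) := by
  induction w using TensorProduct.induction_on with
  | zero => simp only [map_zero, LinearMap.zero_apply]
  | add x y hx hy => simp only [map_add, LinearMap.add_apply, hx, hy]
  | tmul e f =>
    rw [LinearMap.rTensor_tmul, coactThen_tmul, coactThen_tmul, LinearMap.mulLeft_apply,
      S.coactT_mul', rTensor_lTensor_comm]

theorem coactThen_covCurry_mulRight (v : Y) (a : A) (w : A ⊗[k] A) (t : Y) :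
    coactThen ρ (S.covCurry v) ((LinearMap.mulRight k a).lTensor A w) t =
      (((LinearMap.mulRight k a).rTensor Y).lTensor Y).lTensor A
        (coactThen ρ (S.covCurry v) w t) := by
  induction w using TensorProduct.induction_on with
  | zero => simp only [map_zero, LinearMap.zero_apply]
  | add x y hx hy => simp only [map_add, LinearMap.add_apply, hx, hy]
  | tmul e f =>
    rw [LinearMap.lTensor_tmul, coactThen_tmul, coactThen_tmul, lTensor_lTensor]
    congr 2
    exact LinearMap.ext fun y => S.covR_mul y f a v

/-- The same identity with the covering of `Δ_A` moved from its second leg to its first. Multiplying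
the third leg by an arbitrary `a` restores the earlier covering, and nondegeneracy of `A` removes
`a`. -/
theorem coactLegs_comulTwo_covR {y₀ : Y} (hy₀ : εY y₀ = 1) (t v : Y) (p b : A) :
    coactLegs ρ (A ⊗[k] Y) (((TensorProduct.assoc k A A Y).toLinearMap ∘ₗ
      (canonTwo ΔA b).rTensor Y).lTensor Y (S.covR t (p ⊗ₜ[k] v))) =
      coactThen ρ (S.covCurry v) (canonTwo ΔA b p) t := by
  refine ext_mulRight_third S.nondeg_left fun a => ?_
  have e₀ : ∀ (w : A ⊗[k] A) (y : Y), ((LinearMap.mulRight k a).rTensor Y).lTensor A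
      (TensorProduct.assoc k A A Y (w ⊗ₜ[k] y)) =
        TensorProduct.assoc k A A Y ((LinearMap.mulRight k a).lTensor A w ⊗ₜ[k] y) := by
    intro w y
    induction w using TensorProduct.induction_on with
    | zero => simp only [map_zero, TensorProduct.zero_tmul]
    | add w w' h₁ h₂ => simp only [map_add, TensorProduct.add_tmul, h₁, h₂]
    | tmul p q => rfl
  have e₁ : ∀ (w : A ⊗[k] A) (y : Y), (LinearMap.mulLeft k b).rTensor (A ⊗[k] Y)
      (TensorProduct.assoc k A A Y (w ⊗ₜ[k] y)) =
        TensorProduct.assoc k A A Y ((LinearMap.mulLeft k b).rTensor A w ⊗ₜ[k] y) := by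
    intro w y
    induction w using TensorProduct.induction_on with
    | zero => simp only [map_zero, TensorProduct.zero_tmul]
    | add w w' h₁ h₂ => simp only [map_add, TensorProduct.add_tmul, h₁, h₂]
    | tmul p q => rfl
  have e : ((LinearMap.mulRight k a).rTensor Y).lTensor A ∘ₗ
      ((TensorProduct.assoc k A A Y).toLinearMap ∘ₗ (canonTwo ΔA b).rTensor Y) =
      (LinearMap.mulLeft k b).rTensor (A ⊗[k] Y) ∘ₗ ((TensorProduct.assoc k A A Y).toLinearMap ∘ₗ
      ((canonOne ΔA).flip a).rTensor Y) := TensorProduct.ext' fun q y => by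
    change ((LinearMap.mulRight k a).rTensor Y).lTensor A
        (TensorProduct.assoc k A A Y (canonTwo ΔA b q ⊗ₜ[k] y)) =
      (LinearMap.mulLeft k b).rTensor (A ⊗[k] Y)
        (TensorProduct.assoc k A A Y (canonOne ΔA q a ⊗ₜ[k] y))
    rw [e₀, e₁, S.pre_left.mulLeft_one_eq_mulRight_two]
  rw [← S.coactThen_covCurry_mulRight, ← S.pre_left.mulLeft_one_eq_mulRight_two,
    S.coactThen_mulLeft, ← coactLegs_lTensor, lTensor_lTensor, e, ← lTensor_lTensor,
    ← S.mulLeft_coactLegs, S.coactLegs_comul_covR hy₀]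

/-- The left hand side of coassociativity, in terms of `Δ_Y` and `ρ`. -/
theorem canonTwo_smashComul_place (u : Y) (b : A) (z : Y ⊗[k] (A ⊗[k] Y)) (q : A) :
    TensorProduct.assoc k (Y ⊗[k] A) (Y ⊗[k] A) (Y ⊗[k] A)
      ((canonTwo S.smashComul (u ⊗ₜ[k] b)).rTensor (Y ⊗[k] A) (place A Y (z ⊗ₜ[k] q))) =
      place₂ A Y q ((coactLegs ρ (A ⊗[k] Y) ∘ₗ ((TensorProduct.assoc k A A Y).toLinearMap ∘ₗ
        (canonTwo ΔA b).rTensor Y).lTensor Y).lTensor Y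
          (TensorProduct.assoc k Y Y (A ⊗[k] Y) ((canonTwo ΔY u).rTensor (A ⊗[k] Y) z))) := by
  have key : ∀ (v : Y ⊗[k] Y) (w : A ⊗[k] A) (y : Y),
      TensorProduct.assoc k (Y ⊗[k] A) (Y ⊗[k] A) (Y ⊗[k] A)
        (place A Y ((slotT ρ v).rTensor A w) ⊗ₜ[k] (y ⊗ₜ[k] q)) =
      place₂ A Y q ((coactLegs ρ (A ⊗[k] Y)).lTensor Y (TensorProduct.assoc k Y Y _
        (v ⊗ₜ[k] (TensorProduct.assoc k A A Y (w ⊗ₜ[k] y))))) := by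
    intro v w y
    induction v using TensorProduct.induction_on with
    | zero => simp only [map_zero, TensorProduct.zero_tmul, LinearMap.rTensor_zero,
        LinearMap.zero_apply]
    | add w w' h₁ h₂ => simp only [map_add, TensorProduct.add_tmul, LinearMap.rTensor_add,
        LinearMap.add_apply, h₁, h₂]
    | tmul m t =>
      induction w using TensorProduct.induction_on with
      | zero => simp only [map_zero, TensorProduct.zero_tmul, TensorProduct.tmul_zero]
      | add w w' h₁ h₂ => simp only [map_add, TensorProduct.add_tmul, TensorProduct.tmul_add,
          h₁, h₂]
      | tmul g o =>
        rw [LinearMap.rTensor_tmul, slotT_apply, LinearMap.lTensor_tmul, LinearMap.flip_apply,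
          TensorProduct.assoc_tmul, TensorProduct.assoc_tmul, LinearMap.lTensor_tmul,
          coactLegs_tmul]
        induction coactT ρ t g using TensorProduct.induction_on with
        | zero => simp only [map_zero, TensorProduct.zero_tmul, TensorProduct.tmul_zero]
        | add w w' h₁ h₂ => simp only [map_add, TensorProduct.add_tmul, TensorProduct.tmul_add,
            h₁, h₂]
        | tmul β t' => rfl
  induction z using TensorProduct.induction_on with
  | zero => simp only [map_zero, TensorProduct.zero_tmul]
  | add x y hx hy => simp only [map_add, TensorProduct.add_tmul, hx, hy]
  | tmul s x =>
    induction x using TensorProduct.induction_on with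
    | zero => simp only [map_zero, TensorProduct.zero_tmul, TensorProduct.tmul_zero]
    | add x y hx hy =>
      simp only [map_add, TensorProduct.add_tmul, TensorProduct.tmul_add, hx, hy]
    | tmul α y =>
      rw [place_tmul, LinearMap.rTensor_tmul, S.canonTwo_smashComul, key, LinearMap.lTensor_comp,
        LinearMap.comp_apply]
      congr 2
      rw [LinearMap.rTensor_tmul]
      induction canonTwo ΔY u s using TensorProduct.induction_on with
      | zero => simp only [map_zero, TensorProduct.zero_tmul]
      | add w w' h₁ h₂ => simp only [map_add, TensorProduct.add_tmul, h₁, h₂]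
      | tmul p q => rfl

omit S in
/-- `((g ⊗ h₁) ⊗ h₂) ↦ m₁ ⊗ m₂^{-1}g ⊗ Δ_Y(m₂⁰)(h₁ ⊗ v) ⊗ h₂`. -/
def coactThenPlace (S : IsSmashDatum ΔA ΔY ρ E) (v : Y) (m : Y ⊗[k] Y) :
    (A ⊗[k] A) ⊗[k] A →ₗ[k] (Y ⊗[k] A) ⊗[k] ((Y ⊗[k] A) ⊗[k] (Y ⊗[k] A)) :=
  TensorProduct.lift ((place₂ A Y).flip ∘ₗ
    (LinearMap.lTensorHom Y ∘ₗ coactThen ρ (S.covCurry v)).flip m)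

theorem coactThenPlace_tmul (v : Y) (m : Y ⊗[k] Y) (w : A ⊗[k] A) (q : A) :
    S.coactThenPlace v m (w ⊗ₜ[k] q) =
      place₂ A Y q ((coactThen ρ (S.covCurry v) w).lTensor Y m) := rfl

theorem coactThenPlace_add (v : Y) (m n : Y ⊗[k] Y) :
    S.coactThenPlace v (m + n) = S.coactThenPlace v m + S.coactThenPlace v n := by
  refine TensorProduct.ext' fun w q => ?_
  rw [LinearMap.add_apply, coactThenPlace_tmul, coactThenPlace_tmul, coactThenPlace_tmul, map_add,
    map_add]

theorem coactThenPlace_zero (v : Y) : S.coactThenPlace v 0 = 0 := by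
  refine TensorProduct.ext' fun w q => ?_
  rw [LinearMap.zero_apply, coactThenPlace_tmul, map_zero, map_zero]

/-- The right hand side of coassociativity, in terms of `Δ_Y` and `ρ`. -/
theorem canonOne_smashComul_place (v : Y) (a : A) (m : Y ⊗[k] Y) (w : A ⊗[k] A) :
    ((canonOne S.smashComul).flip (v ⊗ₜ[k] a)).lTensor (Y ⊗[k] A)
      (place A Y ((slotT ρ m).rTensor A w)) =
      S.coactThenPlace v m
        ((TensorProduct.assoc k A A A).symm (((canonOne ΔA).flip a).lTensor A w)) := by
  induction m using TensorProduct.induction_on with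
  | zero => simp only [map_zero, LinearMap.rTensor_zero, LinearMap.zero_apply,
      S.coactThenPlace_zero]
  | add w w' h₁ h₂ => simp only [map_add, LinearMap.rTensor_add, LinearMap.add_apply,
      S.coactThenPlace_add, h₁, h₂]
  | tmul s t =>
    induction w using TensorProduct.induction_on with
    | zero => simp only [map_zero]
    | add w w' h₁ h₂ => simp only [map_add, h₁, h₂]
    | tmul g h =>
      have key : ∀ x : A ⊗[k] Y, ((canonOne S.smashComul).flip (v ⊗ₜ[k] a)).lTensor (Y ⊗[k] A)
          (place A Y ((s ⊗ₜ[k] x) ⊗ₜ[k] h)) =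
          TensorProduct.lift ((place₂ A Y).flip ∘ₗ TensorProduct.mk k Y _ s ∘ₗ
            (LinearMap.lTensorHom A ∘ₗ S.covCurry v).flip x) (canonOne ΔA h a) := by
        intro x
        induction x using TensorProduct.induction_on with
        | zero => simp only [map_zero, TensorProduct.zero_tmul, TensorProduct.tmul_zero,
            LinearMap.comp_zero, lift_zero, LinearMap.zero_apply]
        | add w w' h₁ h₂ => simp only [map_add, TensorProduct.add_tmul, TensorProduct.tmul_add,
            LinearMap.comp_add, lift_add, LinearMap.add_apply, h₁, h₂]
        | tmul β y =>
          rw [place_tmul, LinearMap.lTensor_tmul, LinearMap.flip_apply, S.canonOne_smashComul]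
          generalize canonOne ΔA h a = x
          induction x using TensorProduct.induction_on with
          | zero => simp only [map_zero, TensorProduct.tmul_zero]
          | add w w' h₁ h₂ => simp only [map_add, TensorProduct.tmul_add, h₁, h₂]
          | tmul p q => rfl
      rw [LinearMap.rTensor_tmul, slotT_apply, LinearMap.lTensor_tmul, LinearMap.flip_apply, key,
        LinearMap.lTensor_tmul, LinearMap.flip_apply]
      generalize canonOne ΔA h a = x
      induction x using TensorProduct.induction_on with
      | zero => simp only [map_zero, TensorProduct.tmul_zero]
      | add w w' h₁ h₂ => simp only [map_add, TensorProduct.tmul_add, h₁, h₂]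
      | tmul p q => rfl

/-- Coassociativity of `Δ_A` and of `Δ_Y` line up the outer legs of the two iterates; what differs
is the coaction part, settled by `coactLegs_comulTwo_covR`. -/
theorem coassoc_smashComul {y₀ : Y} (hy₀ : εY y₀ = 1) (b c d : Y ⊗[k] A) :
    TensorProduct.assoc k (Y ⊗[k] A) (Y ⊗[k] A) (Y ⊗[k] A)
      ((canonTwo S.smashComul b).rTensor (Y ⊗[k] A) (canonOne S.smashComul c d)) =
      ((canonOne S.smashComul).flip d).lTensor (Y ⊗[k] A) (canonTwo S.smashComul b c) := by
  induction b using TensorProduct.induction_on with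
  | zero => simp only [map_zero, LinearMap.rTensor_zero, LinearMap.zero_apply]
  | add x y h₁ h₂ => simp only [map_add, LinearMap.rTensor_add, LinearMap.add_apply, h₁, h₂]
  | tmul u b =>
    induction c using TensorProduct.induction_on with
    | zero => simp only [map_zero, LinearMap.zero_apply]
    | add x y h₁ h₂ => simp only [map_add, LinearMap.add_apply, h₁, h₂]
    | tmul y a =>
      induction d using TensorProduct.induction_on with
      | zero => simp only [map_zero, LinearMap.lTensor_zero, LinearMap.zero_apply]
      | add x y h₁ h₂ => simp only [map_add, LinearMap.lTensor_add, LinearMap.add_apply, h₁, h₂]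
      | tmul v a' =>
        rw [S.canonTwo_smashComul, S.canonOne_smashComul_place, ← S.pre_left.coassoc,
          LinearEquiv.symm_apply_apply, S.canonOne_smashComul]
        generalize canonOne ΔA a a' = w
        induction w using TensorProduct.induction_on with
        | zero => simp only [map_zero]
        | add x y h₁ h₂ => simp only [map_add, h₁, h₂]
        | tmul p q =>
          rw [LinearMap.rTensor_tmul, LinearMap.rTensor_tmul, S.canonTwo_smashComul_place,
            coactThenPlace_tmul, slotOne, LinearMap.comp_apply, LinearMap.flip_apply,
            TensorProduct.mk_apply, covR, canonTwo_coverR, lTensor_lTensor]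
          congr 3
          exact LinearMap.ext fun t => S.coactLegs_comulTwo_covR hy₀ t v p b

theorem isPreMultiplierBialgebra {y₀ : Y} (hy₀ : εY y₀ = 1) :
    IsPreMultiplierBialgebra S.smashComul :=
  S.isPreMultiplierBialgebra_smashComul (S.coassoc_smashComul hy₀)

end IsSmashDatum

/-! ### The counit of the smash coproduct and the partial smash coproduct -/

namespace IsSmashDatum

variable {k : Type*} [Field k]
variable {A : Type*} [NonUnitalRing A] [Module k A] [SMulCommClass k A A] [IsScalarTower k A A]
variable {Y : Type*} [NonUnitalRing Y] [Module k Y] [SMulCommClass k Y Y] [IsScalarTower k Y Y]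
variable {ΔA : A →ₗ[k] M k (A ⊗[k] A)} {ΔY : Y →ₗ[k] M k (Y ⊗[k] Y)}
variable {ρ : Y →ₗ[k] M k (A ⊗[k] Y)} {E : M k (A ⊗[k] Y)} (S : IsSmashDatum ΔA ΔY ρ E)

local notation "εY" => hopfCounit ΔY
local notation "εA" => hopfCounit ΔA

theorem smashCounit_tmul (y : Y) (a : A) : smashCounit ΔA ΔY (y ⊗ₜ[k] a) = εY y * εA a := rfl

theorem sliceL_place (z : Y ⊗[k] (A ⊗[k] Y)) (q : A) :
    sliceL (smashCounit ΔA ΔY) (place A Y (z ⊗ₜ[k] q)) = sliceL εA (sliceL εY z) ⊗ₜ[k] q := by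
  induction z using TensorProduct.induction_on with
  | zero => simp only [map_zero, TensorProduct.zero_tmul]
  | add x y hx hy => simp only [map_add, TensorProduct.add_tmul, hx, hy]
  | tmul s x =>
    induction x using TensorProduct.induction_on with
    | zero => simp only [map_zero, TensorProduct.zero_tmul, TensorProduct.tmul_zero]
    | add x y hx hy =>
      simp only [map_add, TensorProduct.add_tmul, TensorProduct.tmul_add, hx, hy]
    | tmul a t =>
      rw [place_tmul, sliceL_tmul, sliceL_tmul, map_smul, sliceL_tmul, smashCounit_tmul, smul_smul,
        TensorProduct.smul_tmul']

theorem sliceR_place (z : Y ⊗[k] (A ⊗[k] Y)) (q : A) :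
    sliceR (smashCounit ΔA ΔY) (place A Y (z ⊗ₜ[k] q)) = εA q • (sliceR εY).lTensor Y z := by
  induction z using TensorProduct.induction_on with
  | zero => simp only [map_zero, TensorProduct.zero_tmul, smul_zero]
  | add x y hx hy => simp only [map_add, TensorProduct.add_tmul, smul_add, hx, hy]
  | tmul s x =>
    induction x using TensorProduct.induction_on with
    | zero => simp only [map_zero, TensorProduct.zero_tmul, TensorProduct.tmul_zero, smul_zero]
    | add x y hx hy =>
      simp only [map_add, TensorProduct.add_tmul, TensorProduct.tmul_add, smul_add, hx, hy]
    | tmul a t =>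
      rw [place_tmul, sliceR_tmul, LinearMap.lTensor_tmul, sliceR_tmul, smashCounit_tmul,
        TensorProduct.tmul_smul, smul_smul, mul_comm]

/-- The projection `(ι ⊗ ε)Δ` onto the partial smash coproduct. -/
abbrev slice (y₀ : Y) (a₀ : A) : Y ⊗[k] A →ₗ[k] Y ⊗[k] A :=
  sliceMap S.smashComul (smashCounit ΔA ΔY) (y₀ ⊗ₜ[k] a₀)

include S

theorem smashCounit_mul (b c : Y ⊗[k] A) :
    smashCounit ΔA ΔY (b * c) = smashCounit ΔA ΔY b * smashCounit ΔA ΔY c := by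
  induction b using TensorProduct.induction_on with
  | zero => simp only [zero_mul, map_zero]
  | add x y hx hy => simp only [add_mul, map_add, hx, hy]
  | tmul y a =>
    induction c using TensorProduct.induction_on with
    | zero => simp only [mul_zero, map_zero]
    | add x y hx hy => simp only [mul_add, map_add, hx, hy]
    | tmul y' a' =>
      rw [Algebra.TensorProduct.tmul_mul_tmul, smashCounit_tmul, smashCounit_tmul,
        smashCounit_tmul, S.counit_left.map_mul S.left.toIsMultiplierHopf,
        S.counit_right.map_mul S.right.toIsMultiplierHopf, mul_mul_mul_comm]

/-- `ε_Y` on the first leg undoes `Δ_Y`, after which `ε_A` undoes `ρ`. -/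
theorem sliceL_slotOne (y y'' : Y) (p : A) :
    sliceL εA (sliceL εY (S.slotOne y y'' p)) = εA p • (y * y'') := by
  have e : sliceL εY (S.slotOne y y'' p) = (ρ y).left (p ⊗ₜ[k] y'') :=
    sliceL_coverR _ _ _ S.counit_right y (p ⊗ₜ[k] y'')
  have e' : sliceL εA (coactT ρ y p) = εA p • y := S.bialgebra.coalgebra.counit_right y p
  rw [e, ← actL_apply, S.actL_tmul, LinearMap.comp_apply, sliceL_lTensor, LinearMap.flip_apply, e',
    map_smul, LinearMap.mulRight_apply]

theorem sliceL_canonOne_smashComul (b c : Y ⊗[k] A) :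
    sliceL (smashCounit ΔA ΔY) (canonOne S.smashComul b c) = b * c := by
  induction b using TensorProduct.induction_on with
  | zero => simp only [zero_mul, map_zero, LinearMap.zero_apply]
  | add x y hx hy => simp only [add_mul, map_add, LinearMap.add_apply, hx, hy]
  | tmul y a =>
    induction c using TensorProduct.induction_on with
    | zero => simp only [mul_zero, map_zero]
    | add x y hx hy => simp only [mul_add, map_add, hx, hy]
    | tmul y'' a'' =>
      rw [S.canonOne_smashComul, Algebra.TensorProduct.tmul_mul_tmul, ← S.counit_left.sliceL_one]
      induction canonOne ΔA a a'' using TensorProduct.induction_on with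
      | zero => simp only [TensorProduct.tmul_zero, map_zero]
      | add x y hx hy => simp only [TensorProduct.tmul_add, map_add, hx, hy]
      | tmul p q =>
        rw [LinearMap.rTensor_tmul, sliceL_place, S.sliceL_slotOne, sliceL_tmul,
          TensorProduct.smul_tmul]

theorem isLeftCounit (h : IsPreMultiplierBialgebra S.smashComul) :
    IsLeftCounit S.smashComul (smashCounit ΔA ΔY) where
  map_mul := S.smashCounit_mul
  counit_left := S.sliceL_canonOne_smashComul
  counit_right a b := by
    refine h.nondegenerate.ext_right fun c => ?_
    change sliceL (smashCounit ΔA ΔY) (canonFour S.smashComul b a) * c = _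
    rw [← LinearMap.mulRight_apply (R := k), ← sliceL_lTensor, ← h.mulLeft_one_eq_mulRight_four,
      sliceL_lTensor, S.sliceL_canonOne_smashComul, LinearMap.mulLeft_apply, mul_assoc]

/-- `ε_A` removes the second leg of `Δ_A`, leaving `π(y ⊗ a) = y₍₁₎ ⊗ χ(y₍₂₎)a`. -/
theorem slice_tmul (y₀ : Y) {a₀ : A} (ha₀ : εA a₀ = 1) (y : Y) (a : A) :
    S.slice y₀ a₀ (y ⊗ₜ[k] a) =
      S.partialSlice y₀ y a := by
  have e : sliceR εA (canonOne ΔA a a₀) = a := by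
    rw [S.counit_left.sliceR_one S.left.toIsMultiplierHopf, ha₀, one_smul]
  rw [slice, sliceMap_apply, S.canonOne_smashComul]
  conv_rhs => rw [← e]
  induction canonOne ΔA a a₀ using TensorProduct.induction_on with
  | zero => simp only [map_zero]
  | add x y hx hy => simp only [map_add, hx, hy]
  | tmul p q =>
    rw [LinearMap.rTensor_tmul, sliceR_place, sliceR_tmul, map_smul]
    rfl

theorem partialSlice_mul {y₀ : Y} (hy₀ : εY y₀ = 1) (y : Y) (a : A) (y' : Y) (a' : A) :
    S.partialSlice y₀ y a * (y' ⊗ₜ[k] a') =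
      ((coactChar ΔY ρ).flip (a * a')).lTensor Y (canonThree ΔY y y') := by
  rw [mul_tmul, S.mulRight_partialSlice hy₀, lTensor_lTensor]
  congr 2
  exact LinearMap.ext fun t => (S.coactChar_mul t a a').symm

theorem mul_partialSlice {y₀ : Y} (hy₀ : εY y₀ = 1) (y' : Y) (a' : A) (y : Y) (a : A) :
    (y' ⊗ₜ[k] a') * S.partialSlice y₀ y a =
      ((coactChar ΔY ρ).flip (a' * a)).lTensor Y (canonTwo ΔY y' y) := by
  rw [tmul_mul, S.mulLeft_partialSlice hy₀, lTensor_lTensor]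
  congr 2
  exact LinearMap.ext fun t => (S.mul_coactChar t a' a).symm

omit S in
/-- `(ι ⊗ π)`-type detection: a linear condition on `Y ⊗ A` that factors through `ρ`. -/
theorem lTensor_coactChar_flip_eq_zero (x : Y ⊗[k] A)
    (hx : ∀ t, (coactChar ΔY ρ t).lTensor Y x = 0) :
    (coactChar ΔY ρ).flip.lTensor Y x = 0 :=
  lTensor_eq_zero_of_joint (coactChar ΔY ρ) (coactChar ΔY ρ).flip
    (fun _ hv => LinearMap.ext hv) x hx

/-- After covering by `u`, the slice of `y ⊗ a` depends on `a` only through the function `t ↦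
χ(t)a`, and this function vanishes on `x` by hypothesis. -/
theorem slice_eq_zero {y₀ : Y} (hy₀ : εY y₀ = 1) {a₀ : A} (ha₀ : εA a₀ = 1) (x : Y ⊗[k] A)
    (hx : ∀ t, (coactChar ΔY ρ t).lTensor Y x = 0) :
    S.slice y₀ a₀ x = 0 := by
  refine ext_mulLeft_rTensor S.nondeg_right fun u => ?_
  have e : (LinearMap.mulLeft k u).rTensor A ∘ₗ
      S.slice y₀ a₀ =
      TensorProduct.lift ((LinearMap.lTensorHom Y).flip ∘ₗ canonTwo ΔY u) ∘ₗ
        (coactChar ΔY ρ).flip.lTensor Y := TensorProduct.ext' fun y a => by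
    rw [LinearMap.comp_apply, S.slice_tmul y₀ ha₀, S.mulLeft_partialSlice hy₀]
    rfl
  rw [← LinearMap.comp_apply, e, LinearMap.comp_apply, lTensor_coactChar_flip_eq_zero x hx,
    map_zero, map_zero]

theorem lTensor_coactChar_mul (t s : Y) (a : A) (x : Y ⊗[k] A) :
    (coactChar ΔY ρ t).lTensor Y x * (s ⊗ₜ[k] a) = x * (s ⊗ₜ[k] coactChar ΔY ρ t a) := by
  rw [mul_tmul, mul_tmul, rTensor_lTensor_comm, lTensor_lTensor]
  congr 2
  exact LinearMap.ext fun b => ((S.coactChar_mul t b a).symm.trans (S.mul_coactChar t b a))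

theorem mul_lTensor_coactChar (t s : Y) (a : A) (x : Y ⊗[k] A) :
    (s ⊗ₜ[k] a) * (coactChar ΔY ρ t).lTensor Y x = (s ⊗ₜ[k] coactChar ΔY ρ t a) * x := by
  rw [tmul_mul, tmul_mul, rTensor_lTensor_comm, lTensor_lTensor]
  congr 2
  exact LinearMap.ext fun b => ((S.mul_coactChar t a b).symm.trans (S.coactChar_mul t a b))

/-- Because `A` is commutative, `χ(t)` can be moved from one factor of a product to the other;
nondegeneracy of `Y ⊗ A` then concludes. -/
theorem lTensor_coactChar_eq_zero_of_mul (x : Y ⊗[k] A)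
    (hx : ∀ (v : Y ⊗[k] Y) (a : A), x * ((coactChar ΔY ρ).flip a).lTensor Y v = 0) (t : Y) :
    (coactChar ΔY ρ t).lTensor Y x = 0 := by
  refine S.nondeg_tensor.1 _ fun b => ?_
  induction b using TensorProduct.induction_on with
  | zero => rw [mul_zero]
  | add b c hb hc => rw [mul_add, hb, hc, add_zero]
  | tmul s a => rw [S.lTensor_coactChar_mul]; exact hx (s ⊗ₜ[k] t) a

theorem lTensor_coactChar_eq_zero_of_mul' (x : Y ⊗[k] A)
    (hx : ∀ (v : Y ⊗[k] Y) (a : A), ((coactChar ΔY ρ).flip a).lTensor Y v * x = 0) (t : Y) :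
    (coactChar ΔY ρ t).lTensor Y x = 0 := by
  refine S.nondeg_tensor.2 _ fun b => ?_
  induction b using TensorProduct.induction_on with
  | zero => rw [zero_mul]
  | add b c hb hc => rw [add_mul, hb, hc, add_zero]
  | tmul s a => rw [S.mul_lTensor_coactChar]; exact hx (s ⊗ₜ[k] t) a

omit S in
theorem eq_zero_of_mul (h : IsMultiplierHopf ΔA) {Z : Type*} [AddCommGroup Z] [Module k Z]
    (f : A →ₗ[k] Z) (hf : ∀ a b, f (a * b) = 0) (a : A) : f a = 0 := by
  obtain ⟨w, rfl⟩ := h.hopfCounit_spec.mul'_surjective h a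
  induction w using TensorProduct.induction_on with
  | zero => simp only [map_zero]
  | add x y hx hy => simp only [map_add, hx, hy, add_zero]
  | tmul a b => exact hf a b

theorem smashCounit_eq_one {y₀ : Y} (hy₀ : εY y₀ = 1) {a₀ : A} (ha₀ : εA a₀ = 1) : smashCounit ΔA ΔY (y₀ ⊗ₜ[k] a₀) = 1 := by
  rw [smashCounit_tmul, hy₀, ha₀, one_mul]

theorem slice_mul {y₀ : Y} (hy₀ : εY y₀ = 1) {a₀ : A} (ha₀ : εA a₀ = 1)
    (b c : Y ⊗[k] A) : S.slice y₀ a₀ (b * c) = S.slice y₀ a₀ b * S.slice y₀ a₀ c :=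
  MultHopf.sliceMap_mul (S.isPreMultiplierBialgebra hy₀)
    (S.isLeftCounit (S.isPreMultiplierBialgebra hy₀)) (S.smashCounit_eq_one hy₀ ha₀) b c

theorem slice_slice {y₀ : Y} (hy₀ : εY y₀ = 1) {a₀ : A} (ha₀ : εA a₀ = 1)
    (b : Y ⊗[k] A) : S.slice y₀ a₀ (S.slice y₀ a₀ b) = S.slice y₀ a₀ b :=
  MultHopf.sliceMap_sliceMap (S.isPreMultiplierBialgebra hy₀)
    (S.isLeftCounit (S.isPreMultiplierBialgebra hy₀)) (S.smashCounit_eq_one hy₀ ha₀) b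

/-- The hypothesis says that `π(c)` annihilates `π(B)`, hence `π(B)B`. As `Δ_Y(Y)(Y ⊗ 1)` spans `Y ⊗
Y` and `A` is spanned by products, the latter contains all `s ⊗ χ(t)a`. So every `χ(t)` kills
`π(c)`, and therefore `π(π(c)) = 0`. -/
theorem slice_eq_zero_of_mul {y₀ : Y} (hy₀ : εY y₀ = 1) {a₀ : A} (ha₀ : εA a₀ = 1)
    (c : Y ⊗[k] A) (hc : ∀ b, S.slice y₀ a₀ (c * b) = 0) : S.slice y₀ a₀ c = 0 := by
  rw [← S.slice_slice hy₀ ha₀]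
  refine S.slice_eq_zero hy₀ ha₀ _ (S.lTensor_coactChar_eq_zero_of_mul _ fun v a => ?_)
  have key : ∀ (y y' : Y) (a a' : A),
      S.slice y₀ a₀ c * ((coactChar ΔY ρ).flip (a * a')).lTensor Y (canonThree ΔY y y') = 0 := by
    intro y y' a a'
    rw [← S.partialSlice_mul hy₀, ← S.slice_tmul y₀ ha₀, ← mul_assoc,
      ← S.slice_mul hy₀ ha₀, hc, zero_mul]
  have h₁ : ∀ (v : Y ⊗[k] Y) (a a' : A),
      S.slice y₀ a₀ c * ((coactChar ΔY ρ).flip (a * a')).lTensor Y v = 0 := fun v a a' =>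
    forall_of_surjective_lift S.right.canonThree_surjective
      (f := LinearMap.mulLeft k (S.slice y₀ a₀ c) ∘ₗ ((coactChar ΔY ρ).flip (a * a')).lTensor Y)
      (g := 0)
      (fun y y' => key y y' a a') v
  exact eq_zero_of_mul S.left.toIsMultiplierHopf (LinearMap.mulLeft k (S.slice y₀ a₀ c) ∘ₗ
    (LinearMap.lTensorHom Y ∘ₗ (coactChar ΔY ρ).flip).flip v) (fun a a' => h₁ v a a') a

theorem slice_eq_zero_of_mul' {y₀ : Y} (hy₀ : εY y₀ = 1) {a₀ : A} (ha₀ : εA a₀ = 1)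
    (c : Y ⊗[k] A) (hc : ∀ b, S.slice y₀ a₀ (b * c) = 0) : S.slice y₀ a₀ c = 0 := by
  rw [← S.slice_slice hy₀ ha₀]
  refine S.slice_eq_zero hy₀ ha₀ _ (S.lTensor_coactChar_eq_zero_of_mul' _ fun v a => ?_)
  have key : ∀ (y y' : Y) (a a' : A),
      ((coactChar ΔY ρ).flip (a' * a)).lTensor Y (canonTwo ΔY y' y) * S.slice y₀ a₀ c = 0 := by
    intro y y' a a'
    rw [← S.mul_partialSlice hy₀, ← S.slice_tmul y₀ ha₀, mul_assoc,
      ← S.slice_mul hy₀ ha₀, hc, mul_zero]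
  have h₁ : ∀ (v : Y ⊗[k] Y) (a a' : A),
      ((coactChar ΔY ρ).flip (a * a')).lTensor Y v * S.slice y₀ a₀ c = 0 := fun v a a' =>
    forall_of_surjective_lift S.right.toIsMultiplierHopf.bijective_two.2
      (f := LinearMap.mulRight k (S.slice y₀ a₀ c) ∘ₗ ((coactChar ΔY ρ).flip (a * a')).lTensor Y)
      (g := 0)
      (fun y y' => key y' y a' a) v
  exact eq_zero_of_mul S.left.toIsMultiplierHopf (LinearMap.mulRight k (S.slice y₀ a₀ c) ∘ₗ
    (LinearMap.lTensorHom Y ∘ₗ (coactChar ΔY ρ).flip).flip v) (fun a a' => h₁ v a a') a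

/-- Modulo the kernel of the slice, every element lies in the span of the elements `s ⊗ (ι ⊗ ε)T(u ⊗ a)`.
-/
theorem exists_slice_eq {y₀ : Y} (hy₀ : εY y₀ = 1) {a₀ : A} (ha₀ : εA a₀ = 1) (b : Y ⊗[k] A) :
    ∃ b' ∈ Submodule.span k {x : Y ⊗[k] A | ∃ s u a, x = s ⊗ₜ[k] coactChar ΔY ρ u a},
      S.slice y₀ a₀ b' = S.slice y₀ a₀ b := by
  set P := Submodule.span k {x : Y ⊗[k] A | ∃ s u a, x = s ⊗ₜ[k] coactChar ΔY ρ u a}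
  suffices H : ∀ b, S.slice y₀ a₀ b ∈ P.map (S.slice y₀ a₀) from H b
  have key : ∀ z u a a', S.slice y₀ a₀ ((z * u) ⊗ₜ[k] (a * a')) ∈ P.map (S.slice y₀ a₀) := by
    intro z u a a'
    -- The slice of a product is unchanged when one factor is replaced by its own slice; that slice
    -- brings in the factors `χ`.
    refine ⟨(z ⊗ₜ[k] a) * S.slice y₀ a₀ (u ⊗ₜ[k] a'), ?_, ?_⟩
    · rw [S.slice_tmul y₀ ha₀, S.mul_partialSlice hy₀]
      induction canonTwo ΔY z u using TensorProduct.induction_on with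
      | zero => rw [map_zero]; exact P.zero_mem
      | add x y hx hy => rw [map_add]; exact P.add_mem hx hy
      | tmul s t => exact Submodule.subset_span ⟨s, t, a * a', rfl⟩
    · rw [S.slice_mul hy₀ ha₀, S.slice_slice hy₀ ha₀, ← S.slice_mul hy₀ ha₀,
        Algebra.TensorProduct.tmul_mul_tmul]
  intro b
  -- Membership becomes the vanishing of a linear map to the quotient, which may be tested on
  -- products in each leg.
  rw [← Submodule.Quotient.mk_eq_zero, ← Submodule.mkQ_apply]
  have h₁ : ∀ z u a, (P.map (S.slice y₀ a₀)).mkQ (S.slice y₀ a₀ ((z * u) ⊗ₜ[k] a)) = 0 :=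
    fun z u a =>
    eq_zero_of_mul S.left.toIsMultiplierHopf
      ((P.map (S.slice y₀ a₀)).mkQ ∘ₗ S.slice y₀ a₀ ∘ₗ TensorProduct.mk k Y A (z * u))
      (fun a a' => (Submodule.Quotient.mk_eq_zero _).2 (key z u a a')) a
  induction b using TensorProduct.induction_on with
  | zero => simp only [map_zero]
  | add x y hx hy => simp only [map_add, hx, hy, add_zero]
  | tmul y a =>
    exact eq_zero_of_mul S.right.toIsMultiplierHopf
      ((P.map (S.slice y₀ a₀)).mkQ ∘ₗ S.slice y₀ a₀ ∘ₗ (TensorProduct.mk k Y A).flip a)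
      (fun z u => h₁ z u a) y

end IsSmashDatum

/-! ### Nondegeneracy of the restricted comultiplication -/

namespace IsSmashDatum

variable {k : Type*} [Field k]
variable {A : Type*} [NonUnitalRing A] [Module k A] [SMulCommClass k A A] [IsScalarTower k A A]
variable {Y : Type*} [NonUnitalRing Y] [Module k Y] [SMulCommClass k Y Y] [IsScalarTower k Y Y]
variable {ΔA : A →ₗ[k] M k (A ⊗[k] A)} {ΔY : Y →ₗ[k] M k (Y ⊗[k] Y)}
variable {ρ : Y →ₗ[k] M k (A ⊗[k] Y)} {E : M k (A ⊗[k] Y)} (S : IsSmashDatum ΔA ΔY ρ E)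

local notation "εY" => hopfCounit ΔY
local notation "εA" => hopfCounit ΔA

include S

theorem lTensor_coactLegs_covL (y s z : Y) (b : A) :
    (LinearMap.mul' k Y ∘ₗ (S.right.toIsMultiplierHopf.antipodeL εY ∘ₗ
      (TensorProduct.mk k Y Y).flip z).lTensor Y).lTensor A (coactLegs ρ Y (s ⊗ₜ[k] (b ⊗ₜ[k] y))) =
      (ρ s).left (b ⊗ₜ[k] S.right.toIsMultiplierHopf.antipodeL εY (y ⊗ₜ[k] z)) := by
  rw [← actL_apply, S.actL_tmul, LinearMap.comp_apply, LinearMap.flip_apply, coactLegs_tmul]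
  induction coactT ρ s b using TensorProduct.induction_on with
  | zero => simp only [map_zero, TensorProduct.zero_tmul]
  | add x y hx hy => simp only [map_add, TensorProduct.add_tmul, hx, hy]
  | tmul p q => rfl

/-- Apply `ι ⊗ S` and multiply on the two `Y` legs of the compatibility of `ρ` with `Δ_Y`. One side
gives `χ(y)` by `q₍₁₎S(q₍₂₎) = ε(q)`; the other is `ρ(y₍₁₎)` acting on `y₍₂₎₋₁ ⊗ S(y₍₂₎₀)`. The
cover by `w` inside the antipode keeps everything in `Y ⊗ A ⊗ Y`. -/
theorem coactChar_tmul_antipodeL_mem (y : Y) (a : A) (w z : Y) :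
    coactChar ΔY ρ y a ⊗ₜ[k] S.right.toIsMultiplierHopf.antipodeL εY (w ⊗ₜ[k] z) ∈
      Submodule.span k {x | ∃ v w, x = (ρ v).left w} := by
  set R := Submodule.span k {x | ∃ v w, x = (ρ v).left w}
  set f := (LinearMap.mul' k Y ∘ₗ (S.right.toIsMultiplierHopf.antipodeL εY ∘ₗ
      (TensorProduct.mk k Y Y).flip z).lTensor Y).lTensor A with hf
  have e : f (coactLegs ρ Y (S.covL (a ⊗ₜ[k] w) y)) =
      coactChar ΔY ρ y a ⊗ₜ[k] S.right.toIsMultiplierHopf.antipodeL εY (w ⊗ₜ[k] z) := by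
    rw [S.coactLegs_covL, hf, lTensor_lTensor]
    change _ = sliceR εY (coactT ρ y a) ⊗ₜ[k] _
    induction coactT ρ y a using TensorProduct.induction_on with
    | zero => simp only [map_zero, TensorProduct.zero_tmul]
    | add x y hx hy => simp only [map_add, TensorProduct.add_tmul, hx, hy]
    | tmul p q =>
      rw [LinearMap.lTensor_tmul, LinearMap.comp_apply, LinearMap.comp_apply,
        S.right.toIsMultiplierHopf.mul'_antipodeL_canonFour S.counit_right, sliceR_tmul,
        TensorProduct.smul_tmul]
  rw [← e]
  induction S.covL (a ⊗ₜ[k] w) y using TensorProduct.induction_on with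
  | zero => simp only [map_zero]; exact R.zero_mem
  | add x y hx hy => simp only [map_add]; exact R.add_mem hx hy
  | tmul s x =>
    induction x using TensorProduct.induction_on with
    | zero => simp only [map_zero, TensorProduct.tmul_zero]; exact R.zero_mem
    | add x y hx hy => simp only [map_add, TensorProduct.tmul_add]; exact R.add_mem hx hy
    | tmul b t =>
      rw [hf, S.lTensor_coactLegs_covL t s z b]
      exact Submodule.subset_span ⟨s, _, rfl⟩

theorem coactChar_tmul_mem_left (u : Y) (a : A) (y : Y) :
    coactChar ΔY ρ u a ⊗ₜ[k] y ∈ Submodule.span k {x | ∃ v w, x = (ρ v).left w} := by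
  obtain ⟨w, rfl⟩ := S.right.toIsMultiplierHopf.antipodeL_surjective S.counit_right y
  induction w using TensorProduct.induction_on with
  | zero => rw [map_zero, TensorProduct.tmul_zero]; exact Submodule.zero_mem _
  | add x y hx hy => rw [map_add, TensorProduct.tmul_add]; exact Submodule.add_mem _ hx hy
  | tmul w z => exact S.coactChar_tmul_antipodeL_mem u a w z

theorem lTensor_coactLegs_covR (y s z : Y) (b : A) (F : Y ⊗[k] Y →ₗ[k] Y) :
    (LinearMap.mul' k Y ∘ₗ (F ∘ₗ TensorProduct.mk k Y Y z).rTensor Y ∘ₗ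
      (TensorProduct.comm k Y Y).toLinearMap).lTensor A
        (coactLegs ρ Y (s ⊗ₜ[k] (b ⊗ₜ[k] y))) = (ρ s).right (b ⊗ₜ[k] F (z ⊗ₜ[k] y)) := by
  rw [← actR_apply, S.actR_tmul, LinearMap.comp_apply, LinearMap.flip_apply, coactLegs_tmul]
  induction coactT ρ s b using TensorProduct.induction_on with
  | zero => simp only [map_zero, TensorProduct.zero_tmul]
  | add x y hx hy => simp only [map_add, TensorProduct.add_tmul, hx, hy]
  | tmul p q => rfl

/-- On the right the factor `y₍₁₎₀` must come last, so the relation needed is `S'(q₍₂₎)q₍₁₎ = ε(q)`,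
where `S'` is the antipode of the co-opposite. -/
theorem coactChar_tmul_antipodeR_mem (y : Y) (a : A) (w z : Y) :
    coactChar ΔY ρ y a ⊗ₜ[k] S.right.flip.antipodeR εY (z ⊗ₜ[k] w) ∈
      Submodule.span k {x | ∃ v w, x = (ρ v).right w} := by
  set R := Submodule.span k {x | ∃ v w, x = (ρ v).right w}
  set f := (LinearMap.mul' k Y ∘ₗ (S.right.flip.antipodeR εY ∘ₗ
    TensorProduct.mk k Y Y z).rTensor Y ∘ₗ (TensorProduct.comm k Y Y).toLinearMap).lTensor A with hf
  have e : f (coactLegs ρ Y (S.covR y (a ⊗ₜ[k] w))) =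
      coactChar ΔY ρ y a ⊗ₜ[k] S.right.flip.antipodeR εY (z ⊗ₜ[k] w) := by
    rw [S.coactLegs_covR, hf, lTensor_lTensor]
    change _ = sliceR εY (coactT ρ y a) ⊗ₜ[k] _
    induction coactT ρ y a using TensorProduct.induction_on with
    | zero => simp only [map_zero, TensorProduct.zero_tmul]
    | add x y hx hy => simp only [map_add, TensorProduct.add_tmul, hx, hy]
    | tmul p q =>
      rw [LinearMap.lTensor_tmul, LinearMap.comp_apply, LinearMap.comp_apply, LinearMap.comp_apply,
        LinearMap.flip_apply, LinearEquiv.coe_coe, ← canonThree_flip S.pre_right,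
        S.right.flip.mul'_antipodeR_canonThree (S.counit_right.flip S.pre_right), sliceR_tmul,
        TensorProduct.smul_tmul]
  rw [← e]
  induction S.covR y (a ⊗ₜ[k] w) using TensorProduct.induction_on with
  | zero => simp only [map_zero]; exact R.zero_mem
  | add x y hx hy => simp only [map_add]; exact R.add_mem hx hy
  | tmul s x =>
    induction x using TensorProduct.induction_on with
    | zero => simp only [map_zero, TensorProduct.tmul_zero]; exact R.zero_mem
    | add x y hx hy => simp only [map_add, TensorProduct.tmul_add]; exact R.add_mem hx hy
    | tmul b t =>
      rw [hf, S.lTensor_coactLegs_covR]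
      exact Submodule.subset_span ⟨s, _, rfl⟩

theorem coactChar_tmul_mem_right (u : Y) (a : A) (y : Y) :
    coactChar ΔY ρ u a ⊗ₜ[k] y ∈ Submodule.span k {x | ∃ v w, x = (ρ v).right w} := by
  obtain ⟨w, rfl⟩ := S.right.flip.antipodeR_surjective (S.counit_right.flip S.pre_right) y
  induction w using TensorProduct.induction_on with
  | zero => rw [map_zero, TensorProduct.tmul_zero]; exact Submodule.zero_mem _
  | add x y hx hy => rw [map_add, TensorProduct.tmul_add]; exact Submodule.add_mem _ hx hy
  | tmul z w => exact S.coactChar_tmul_antipodeR_mem u a w z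

omit S in
/-- A linear map that vanishes on a spanning set vanishes. -/
theorem eq_zero_of_span {V W : Type*} [AddCommGroup V] [Module k V] [AddCommGroup W] [Module k W]
    {s : Set V} (hs : Submodule.span k s = ⊤) (f : V →ₗ[k] W) (h : ∀ x ∈ s, f x = 0) (v : V) :
    f v = 0 := by
  have : s ⊆ LinearMap.ker f := h
  exact (Submodule.span_le.2 this) (hs ▸ Submodule.mem_top)

/-- `place((s ⊗ ρ(t)x) ⊗ d)` lies in the span of `Δ(B)(B ⊗ B)`. -/
theorem place_left_mem (s t : Y) (x : A ⊗[k] Y) (d : A) :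
    place A Y ((s ⊗ₜ[k] (ρ t).left x) ⊗ₜ[k] d) ∈
      Submodule.span k {x | ∃ b d, x = (S.smashComul b).left d} := by
  set P := Submodule.span k {x | ∃ b d, x = (S.smashComul b).left d}
  -- `Δ_A` is nondegenerate, so the elements `Δ_A(a)(a' ⊗ a'')` span, and an arbitrary `w` can stand
  -- in their place.
  have h₁ : ∀ y y' y'' w, P.mkQ (place A Y ((slotL ΔY ρ y y' y'').rTensor A w)) = 0 :=
    fun y y' y'' w => by
    refine eq_zero_of_span S.left.nondegenerateHom.1
      (P.mkQ ∘ₗ (place A Y).toLinearMap ∘ₗ (slotL ΔY ρ y y' y'').rTensor A) ?_ w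
    rintro _ ⟨a, v, rfl⟩
    induction v using TensorProduct.induction_on with
    | zero => simp only [map_zero]
    | add x y hx hy => simp only [map_add, hx, hy, add_zero]
    | tmul a' a'' =>
      refine (Submodule.Quotient.mk_eq_zero _).2 (Submodule.subset_span
        ⟨y ⊗ₜ[k] a, (y' ⊗ₜ[k] a') ⊗ₜ[k] (y'' ⊗ₜ[k] a''), ?_⟩)
      rw [S.smashComul_left]
      rfl
  -- Similarly `Δ_Y(y)(y' ⊗ 1)` spans `Y ⊗ Y`, so an arbitrary `v`, in particular `s ⊗ t`, is
  -- allowed.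
  have h₂ : ∀ (v : Y ⊗[k] Y) (p : A) (y'' : Y),
      P.mkQ (place A Y ((actL ρ (p ⊗ₜ[k] y'')).lTensor Y v ⊗ₜ[k] d)) = 0 := fun v p y'' =>
    forall_of_surjective_lift S.right.canonThree_surjective
      (f := P.mkQ ∘ₗ (place A Y).toLinearMap ∘ₗ (TensorProduct.mk k _ A).flip d ∘ₗ
        (actL ρ (p ⊗ₜ[k] y'')).lTensor Y) (g := 0)
      (fun y y' => h₁ y y' y'' (p ⊗ₜ[k] d)) v
  rw [← Submodule.Quotient.mk_eq_zero, ← Submodule.mkQ_apply]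
  induction x using TensorProduct.induction_on with
  | zero => simp only [map_zero, TensorProduct.tmul_zero, TensorProduct.zero_tmul]
  | add x y hx hy =>
    simp only [map_add, TensorProduct.tmul_add, TensorProduct.add_tmul, hx, hy, add_zero]
  | tmul p y'' => exact h₂ (s ⊗ₜ[k] t) p y''

/-- `place((s ⊗ xρ(t)) ⊗ d)` lies in the span of `(B ⊗ B)Δ(B)`. -/
theorem place_right_mem (s t : Y) (x : A ⊗[k] Y) (d : A) :
    place A Y ((s ⊗ₜ[k] (ρ t).right x) ⊗ₜ[k] d) ∈
      Submodule.span k {x | ∃ b d, x = (S.smashComul b).right d} := by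
  set P := Submodule.span k {x | ∃ b d, x = (S.smashComul b).right d}
  have h₁ : ∀ y y' y'' w, P.mkQ (place A Y ((slotR ΔY ρ y y' y'').rTensor A w)) = 0 :=
    fun y y' y'' w => by
    refine eq_zero_of_span S.left.nondegenerateHom.2
      (P.mkQ ∘ₗ (place A Y).toLinearMap ∘ₗ (slotR ΔY ρ y y' y'').rTensor A) ?_ w
    rintro _ ⟨a, v, rfl⟩
    induction v using TensorProduct.induction_on with
    | zero => simp only [map_zero]
    | add x y hx hy => simp only [map_add, hx, hy, add_zero]
    | tmul a' a'' =>
      refine (Submodule.Quotient.mk_eq_zero _).2 (Submodule.subset_span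
        ⟨y ⊗ₜ[k] a, (y' ⊗ₜ[k] a') ⊗ₜ[k] (y'' ⊗ₜ[k] a''), ?_⟩)
      rw [S.smashComul_right]
      rfl
  have h₂ : ∀ (v : Y ⊗[k] Y) (p : A) (y'' : Y),
      P.mkQ (place A Y ((actR ρ (p ⊗ₜ[k] y'')).lTensor Y v ⊗ₜ[k] d)) = 0 := fun v p y'' =>
    forall_of_surjective_lift S.right.toIsMultiplierHopf.bijective_two.2
      (f := P.mkQ ∘ₗ (place A Y).toLinearMap ∘ₗ (TensorProduct.mk k _ A).flip d ∘ₗ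
        (actR ρ (p ⊗ₜ[k] y'')).lTensor Y) (g := 0)
      (fun y' y => h₁ y y' y'' (p ⊗ₜ[k] d)) v
  rw [← Submodule.Quotient.mk_eq_zero, ← Submodule.mkQ_apply]
  induction x using TensorProduct.induction_on with
  | zero => simp only [map_zero, TensorProduct.tmul_zero, TensorProduct.zero_tmul]
  | add x y hx hy =>
    simp only [map_add, TensorProduct.tmul_add, TensorProduct.add_tmul, hx, hy, add_zero]
  | tmul p y'' => exact h₂ (s ⊗ₜ[k] t) p y''

omit S in
theorem place_mem_of_span {P : Submodule k ((Y ⊗[k] A) ⊗[k] (Y ⊗[k] A))} {s : Set (A ⊗[k] Y)}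
    (u : Y) (d : A) (h : ∀ x ∈ s, place A Y ((u ⊗ₜ[k] x) ⊗ₜ[k] d) ∈ P) {x : A ⊗[k] Y}
    (hx : x ∈ Submodule.span k s) : place A Y ((u ⊗ₜ[k] x) ⊗ₜ[k] d) ∈ P := by
  induction hx using Submodule.span_induction with
  | mem z hz => exact h z hz
  | zero => simp only [TensorProduct.tmul_zero, TensorProduct.zero_tmul, map_zero, P.zero_mem]
  | add z w _ _ h₁ h₂ =>
    simp only [TensorProduct.tmul_add, TensorProduct.add_tmul, map_add, P.add_mem h₁ h₂]
  | smul c z _ h₁ =>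
    rw [TensorProduct.tmul_smul, ← TensorProduct.smul_tmul', map_smul]
    exact P.smul_mem c h₁

theorem coactChar_mem_left (s u : Y) (a : A) (y : Y) (d : A) :
    (s ⊗ₜ[k] coactChar ΔY ρ u a) ⊗ₜ[k] (y ⊗ₜ[k] d) ∈
      Submodule.span k {x | ∃ b d, x = (S.smashComul b).left d} := by
  rw [← place_tmul]
  refine place_mem_of_span s d ?_ (S.coactChar_tmul_mem_left u a y)
  rintro _ ⟨v, w, rfl⟩
  exact S.place_left_mem s v w d

theorem coactChar_mem_right (s u : Y) (a : A) (y : Y) (d : A) :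
    (s ⊗ₜ[k] coactChar ΔY ρ u a) ⊗ₜ[k] (y ⊗ₜ[k] d) ∈
      Submodule.span k {x | ∃ b d, x = (S.smashComul b).right d} := by
  rw [← place_tmul]
  refine place_mem_of_span s d ?_ (S.coactChar_tmul_mem_right u a y)
  rintro _ ⟨v, w, rfl⟩
  exact S.place_right_mem s v w d

/-- Only the first tensor factor has to be adjusted modulo the kernel of the slice; the second is
arbitrary in `hP`. -/
theorem exists_map_slice_eq {y₀ : Y} (hy₀ : εY y₀ = 1) {a₀ : A} (ha₀ : εA a₀ = 1)
    {P : Submodule k ((Y ⊗[k] A) ⊗[k] (Y ⊗[k] A))}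
    (hP : ∀ s u a y d, (s ⊗ₜ[k] coactChar ΔY ρ u a) ⊗ₜ[k] (y ⊗ₜ[k] d) ∈ P)
    (x : (Y ⊗[k] A) ⊗[k] (Y ⊗[k] A)) :
    ∃ s ∈ P, TensorProduct.map (S.slice y₀ a₀) (S.slice y₀ a₀) s =
      TensorProduct.map (S.slice y₀ a₀) (S.slice y₀ a₀) x := by
  induction x using TensorProduct.induction_on with
  | zero => exact ⟨0, P.zero_mem, rfl⟩
  | add x y hx hy =>
    obtain ⟨s, hs, es⟩ := hx
    obtain ⟨t, ht, et⟩ := hy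
    exact ⟨s + t, P.add_mem hs ht, by rw [map_add, map_add, es, et]⟩
  | tmul b c =>
    obtain ⟨b', hb', e⟩ := S.exists_slice_eq hy₀ ha₀ b
    refine ⟨b' ⊗ₜ[k] c, ?_, by rw [TensorProduct.map_tmul, TensorProduct.map_tmul, e]⟩
    clear e
    induction hb' using Submodule.span_induction with
    | mem z hz =>
      obtain ⟨s, u, a, rfl⟩ := hz
      induction c using TensorProduct.induction_on with
      | zero => rw [TensorProduct.tmul_zero]; exact P.zero_mem
      | add x y hx hy => rw [TensorProduct.tmul_add]; exact P.add_mem hx hy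
      | tmul y d => exact hP s u a y d
    | zero => rw [TensorProduct.zero_tmul]; exact P.zero_mem
    | add z w _ _ h₁ h₂ => rw [TensorProduct.add_tmul]; exact P.add_mem h₁ h₂
    | smul c z _ h₁ => rw [← TensorProduct.smul_tmul']; exact P.smul_mem c h₁

theorem exists_partialSmash {y₀ : Y} (hy₀ : εY y₀ = 1) {a₀ : A} (ha₀ : εA a₀ = 1) :
    ∃ C : NonUnitalSubalgebra k (Y ⊗[k] A),
      C.toSubmodule = sliceSubspace S.smashComul (smashCounit ΔA ΔY) ∧
      ∃ ΔC : C →ₗ[k] M k (C ⊗[k] C), IsRestriction C S.smashComul ΔC ∧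
        IsMultiplierBialgebra ΔC ∧
        IsLeftCounit ΔC (smashCounit ΔA ΔY ∘ₗ C.toSubmodule.subtype) ∧
        IsRightCounit ΔC (smashCounit ΔA ΔY ∘ₗ C.toSubmodule.subtype) :=
  exists_restriction_slice (S.isPreMultiplierBialgebra hy₀)
    (S.isLeftCounit (S.isPreMultiplierBialgebra hy₀)) (S.smashCounit_eq_one hy₀ ha₀)
    (S.slice_eq_zero_of_mul hy₀ ha₀) (S.slice_eq_zero_of_mul' hy₀ ha₀)
    (S.exists_map_slice_eq hy₀ ha₀ S.coactChar_mem_left)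
    (S.exists_map_slice_eq hy₀ ha₀ S.coactChar_mem_right)

end IsSmashDatum

/-! ### The zero algebra -/

section Subsingleton

variable {k : Type*} [Field k]
variable {B : Type*} [NonUnitalRing B] [Module k B] [SMulCommClass k B B] [IsScalarTower k B B]

theorem subsingleton_tensor_left {U V : Type*} [AddCommGroup U] [Module k U] [AddCommGroup V]
    [Module k V] (h : Subsingleton U) : Subsingleton (U ⊗[k] V) :=
  ⟨fun x y => by
    have e : (LinearMap.id : U ⊗[k] V →ₗ[k] U ⊗[k] V) = 0 := TensorProduct.ext' fun u v => by
      rw [Subsingleton.elim u 0, TensorProduct.zero_tmul, map_zero, map_zero]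
    exact (LinearMap.congr_fun e x).trans (LinearMap.congr_fun e y).symm⟩

theorem subsingleton_tensor_right {U V : Type*} [AddCommGroup U] [Module k U] [AddCommGroup V]
    [Module k V] (h : Subsingleton V) : Subsingleton (U ⊗[k] V) :=
  ⟨fun x y => by
    have e : (LinearMap.id : U ⊗[k] V →ₗ[k] U ⊗[k] V) = 0 := TensorProduct.ext' fun u v => by
      rw [Subsingleton.elim v 0, TensorProduct.tmul_zero, map_zero, map_zero]
    exact (LinearMap.congr_fun e x).trans (LinearMap.congr_fun e y).symm⟩

theorem subsingleton_multiplier (h : Subsingleton B) : Subsingleton (M k B) :=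
  ⟨fun _ _ => M.ext_both (LinearMap.ext fun _ => Subsingleton.elim _ _)
    (LinearMap.ext fun _ => Subsingleton.elim _ _)⟩

theorem isMultiplierBialgebra_of_subsingleton (h : Subsingleton B)
    (Δ : B →ₗ[k] M k (B ⊗[k] B)) : IsMultiplierBialgebra Δ := by
  have h₂ : Subsingleton (B ⊗[k] B) := subsingleton_tensor_left h
  have h₃ : Subsingleton (B ⊗[k] (B ⊗[k] B)) := subsingleton_tensor_left h
  have h₄ : Subsingleton (M k (B ⊗[k] B)) := subsingleton_multiplier h₂
  exact
    { nondegenerate := ⟨fun _ _ => Subsingleton.elim _ _, fun _ _ => Subsingleton.elim _ _⟩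
      map_mul := fun _ _ => Subsingleton.elim _ _
      mem_one := fun _ _ => ⟨0, Subsingleton.elim _ _⟩
      mem_two := fun _ _ => ⟨0, Subsingleton.elim _ _⟩
      mem_three := fun _ _ => ⟨0, Subsingleton.elim _ _⟩
      mem_four := fun _ _ => ⟨0, Subsingleton.elim _ _⟩
      coassoc := fun _ _ _ => Subsingleton.elim _ _
      nondegenerateHom := ⟨Subsingleton.elim _ _, Subsingleton.elim _ _⟩ }

theorem map_mul_of_subsingleton (h : Subsingleton B) (ε : B →ₗ[k] k) (a b : B) :
    ε (a * b) = ε a * ε b := by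
  rw [Subsingleton.elim a 0, zero_mul, map_zero, zero_mul]

theorem exists_restriction_of_subsingleton (h : Subsingleton B) (Δ : B →ₗ[k] M k (B ⊗[k] B))
    (ε : B →ₗ[k] k) :
    ∃ C : NonUnitalSubalgebra k B, C.toSubmodule = sliceSubspace Δ ε ∧
      ∃ ΔC : C →ₗ[k] M k (C ⊗[k] C), IsRestriction C Δ ΔC ∧ IsMultiplierBialgebra ΔC ∧
        IsLeftCounit ΔC (ε ∘ₗ C.toSubmodule.subtype) ∧
        IsRightCounit ΔC (ε ∘ₗ C.toSubmodule.subtype) := by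
  have h₂ : Subsingleton (B ⊗[k] B) := subsingleton_tensor_left h
  refine ⟨⊥, Subsingleton.elim _ _, ?_⟩
  have hC : Subsingleton (⊥ : NonUnitalSubalgebra k B) := Subtype.val_injective.subsingleton
  refine ⟨0, fun _ _ => ⟨Subsingleton.elim _ _, Subsingleton.elim _ _⟩,
    isMultiplierBialgebra_of_subsingleton hC _,
    ⟨map_mul_of_subsingleton hC _, fun _ _ => Subsingleton.elim _ _,
      fun _ _ => Subsingleton.elim _ _⟩,
    ⟨map_mul_of_subsingleton hC _, fun _ _ => Subsingleton.elim _ _,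
      fun _ _ => Subsingleton.elim _ _⟩⟩

theorem IsMultiplierHopf.subsingleton_or_exists {Δ : B →ₗ[k] M k (B ⊗[k] B)}
    (h : IsMultiplierHopf Δ) : Subsingleton B ∨ ∃ b, hopfCounit Δ b = 1 := by
  by_cases hB : ∃ x : B, x ≠ 0
  · obtain ⟨x, hx⟩ := hB
    exact Or.inr (h.hopfCounit_spec.exists_eq_one h x hx)
  · refine Or.inl ⟨fun x y => ?_⟩
    rw [not_exists_not.1 hB x, not_exists_not.1 hB y]

end Subsingleton

/-- Slicing needs an element of counit one in both `Y` and `A`. These exist unless one of the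
algebras is zero; in that case `Y ⊗ A` is zero and every assertion is trivial. -/
theorem IsSmashDatum.exists_smash {k : Type*} [Field k]
    {A : Type*} [NonUnitalRing A] [Module k A] [SMulCommClass k A A] [IsScalarTower k A A]
    {Y : Type*} [NonUnitalRing Y] [Module k Y] [SMulCommClass k Y Y] [IsScalarTower k Y Y]
    {ΔA : A →ₗ[k] M k (A ⊗[k] A)} {ΔY : Y →ₗ[k] M k (Y ⊗[k] Y)}
    {ρ : Y →ₗ[k] M k (A ⊗[k] Y)} {E : M k (A ⊗[k] Y)} (S : IsSmashDatum ΔA ΔY ρ E) :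
    IsPreMultiplierBialgebra S.smashComul ∧
      ∃ C : NonUnitalSubalgebra k (Y ⊗[k] A),
        C.toSubmodule = sliceSubspace S.smashComul (smashCounit ΔA ΔY) ∧
        ∃ ΔC : C →ₗ[k] M k (C ⊗[k] C), IsRestriction C S.smashComul ΔC ∧
          IsMultiplierBialgebra ΔC ∧
          IsLeftCounit ΔC (smashCounit ΔA ΔY ∘ₗ C.toSubmodule.subtype) ∧
          IsRightCounit ΔC (smashCounit ΔA ΔY ∘ₗ C.toSubmodule.subtype) := by
  have zero : Subsingleton (Y ⊗[k] A) → _ := fun h =>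
    And.intro (isMultiplierBialgebra_of_subsingleton h S.smashComul).toIsPreMultiplierBialgebra
      (exists_restriction_of_subsingleton h S.smashComul (smashCounit ΔA ΔY))
  obtain h | ⟨y₀, hy₀⟩ := S.right.toIsMultiplierHopf.subsingleton_or_exists
  · exact zero (subsingleton_tensor_left h)
  obtain h | ⟨a₀, ha₀⟩ := S.left.toIsMultiplierHopf.subsingleton_or_exists
  · exact zero (subsingleton_tensor_right h)
  exact ⟨S.isPreMultiplierBialgebra hy₀, S.exists_partialSmash hy₀ ha₀⟩

end

end MultHopf

theorem mainTheorem9 {k : Type*} [Field k]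
    {A : Type*} [NonUnitalRing A] [Module k A] [SMulCommClass k A A] [IsScalarTower k A A]
    {Y : Type*} [NonUnitalRing Y] [Module k Y] [SMulCommClass k Y Y] [IsScalarTower k Y Y]
    (ΔA : A →ₗ[k] MultHopf.M k (A ⊗[k] A)) (hA : MultHopf.IsRegularMultiplierHopf ΔA)
    (ΔY : Y →ₗ[k] MultHopf.M k (Y ⊗[k] Y)) (hY : MultHopf.IsRegularMultiplierHopf ΔY)
    (hcomm : ∀ a b : A, a * b = b * a)
    (ρ : Y →ₗ[k] MultHopf.M k (A ⊗[k] Y)) (E : MultHopf.M k (A ⊗[k] Y))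
    (hρ : MultHopf.IsSymmetricPartialComoduleBialgebra ΔA ΔY ρ E) :
    ∃ Δ : Y ⊗[k] A →ₗ[k] MultHopf.M k ((Y ⊗[k] A) ⊗[k] (Y ⊗[k] A)),
      MultHopf.IsSmashComul ΔA ΔY ρ Δ ∧
      MultHopf.IsPreMultiplierBialgebra Δ ∧
      MultHopf.IsLeftCounit Δ (MultHopf.smashCounit ΔA ΔY) ∧
      ∃ C : NonUnitalSubalgebra k (Y ⊗[k] A),
        C.toSubmodule = MultHopf.sliceSubspace Δ (MultHopf.smashCounit ΔA ΔY) ∧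
        ∃ ΔC : C →ₗ[k] MultHopf.M k (C ⊗[k] C),
          MultHopf.IsRestriction C Δ ΔC ∧
          MultHopf.IsMultiplierBialgebra ΔC ∧
          MultHopf.IsLeftCounit ΔC
            (MultHopf.smashCounit ΔA ΔY ∘ₗ C.toSubmodule.subtype) ∧
          MultHopf.IsRightCounit ΔC
            (MultHopf.smashCounit ΔA ΔY ∘ₗ C.toSubmodule.subtype) := by
  have S : MultHopf.IsSmashDatum ΔA ΔY ρ E := ⟨hA, hY, hcomm, hρ⟩
  exact ⟨S.smashComul, S.isSmashComul, S.exists_smash.1, S.isLeftCounit S.exists_smash.1,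
    S.exists_smash.2⟩
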